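/- All graphs are finite and simple, and $|G|$ denotes the number of vertices of $G$. If $H$ is a graph and $P$ is an induced path of $H$ of length (number of edges) at least two, all of whose internal vertices have degree two in $H$, then $H$ is said to be obtained by *adding the handle* $P$ to the graph $H\setminus P^*$, where $P^*$ is the set of internal vertices of $P$. For an integer $\beta\ge 2$, a graph is *$\beta$-buildable* if it can be constructed, starting from a two-vertex graph with no edges, by repeatedly adding a handle of length at least $\beta$. A graph $G$ is *$\varepsilon$-sparse* if every vertex has degree less than $\varepsilon|G|$; it is *$(\gamma,\delta)$-coherent* if there are no disjoint sets $A,B\subseteq V(G)$ with no edges between $A$ and $B$ such that $|A|\ge\gamma$ and $|B|\ge\delta$; and $G$ *contains* $H$ if some induced subgraph of $G$ is isomorphic to $H$. **Theorem.** Let $\beta\ge 2$ be an integer with $\lfloor(\beta-3)/3\rfloor\ge 1$ (that is, $\beta\ge 6$), let $H$ be a $\beta$-buildable graph, and let $c>1/\lfloor(\beta-3)/3\rfloor$ be a real number. Then there exists $\varepsilon>0$ such that every $\varepsilon$-sparse $(\varepsilon|G|^{1-c},\varepsilon|G|^{1-c})$-coherent graph $G$ with $|G|>1$ contains $H$. 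-/

import Mathlib

namespace SimpleGraph

/-- `A, B` is an anticomplete pair of `G`: the sets are disjoint and no vertex of `A` has a
neighbour in `B`. -/
def IsAnticompletePair {V : Type*} (G : SimpleGraph V) (A B : Set V) : Prop :=
  Disjoint A B ∧ ∀ a ∈ A, ∀ b ∈ B, ¬ G.Adj a b

/-- `G` is `ε`-sparse: every vertex has degree less than `ε |G|` (for finite graphs). -/
def IsSparse {V : Type*} (G : SimpleGraph V) (ε : ℝ) : Prop :=
  ∀ v : V, ((G.neighborSet v).ncard : ℝ) < ε * (Nat.card V : ℝ)

/-- `G` is `(γ, δ)`-coherent: there is no anticomplete pair `A, B` with `|A| ≥ γ` and `|B| ≥ δ`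
(for finite graphs). -/
def IsCoherent {V : Type*} (G : SimpleGraph V) (γ δ : ℝ) : Prop :=
  ¬ ∃ A B : Set V, G.IsAnticompletePair A B ∧ γ ≤ (A.ncard : ℝ) ∧ δ ≤ (B.ncard : ℝ)

/-- The set of internal vertices of an induced path `P` of length `ℓ` in `H`, where the path is
given as an induced copy in `H` of the path with vertices `0, 1, …, ℓ`. -/
def pathInterior {V : Type*} {H : SimpleGraph V} {ℓ : ℕ} (P : pathGraph (ℓ + 1) ↪g H) : Set V :=
  P '' {i | i ≠ 0 ∧ i ≠ Fin.last ℓ}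

/-- The induced path `P` is a handle of `H`: it has length at least two, and all its internal
vertices have degree two in `H`. Then `H` is obtained from the graph `H \ P*` by adding the
handle `P`, where `P*` is the set of internal vertices of `P`. -/
def IsHandle {V : Type*} (H : SimpleGraph V) {ℓ : ℕ} (P : pathGraph (ℓ + 1) ↪g H) : Prop :=
  2 ≤ ℓ ∧ ∀ v ∈ pathInterior P, (H.neighborSet v).ncard = 2

/-- `H` is `β`-buildable: it can be constructed, starting from a two-vertex graph with no edges, by
repeatedly adding a handle of length at least `β`. -/
inductive IsBuildable.{u} (β : ℕ) : ∀ {V : Type u}, SimpleGraph V → Prop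
  | two {V : Type u} (H : SimpleGraph V) (hcard : Nat.card V = 2) (hedge : H = ⊥) :
      IsBuildable β H
  | handle {V : Type u} (H : SimpleGraph V) {ℓ : ℕ} (P : pathGraph (ℓ + 1) ↪g H)
      (hP : H.IsHandle P) (hℓ : β ≤ ℓ)
      (hbuild : IsBuildable β (H.induce (pathInterior P)ᶜ)) :
      IsBuildable β H

end SimpleGraph

/-! ### Degenerate thresholds: `c ≥ 1`, and graphs with few vertices. -/

namespace SimpleGraph

variable {W : Type*}

/-! If `1 ≤ c`, the coherence thresholds are at most one, so a coherent graph is complete, which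
sparsity forbids. Let `c < 1` and `k = ⌊(β - 3) / 3⌋`. Then `k c > 1`, so `k ≥ 2`, and all handles
have length at least `3 k` and at least seven. Suppose that `G` contains no copy of `H`. Sparsity
and coherence make `n = |G|` larger than any prescribed constant. Put `n = q ^ E` with `E` fixed, so
that `q` is large and constants are absorbed by powers of `q`, and let `x` be a fixed negative power
of `q`.

Dense regime. Call `U` dense if degrees in `U` are at most `η |U|` and any two subsets of sizes at
least `x ^ t |U|` and `η |U|` have density at least `x` (`IsDense`). In a dense set a fraction `x ^
a` of all maps are induced copies of `H` (`LeafBuildable.denseClaim`). This is an induction over a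
construction from leaves and handles of length exactly seven; a longer handle is a few leaves
followed by a handle of length seven. A leaf is added by counting (`IsDense.card_attach_lo_lt`). For
a handle, vertices `y`, `y'` are attached to the two ends, and a neighbour `p` of `y` is joined to a
neighbour `q` of `y'` by a path `p a b q`; `IsDense.exists_le_card_linkEdges` supplies many of
these.

Sparse regime. As `G` has no copy of `H`, no subset of constant proportion is dense. The pairs
violating density, collected repeatedly, form a blockade (`DenseClaim.exists_blockade`): many
disjoint sets of about `x ^ t n` vertices with all degrees between them at most about `x ^ (t + 1)
n`. Inside it `H` is built with its vertices in different sets (`SetBuildable.blockadeClaim`). Let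
`m` be the size from which coherence yields an edge between two sets. After small deletions, sets of
fewer than `m` vertices expand by a factor `r` into every other set, where `m ≤ r ^ (k - 1)`. So
fewer than `k` steps from a vertex `z` reach `m` vertices, and coherence then joins `z` to most
vertices of the remaining sets by paths with at most `k` edges. Three such systems of paths link any
two vertices of different surviving sets by paths of one common length at most `3 k`
(`IsSetting.exists_hasLinks`), and links are lengthened edge by edge to the length of the handle.

The regimes fit together because `k c > 1`: `m` is about `n ^ (1 - c)` and `r` about `m ^ (1 / (k -
1))`, and the sets of the blockade must have more than `r m` vertices, which is possible as `(1 - c)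
k / (k - 1) < 1` (`exists_exponents`). -/

theorem isAnticompletePair_singleton {G : SimpleGraph W} {v w : W} (hne : v ≠ w)
    (h : ¬ G.Adj v w) : G.IsAnticompletePair {v} {w} := by
  refine ⟨by simpa using hne, ?_⟩
  rintro a rfl b rfl
  exact h

/-- Coherence with thresholds at most one forces all pairs of distinct vertices to be adjacent. -/
theorem IsCoherent.eq_top {G : SimpleGraph W} {γ δ : ℝ} (hG : G.IsCoherent γ δ) (hγ : γ ≤ 1)
    (hδ : δ ≤ 1) : G = ⊤ := by
  ext v w
  refine ⟨fun h => h.ne, fun hne => ?_⟩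
  by_contra hvw
  exact hG ⟨{v}, {w}, isAnticompletePair_singleton hne hvw, by simpa using hγ, by simpa using hδ⟩

theorem ncard_neighborSet_top [Finite W] (v : W) :
    ((⊤ : SimpleGraph W).neighborSet v).ncard = Nat.card W - 1 := by
  have h : (⊤ : SimpleGraph W).neighborSet v = {v}ᶜ := by
    ext w
    simp [eq_comm]
  rw [h, Set.ncard_compl, Set.ncard_singleton]

/-- A sparse graph with thresholds at most one for coherence has at most one vertex. -/
theorem IsSparse.not_isCoherent [Finite W] {G : SimpleGraph W} {ε γ δ : ℝ} (hε : ε ≤ 1 / 2)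
    (hW : 1 < Nat.card W) (hs : G.IsSparse ε) (hγ : γ ≤ 1) (hδ : δ ≤ 1) : ¬ G.IsCoherent γ δ := by
  intro hc
  obtain rfl := hc.eq_top hγ hδ
  obtain ⟨v⟩ : Nonempty W := (Nat.card_pos_iff.1 (by omega)).1
  have h := hs v
  have h2 : (2 : ℝ) ≤ Nat.card W := by exact_mod_cast hW
  rw [ncard_neighborSet_top, Nat.cast_sub hW.le] at h
  push_cast at h
  nlinarith

/-- The range `1 ≤ c`, in which no graph satisfies the hypotheses. -/
theorem not_isCoherent_of_one_le [Finite W] {G : SimpleGraph W} {c : ℝ} (hc : 1 ≤ c)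
    (hW : 1 < Nat.card W) (hs : G.IsSparse (1 / 2)) :
    ¬ G.IsCoherent (1 / 2 * (Nat.card W : ℝ) ^ (1 - c)) (1 / 2 * (Nat.card W : ℝ) ^ (1 - c)) := by
  have h1 : (1 : ℝ) ≤ Nat.card W := by exact_mod_cast hW.le
  have h : (Nat.card W : ℝ) ^ (1 - c) ≤ 1 := Real.rpow_le_one_of_one_le_of_nonpos h1 (by linarith)
  exact hs.not_isCoherent le_rfl hW (by linarith) (by linarith)

/-- Sparse coherent graphs have more than `ε⁻¹` vertices. -/
theorem inv_lt_card_of_isSparse_of_isCoherent [Finite W] {G : SimpleGraph W} {ε c : ℝ}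
    (hε0 : 0 < ε) (hε : ε ≤ 1 / 2) (hc : 0 ≤ c) (hW : 1 < Nat.card W) (hs : G.IsSparse ε)
    (hG : G.IsCoherent (ε * (Nat.card W : ℝ) ^ (1 - c)) (ε * (Nat.card W : ℝ) ^ (1 - c))) :
    ε⁻¹ < Nat.card W := by
  by_contra! hle
  have h1 : (1 : ℝ) ≤ Nat.card W := by exact_mod_cast hW.le
  have h : (Nat.card W : ℝ) ^ (1 - c) ≤ Nat.card W := by
    simpa using Real.rpow_le_rpow_of_exponent_le h1 (show 1 - c ≤ 1 by linarith)
  have h2 : ε * (Nat.card W : ℝ) ^ (1 - c) ≤ 1 := by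
    calc ε * (Nat.card W : ℝ) ^ (1 - c) ≤ ε * ε⁻¹ := by gcongr; exact h.trans hle
      _ = 1 := mul_inv_cancel₀ hε0.ne'
  exact hs.not_isCoherent hε hW h2 h2 hG

end SimpleGraph

/-! ### Constructions of `H` as chains of vertex sets. -/

namespace SimpleGraph

open Finset

section Copies

variable {V W : Type*}

/-- `p 0, …, p ℓ` is an induced path of `H` whose ends lie in `S`, whose internal vertices lie
outside `S`, and there are no edges between the interior and `S` other than the end edges. -/
structure IsAttachedPath (H : SimpleGraph V) (S : Finset V) (ℓ : ℕ) (p : ℕ → V) : Prop where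
  left_mem : p 0 ∈ S
  right_mem : p ℓ ∈ S
  notMem : ∀ i, 0 < i → i < ℓ → p i ∉ S
  inj : ∀ i ≤ ℓ, ∀ j ≤ ℓ, p i = p j → i = j
  adj_iff : ∀ i ≤ ℓ, ∀ j ≤ ℓ, (H.Adj (p i) (p j) ↔ i + 1 = j ∨ j + 1 = i)
  adj_mem_iff : ∀ i, 0 < i → i < ℓ → ∀ v ∈ S,
    (H.Adj (p i) v ↔ (i = 1 ∧ v = p 0) ∨ (i + 1 = ℓ ∧ v = p ℓ))

open Classical in
/-- The vertex sets obtained inside `H` by the moves that define `β`-buildable graphs. -/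
inductive SetBuildable (H : SimpleGraph V) (β : ℕ) : Finset V → Prop
  | two (a b : V) (hab : a ≠ b) (h : ¬ H.Adj a b) : SetBuildable H β {a, b}
  | handle (S : Finset V) (ℓ : ℕ) (p : ℕ → V) (hS : SetBuildable H β S) (hℓ : β ≤ ℓ)
      (hp : H.IsAttachedPath S ℓ p) : SetBuildable H β (S ∪ (Ioo 0 ℓ).image p)

open Classical in
/-- The vertex sets obtained inside `H` by adding leaves and handles of length seven. -/
inductive LeafBuildable (H : SimpleGraph V) : Finset V → Prop
  | two (a b : V) (hab : a ≠ b) (h : ¬ H.Adj a b) : LeafBuildable H {a, b}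
  | leaf (S : Finset V) (w v : V) (hS : LeafBuildable H S) (hw : w ∈ S) (hv : v ∉ S)
      (h : ∀ u ∈ S, H.Adj v u ↔ u = w) : LeafBuildable H (insert v S)
  | handle (S : Finset V) (p : ℕ → V) (hS : LeafBuildable H S)
      (hp : H.IsAttachedPath S 7 p) : LeafBuildable H (S ∪ (Ioo 0 7).image p)

/-- `φ` restricts to an induced copy in `G` of the subgraph of `H` induced on `S`. -/
def IsCopyOn (G : SimpleGraph W) (H : SimpleGraph V) (S : Finset V) (φ : V → W) : Prop :=
  (∀ u ∈ S, ∀ v ∈ S, φ u = φ v → u = v) ∧ ∀ u ∈ S, ∀ v ∈ S, (G.Adj (φ u) (φ v) ↔ H.Adj u v)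

theorem IsCopyOn.isIndContained [Fintype V] {G : SimpleGraph W} {H : SimpleGraph V} {φ : V → W}
    (h : IsCopyOn G H univ φ) : H.IsIndContained G :=
  ⟨⟨⟨φ, fun u v huv => h.1 u (mem_univ _) v (mem_univ _) huv⟩,
    fun {u v} => h.2 u (mem_univ _) v (mem_univ _)⟩⟩

theorem IsBuildable.finite {β : ℕ} {H : SimpleGraph V} (h : H.IsBuildable β) : Finite V := by
  induction h with
  | two H hcard hedge => exact Nat.finite_of_card_ne_zero (by omega)
  | handle H P hP hl hb ih =>
    have h1 : (pathInterior P).Finite := (Set.toFinite _).image _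
    have h2 : ((pathInterior P)ᶜ).Finite := Set.toFinite _
    exact Set.finite_univ_iff.1 (by simpa using h1.union h2)

/-- The two neighbours along the path already exhaust the degree two of an internal vertex. -/
theorem IsHandle.adj_iff {H : SimpleGraph V} [Finite V] {ℓ : ℕ} {P : pathGraph (ℓ + 1) ↪g H}
    (hP : H.IsHandle P) {i : ℕ} (h0 : 0 < i) (hi : i < ℓ) (v : V) :
    H.Adj (P ⟨i, by omega⟩) v ↔ v = P ⟨i - 1, by omega⟩ ∨ v = P ⟨i + 1, by omega⟩ := by
  have hmem : P ⟨i, by omega⟩ ∈ pathInterior P := by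
    refine ⟨_, ⟨?_, ?_⟩, rfl⟩
    · intro h; rw [Fin.ext_iff] at h; simp at h; omega
    · intro h; rw [Fin.ext_iff] at h; simp at h; omega
  have hcard := hP.2 _ hmem
  have hsub : ({P ⟨i - 1, by omega⟩, P ⟨i + 1, by omega⟩} : Set V) ⊆
      H.neighborSet (P ⟨i, by omega⟩) := by
    rintro w (rfl | rfl)
    · rw [mem_neighborSet, P.map_adj_iff, pathGraph_adj]; simp; omega
    · rw [mem_neighborSet, P.map_adj_iff, pathGraph_adj]; simp
  have hne : P ⟨i - 1, by omega⟩ ≠ P ⟨i + 1, by omega⟩ := by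
    intro h
    have := P.injective h
    rw [Fin.ext_iff] at this
    simp at this
  have heq := Set.eq_of_subset_of_ncard_le hsub (by rw [hcard, Set.ncard_pair hne]) (Set.toFinite _)
  rw [← mem_neighborSet, ← heq]
  rfl

/-- `IsBuildable` changes the vertex type at every move. Carrying the construction along an
embedding into one fixed graph turns it into a chain of finite subsets, over which all later
inductions run. -/
theorem IsBuildable.exists_setBuildable {U : Type*} {β : ℕ} {H : SimpleGraph V}
    (h : H.IsBuildable β) {K : SimpleGraph U} (e : H ↪g K) :
    ∃ S : Finset U, (S : Set U) = Set.range e ∧ K.SetBuildable β S := by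
  classical
  induction h with
  | two H hcard hedge =>
    obtain ⟨a, b, hab, hu⟩ := Nat.card_eq_two_iff.1 hcard
    refine ⟨{e a, e b}, ?_, ?_⟩
    · rw [← Set.image_univ, ← hu]; simp [Set.image_pair]
    · convert SetBuildable.two (e a) (e b) (fun h => hab (e.injective h)) ?_
      rw [e.map_adj_iff, hedge]; simp
  | @handle V H ℓ P hP hl hb ih =>
    have hfin : Finite V := (IsBuildable.handle H P hP hl hb).finite
    have h2 := hP.1
    obtain ⟨S, hS, hSb⟩ := ih ((Embedding.induce _).trans e)
    have hS' : ∀ x, x ∈ S ↔ ∃ v, v ∉ pathInterior P ∧ e v = x := by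
      intro x
      rw [← Finset.mem_coe, hS]
      constructor
      · rintro ⟨⟨v, hv⟩, rfl⟩; exact ⟨v, hv, rfl⟩
      · rintro ⟨v, hv, rfl⟩; exact ⟨⟨v, hv⟩, rfl⟩
    have hint : ∀ i (hi : i < ℓ + 1), P ⟨i, hi⟩ ∈ pathInterior P ↔ 0 < i ∧ i < ℓ := by
      intro i hi
      constructor
      · rintro ⟨j, ⟨hj0, hj1⟩, hj⟩
        have := P.injective hj
        subst this
        rw [Ne, Fin.ext_iff] at hj0 hj1
        simp at hj0 hj1; omega
      · rintro ⟨h0, h1⟩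
        refine ⟨_, ⟨?_, ?_⟩, rfl⟩
        · intro h; rw [Fin.ext_iff] at h; simp at h; omega
        · intro h; rw [Fin.ext_iff] at h; simp at h; omega
    -- The values beyond `ℓ` are dummies.
    let p : ℕ → U := fun i => if h : i < ℓ + 1 then e (P ⟨i, h⟩) else e (P 0)
    have hp : ∀ i (h : i < ℓ + 1), p i = e (P ⟨i, h⟩) := fun i h => dif_pos h
    have hatt : K.IsAttachedPath S ℓ p := by
      refine ⟨?_, ?_, ?_, ?_, ?_, ?_⟩
      · rw [hS', hp 0 (by omega)]
        exact ⟨_, by rw [hint]; omega, rfl⟩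
      · rw [hS', hp ℓ (by omega)]
        exact ⟨_, by rw [hint]; omega, rfl⟩
      · intro i h0 h1 h
        rw [hS', hp i (by omega)] at h
        obtain ⟨v, hv, hvv⟩ := h
        rw [e.injective hvv, hint] at hv
        omega
      · intro i hi j hj hij
        rw [hp i (by omega), hp j (by omega)] at hij
        simpa using P.injective (e.injective hij)
      · intro i hi j hj
        rw [hp i (by omega), hp j (by omega), e.map_adj_iff, P.map_adj_iff, pathGraph_adj]
      · intro i h0 h1 v hv
        obtain ⟨u, hu, rfl⟩ := (hS' v).1 hv
        rw [hp i (by omega), hp 0 (by omega), hp ℓ (by omega), e.map_adj_iff, hP.adj_iff h0 h1,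
          e.injective.eq_iff, e.injective.eq_iff]
        constructor
        · rintro (rfl | rfl)
          · rw [hint] at hu
            have : i = 1 := by omega
            subst this
            left; simp
          · rw [hint] at hu
            have : i + 1 = ℓ := by omega
            subst this
            right; simp
        · rintro (⟨rfl, rfl⟩ | ⟨rfl, rfl⟩)
          · left; rfl
          · right; rfl
    refine ⟨_, ?_, SetBuildable.handle S ℓ p hSb hl hatt⟩
    ext x
    simp only [coe_union, coe_image, coe_Ioo, Set.mem_union, Finset.mem_coe, Set.mem_image,
      Set.mem_Ioo, Set.mem_range]
    rw [hS']
    constructor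
    · rintro (⟨v, -, rfl⟩ | ⟨i, hi, rfl⟩)
      · exact ⟨v, rfl⟩
      · rw [hp i (by omega)]; exact ⟨_, rfl⟩
    · rintro ⟨v, rfl⟩
      by_cases hv : v ∈ pathInterior P
      · right
        obtain ⟨⟨i, hi⟩, -, rfl⟩ := id hv
        exact ⟨i, (hint i hi).1 hv, hp i hi⟩
      · exact Or.inl ⟨v, hv, rfl⟩

/-- The vertex `p 1` of a long attached path can be added as a leaf at `p 0`; the rest is then an
attached path with one edge less. This reduces every handle of length at least seven to length
exactly seven. -/
theorem LeafBuildable.handle_of_le [DecidableEq V] {H : SimpleGraph V} (n : ℕ) :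
    ∀ (S : Finset V) (p : ℕ → V), H.LeafBuildable S → H.IsAttachedPath S (n + 7) p →
      H.LeafBuildable (S ∪ (Ioo 0 (n + 7)).image p) := by
  induction n with
  | zero => intro S p hS hp; convert LeafBuildable.handle S p hS (by simpa using hp)
  | succ n ih =>
    intro S p hS hp
    have h1 : H.LeafBuildable (insert (p 1) S) := by
      convert LeafBuildable.leaf S (p 0) (p 1) hS hp.left_mem
        (hp.notMem 1 (by omega) (by omega)) ?_
      intro u hu
      rw [hp.adj_mem_iff 1 (by omega) (by omega) u hu]
      simp
    have hp' : H.IsAttachedPath (insert (p 1) S) (n + 7) (fun i => p (i + 1)) := by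
      refine ⟨by simp, mem_insert_of_mem hp.right_mem, ?_, ?_, ?_, ?_⟩
      · intro i h0 hi h
        rcases mem_insert.1 h with h | h
        · have := hp.inj _ (by omega) _ (by omega) h
          omega
        · exact hp.notMem _ (by omega) (by omega) h
      · intro i hi j hj hij
        have := hp.inj _ (by omega) _ (by omega) hij
        omega
      · intro i hi j hj
        rw [hp.adj_iff _ (by omega) _ (by omega)]
        omega
      · intro i h0 hi v hv
        rcases mem_insert.1 hv with rfl | hv
        · rw [hp.adj_iff _ (by omega) _ (by omega)]
          constructor
          · intro h
            left; constructor
            · omega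
            · rfl
          · rintro (⟨rfl, -⟩ | ⟨-, h⟩)
            · right; rfl
            · have := hp.inj _ (by omega) _ (by omega) h
              omega
        · rw [hp.adj_mem_iff _ (by omega) (by omega) v hv]
          constructor
          · rintro (⟨h, -⟩ | ⟨h, h'⟩)
            · omega
            · right; exact ⟨by omega, h'⟩
          · rintro (⟨rfl, rfl⟩ | ⟨h, h'⟩)
            · exact absurd hv (hp.notMem _ (by omega) (by omega))
            · right; exact ⟨by omega, h'⟩
    convert ih _ _ h1 hp' using 1
    ext x
    simp only [mem_union, mem_image, mem_Ioo, mem_insert]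
    constructor
    · rintro (h | ⟨i, hi, rfl⟩)
      · exact Or.inl (Or.inr h)
      · rcases Nat.lt_or_ge 1 i with h | h
        · exact Or.inr ⟨i - 1, by omega, by congr 1; omega⟩
        · have : i = 1 := by omega
          subst this
          exact Or.inl (Or.inl rfl)
    · rintro ((rfl | h) | ⟨i, hi, rfl⟩)
      · exact Or.inr ⟨1, by omega, rfl⟩
      · exact Or.inl h
      · exact Or.inr ⟨i + 1, by omega, rfl⟩

theorem SetBuildable.leafBuildable {H : SimpleGraph V} {β : ℕ} (hβ : 7 ≤ β) {S : Finset V}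
    (h : H.SetBuildable β S) : H.LeafBuildable S := by
  classical
  induction h with
  | two a b hab h => convert LeafBuildable.two a b hab h
  | handle S ℓ p hS hl hp ih =>
    obtain ⟨n, rfl⟩ : ∃ n, ℓ = n + 7 := ⟨ℓ - 7, by omega⟩
    convert LeafBuildable.handle_of_le n S p ih hp

end Copies

end SimpleGraph

namespace SimpleGraph

open Finset

open scoped Classical

/-! ### Averaging and greedy covers. -/

section Averaging

variable {ι κ : Type*}

theorem mul_card_filter_lt_le_sum (s : Finset ι) (f : ι → ℝ) (hf : ∀ i ∈ s, 0 ≤ f i) (c : ℝ) :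
    c * #(s.filter fun i => c < f i) ≤ ∑ i ∈ s, f i := by
  calc c * #(s.filter fun i => c < f i) = ∑ i ∈ s.filter (fun i => c < f i), c := by
        rw [sum_const, nsmul_eq_mul, mul_comm]
    _ ≤ ∑ i ∈ s.filter (fun i => c < f i), f i :=
        sum_le_sum fun i hi => (mem_filter.1 hi).2.le
    _ ≤ ∑ i ∈ s, f i := sum_le_sum_of_subset_of_nonneg (filter_subset _ _) fun i hi _ => hf i hi

theorem mul_card_filter_le_le_sum (s : Finset ι) (f : ι → ℝ) (hf : ∀ i ∈ s, 0 ≤ f i) (c : ℝ) :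
    c * #(s.filter fun i => c ≤ f i) ≤ ∑ i ∈ s, f i := by
  calc c * #(s.filter fun i => c ≤ f i) = ∑ i ∈ s.filter (fun i => c ≤ f i), c := by
        rw [sum_const, nsmul_eq_mul, mul_comm]
    _ ≤ ∑ i ∈ s.filter (fun i => c ≤ f i), f i :=
        sum_le_sum fun i hi => (mem_filter.1 hi).2
    _ ≤ ∑ i ∈ s, f i := sum_le_sum_of_subset_of_nonneg (filter_subset _ _) fun i hi _ => hf i hi

/-- A quantile of a function on a finite set. -/
theorem exists_quantile (s : Finset ι) (f : ι → ℕ) {θ : ℝ} (hθ0 : 0 ≤ θ) (hθ : θ ≤ 1) :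
    ∃ ρ : ℕ, θ * #s ≤ #(s.filter fun i => f i ≤ ρ) ∧
      (1 - θ) * #s ≤ #(s.filter fun i => ρ ≤ f i) := by
  have hex : ∃ ρ : ℕ, θ * #s ≤ #(s.filter fun i => f i ≤ ρ) := by
    refine ⟨s.sup f, ?_⟩
    rw [filter_true_of_mem fun i hi => le_sup hi]
    have : (0 : ℝ) ≤ #s := by positivity
    nlinarith
  refine ⟨Nat.find hex, Nat.find_spec hex, ?_⟩
  have hsplit : (#s : ℝ) = #(s.filter fun i => Nat.find hex ≤ f i) +
      #(s.filter fun i => ¬ Nat.find hex ≤ f i) := by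
    rw [← Nat.cast_add, card_filter_add_card_filter_not]
  rcases Nat.eq_zero_or_pos (Nat.find hex) with h0 | h0
  · rw [h0, filter_true_of_mem fun i _ => Nat.zero_le _]
    have : (0 : ℝ) ≤ #s := Nat.cast_nonneg _
    nlinarith
  -- By minimality of the threshold, the values strictly below it make up less than a proportion
  -- `θ`.
  · have hm := Nat.find_min hex (show Nat.find hex - 1 < Nat.find hex by omega)
    have he : (s.filter fun i => ¬ Nat.find hex ≤ f i) =
        s.filter fun i => f i ≤ Nat.find hex - 1 := by
      refine filter_congr fun i _ => ?_
      omega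
    rw [← he, not_le] at hm
    linarith

/-- Otherwise every index with `g i > 0` would cost more than `c` per unit of gain, and so would the
whole sum. -/
theorem exists_pos_and_le_mul {s : Finset ι} {ω : ι → ℝ} {g : ι → ℕ} {c : ℝ}
    (hω : ∀ i ∈ s, 0 ≤ ω i) (hpos : 0 < ∑ i ∈ s, g i)
    (h : ∑ i ∈ s, ω i ≤ c * (∑ i ∈ s, g i : ℕ)) : ∃ i ∈ s, 0 < g i ∧ ω i ≤ c * g i := by
  by_contra! hcon
  obtain ⟨j, hj, hj0⟩ : ∃ j ∈ s, 0 < g j := by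
    by_contra! h0
    exact absurd hpos (by simpa using fun i hi => Nat.le_zero.1 (h0 i hi))
  have hlt : ∑ i ∈ s, c * (g i : ℝ) < ∑ i ∈ s, ω i := by
    refine sum_lt_sum (fun i hi => ?_) ⟨j, hj, hcon j hj hj0⟩
    rcases Nat.eq_zero_or_pos (g i) with h0 | h0
    · simpa [h0] using hω i hi
    · exact (hcon i hi h0).le
  rw [← mul_sum] at hlt
  push_cast at h
  linarith

/-- Greedy covering: if in every large part of `T` some set `N y` covers cheaply, then a given
number of elements of `T` can be covered cheaply. -/
theorem exists_greedy_cover {L : Finset ι} {T : Finset κ} {N : ι → Finset κ} {ω : ι → ℝ} {c : ℝ}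
    {m τ : ℕ} (hm : ∀ y ∈ L, #(T ∩ N y) ≤ m) (hτ : 2 * τ ≤ #T)
    (h : ∀ T' ⊆ T, #T ≤ 2 * #T' → ∃ y ∈ L, 0 < #(T' ∩ N y) ∧ ω y ≤ c * #(T' ∩ N y)) :
    ∃ Y ⊆ L, τ ≤ #(T ∩ Y.biUnion N) ∧ #(T ∩ Y.biUnion N) ≤ τ + m ∧
      ∑ y ∈ Y, ω y ≤ c * #(T ∩ Y.biUnion N) := by
  -- Among the `Y` within the budget and the upper bound, one covering the most must reach `τ`:
  -- below `τ`, at least half of `T` is uncovered, and the cheap `y` supplied by `h` could be added.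
  let p : Finset ι → Prop := fun Y => #(T ∩ Y.biUnion N) ≤ τ + m ∧
    ∑ y ∈ Y, ω y ≤ c * #(T ∩ Y.biUnion N)
  have hne : (L.powerset.filter p).Nonempty :=
    ⟨∅, by simp [p]⟩
  obtain ⟨Y, hY, hmax⟩ := exists_max_image _ (fun Y => #(T ∩ Y.biUnion N)) hne
  rw [mem_filter, mem_powerset] at hY
  obtain ⟨hYL, hY1, hY2⟩ := hY
  refine ⟨Y, hYL, ?_, hY1, hY2⟩
  by_contra! hlt
  have hcard : #(T \ Y.biUnion N) + #(T ∩ Y.biUnion N) = #T := card_sdiff_add_card_inter _ _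
  obtain ⟨y, hy, hy0, hyω⟩ := h (T \ Y.biUnion N) sdiff_subset (by omega)
  have hyY : y ∉ Y := by
    intro hyY
    obtain ⟨z, hz⟩ := card_pos.1 hy0
    rw [mem_inter, mem_sdiff] at hz
    exact hz.1.2 (mem_biUnion.2 ⟨y, hyY, hz.2⟩)
  have hun : T ∩ (insert y Y).biUnion N =
      ((T \ Y.biUnion N) ∩ N y) ∪ (T ∩ Y.biUnion N) := by
    ext z
    simp only [biUnion_insert, mem_inter, mem_union, mem_sdiff]
    tauto
  have hdisj : Disjoint ((T \ Y.biUnion N) ∩ N y) (T ∩ Y.biUnion N) := by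
    rw [Finset.disjoint_left]
    intro z hz hz'
    rw [mem_inter, mem_sdiff] at hz
    exact hz.1.2 (mem_inter.1 hz').2
  have hc : #(T ∩ (insert y Y).biUnion N) =
      #((T \ Y.biUnion N) ∩ N y) + #(T ∩ Y.biUnion N) := by
    rw [hun, card_union_of_disjoint hdisj]
  have hle : #((T \ Y.biUnion N) ∩ N y) ≤ m :=
    (card_le_card (inter_subset_inter_right sdiff_subset)).trans (hm y hy)
  have := hmax (insert y Y) (by
    rw [mem_filter, mem_powerset]
    refine ⟨insert_subset hy hYL, by omega, ?_⟩
    rw [sum_insert hyY, hc]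
    push_cast
    linarith)
  omega

end Averaging

/-! ### Vertex sets of guaranteed density. -/

section Dense

variable {W : Type*}

/-- The neighbours of `v` in `A`. -/
noncomputable def nbIn (G : SimpleGraph W) (A : Finset W) (v : W) : Finset W := A.filter (G.Adj v)

variable {G : SimpleGraph W}

@[simp] theorem mem_nbIn {A : Finset W} {v w : W} : w ∈ G.nbIn A v ↔ w ∈ A ∧ G.Adj v w := by
  simp [nbIn]

theorem nbIn_subset (A : Finset W) (v : W) : G.nbIn A v ⊆ A := filter_subset _ _

theorem nbIn_mono {A B : Finset W} (h : A ⊆ B) (v : W) : G.nbIn A v ⊆ G.nbIn B v :=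
  filter_subset_filter _ h

theorem sum_card_nbIn_comm (A B : Finset W) :
    ∑ b ∈ B, #(G.nbIn A b) = ∑ a ∈ A, #(G.nbIn B a) := by
  simp only [nbIn, card_filter]
  rw [sum_comm]
  simp only [G.adj_comm]

/-- The graph induced on `U` has maximum degree at most `η |U|`, and the density between any two
sets of sizes at least `x ^ t |U|` and `η |U|` is at least `x`. -/
structure IsDense (G : SimpleGraph W) (U : Finset W) (x : ℝ) (t : ℕ) (η : ℝ) : Prop where
  deg_le : ∀ v ∈ U, (#(G.nbIn U v) : ℝ) ≤ η * #U
  le_sum : ∀ A ⊆ U, ∀ B ⊆ U, x ^ t * #U ≤ #A → η * #U ≤ #B →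
    x * #A * #B ≤ ((∑ b ∈ B, #(G.nbIn A b) : ℕ) : ℝ)
  one_le : 1 ≤ x ^ t * #U

namespace IsDense

variable {U : Finset W} {x η : ℝ} {t : ℕ}

theorem mono (h : G.IsDense U x t η) (hx0 : 0 < x) (hx : x ≤ 1) {t' : ℕ} {η' : ℝ} (ht : t' ≤ t)
    (hη : η ≤ η') : G.IsDense U x t' η' := by
  have hn : (0 : ℝ) ≤ #U := by positivity
  have hp : x ^ t * #U ≤ x ^ t' * #U :=
    mul_le_mul_of_nonneg_right (pow_le_pow_of_le_one hx0.le hx ht) hn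
  exact ⟨fun v hv => (h.deg_le v hv).trans (mul_le_mul_of_nonneg_right hη hn),
    fun A hA B hB h1 h2 => h.le_sum A hA B hB (hp.trans h1)
      ((mul_le_mul_of_nonneg_right hη hn).trans h2), h.one_le.trans hp⟩

/-- Halving the ground set costs one power of `x`, as `x ≤ 1 / 2`, and a factor two in `η`. -/
theorem subset (h : G.IsDense U x (t + 1) η) (hη : 0 ≤ η) (hx0 : 0 < x) (hx : x ≤ 1 / 2)
    {U' : Finset W} (hU : U' ⊆ U) (hcard : (#U : ℝ) ≤ 2 * #U') : G.IsDense U' x t (2 * η) := by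
  have hp : x ^ (t + 1) * #U ≤ x ^ t * #U' := by
    rw [pow_succ, mul_assoc]
    refine mul_le_mul_of_nonneg_left ?_ (by positivity)
    have : (0 : ℝ) ≤ #U' := by positivity
    nlinarith
  refine ⟨fun v hv => ?_, fun A hA B hB h1 h2 => ?_, h.one_le.trans hp⟩
  · have h1 : (#(G.nbIn U' v) : ℝ) ≤ #(G.nbIn U v) := by
      exact_mod_cast card_le_card (nbIn_mono hU v)
    have := h.deg_le v (hU hv)
    nlinarith
  · exact h.le_sum A (hA.trans hU) B (hB.trans hU) (hp.trans h1) (le_trans (by nlinarith) h2)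

theorem card_pos (h : G.IsDense U x t η) (hx0 : 0 < x) : (0 : ℝ) < #U := by
  have := h.one_le
  by_contra! h0
  have : x ^ t * #U ≤ 0 := mul_nonpos_of_nonneg_of_nonpos (by positivity) h0
  linarith

/-- The vertices with fewer than `x |A|` neighbours in `A` together have density below `x` to `A`,
so they must be too few for `le_sum` to apply. -/
theorem card_lo_lt (h : G.IsDense U x t η) (hx0 : 0 < x) (hη : 0 < η) {A : Finset W} (hA : A ⊆ U)
    (hAc : x ^ t * #U ≤ #A) : (#(U.filter fun v => (#(G.nbIn A v) : ℝ) < x * #A) : ℝ) < η * #U := by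
  by_contra! hcon
  have h1 := h.le_sum A hA _ (filter_subset _ _) hAc hcon
  set B := U.filter fun v => (#(G.nbIn A v) : ℝ) < x * #A
  have hB : B.Nonempty := by
    rw [← Finset.card_pos]
    have := h.card_pos hx0
    have h2 : (0 : ℝ) < #B := lt_of_lt_of_le (by positivity) hcon
    exact_mod_cast h2
  have h2 : ∑ b ∈ B, (#(G.nbIn A b) : ℝ) < ∑ b ∈ B, x * #A :=
    sum_lt_sum_of_nonempty hB fun b hb => (mem_filter.1 hb).2
  rw [sum_const, nsmul_eq_mul] at h2
  push_cast at h1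
  linarith

/-- Markov's inequality: by the degree bound at most `|A| η |U|` adjacent pairs join `A` to `U`. -/
theorem card_hi_le (h : G.IsDense U x t η) {σ : ℝ} {A : Finset W} (hA : A ⊆ U) :
    σ * (#(U.filter fun v => σ * #A < #(G.nbIn A v)) : ℝ) ≤ η * #U := by
  rcases A.eq_empty_or_nonempty with rfl | hne
  · simp [nbIn]
    have hη : 0 ≤ η * #U := by
      by_cases hU : U = ∅
      · simp [hU]
      · obtain ⟨v, hv⟩ := nonempty_iff_ne_empty.2 hU
        exact le_trans (by positivity) (h.deg_le v hv)
    exact hη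
  · have h1 := mul_card_filter_lt_le_sum U (fun v => (#(G.nbIn A v) : ℝ)) (fun _ _ => by positivity)
      (σ * #A)
    have h2 : ∑ v ∈ U, (#(G.nbIn A v) : ℝ) ≤ #A * (η * #U) := by
      have h3 : ∑ v ∈ U, (#(G.nbIn A v) : ℝ) = ∑ a ∈ A, (#(G.nbIn U a) : ℝ) := by
        exact_mod_cast sum_card_nbIn_comm A U
      rw [h3, ← nsmul_eq_mul]
      exact sum_le_card_nsmul _ _ _ fun a ha => h.deg_le a (hA ha)
    have h4 : (0 : ℝ) < #A := by exact_mod_cast Finset.card_pos.2 hne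
    refine le_of_mul_le_mul_left ?_ h4
    linarith

end IsDense

end Dense

end SimpleGraph

/-! ### Counting copies in dense sets: the initial pair and leaves. -/

namespace SimpleGraph

open Finset

open scoped Classical

universe u

section Families

variable {V : Type*} [Fintype V] {W : Type u}

/-- The induced copies in `G` of the subgraph of `H` induced on `S`, with all vertices in `U`. -/
noncomputable def copies (G : SimpleGraph W) (H : SimpleGraph V) (S : Finset V) (U : Finset W) :
    Finset (V → W) :=
  (Fintype.piFinset fun _ => U).filter (IsCopyOn G H S)

/-- The maps in `F` sending `w` to a neighbour of `y` and the rest of `S` away from `y`. -/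
noncomputable def attach (G : SimpleGraph W) (F : Finset (V → W)) (S : Finset V) (w : V) (y : W) :
    Finset (V → W) :=
  F.filter fun φ => G.Adj y (φ w) ∧ ∀ u ∈ S, u ≠ w → y ≠ φ u ∧ ¬ G.Adj y (φ u)

/-- Sufficiently dense graphs have many induced copies of the subgraph of `H` induced on `S`. -/
def DenseClaim (H : SimpleGraph V) (S : Finset V) : Prop :=
  ∃ a t : ℕ, ∃ η x₀ : ℝ, 0 < η ∧ 0 < x₀ ∧ ∀ (W : Type u) (G : SimpleGraph W) (U : Finset W) (x : ℝ),
    0 < x → x ≤ x₀ → G.IsDense U x t η →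
      x ^ a * (#U : ℝ) ^ Fintype.card V ≤ #(copies G H S U)

/-- Maps are defined on all of `V` even when only their values on `S` matter, so that every count is
a proportion of `|U| ^ |V|`. Fixing the value at `w` divides the number of possible maps by `|U|`.
-/
theorem card_image_update_mul_le {U : Finset W} {F : Finset (V → W)}
    (hF : ∀ φ ∈ F, ∀ v, φ v ∈ U) (w : V) (u₀ : W) :
    #(F.image fun φ => Function.update φ w u₀) * #U ≤ #U ^ Fintype.card V := by
  have hsub : (F.image fun φ => Function.update φ w u₀) ⊆
      Fintype.piFinset (Function.update (fun _ => U) w {u₀}) := by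
    intro ψ hψ
    obtain ⟨φ, hφ, rfl⟩ := mem_image.1 hψ
    rw [Fintype.mem_piFinset]
    intro v
    by_cases hv : v = w
    · subst hv; simp
    · simp [hv, hF φ hφ v]
  have hcard : #(Fintype.piFinset (Function.update (fun _ => U) w {u₀})) * #U =
      #U ^ Fintype.card V := by
    rw [Fintype.card_piFinset, ← mul_prod_erase univ _ (mem_univ w)]
    have : ∏ i ∈ univ.erase w, #(Function.update (fun _ => U) w {u₀} i) =
        #U ^ (Fintype.card V - 1) := by
      rw [prod_congr rfl (g := fun _ => #U), prod_const, card_erase_of_mem (mem_univ w), card_univ]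
      intro i hi
      simp [ne_of_mem_erase hi]
    rw [this]
    have hpos : 0 < Fintype.card V := Fintype.card_pos_iff.2 ⟨w⟩
    simp only [Function.update_self, card_singleton, one_mul]
    rw [← pow_succ, Nat.sub_add_cancel hpos]
  rw [← hcard]
  exact Nat.mul_le_mul_right _ (card_le_card hsub)

/-- The bookkeeping for adding `m` vertices: overwriting the coordinates `j` loses only the old
values there, for which there are at most `|U| ^ m` possibilities. -/
theorem card_le_pow_mul_card_of_extend {m : ℕ} {j : Fin m → V} (hj : Function.Injective j)
    {U : Finset W} {D : Finset ((Fin m → W) × (V → W))} (hD : ∀ d ∈ D, ∀ v, d.2 v ∈ U)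
    {C : Finset (V → W)} (h : ∀ d ∈ D, Function.extend j d.1 d.2 ∈ C) : #D ≤ #U ^ m * #C := by
  refine card_le_mul_card_image_of_maps_to h _ fun ψ hψ => ?_
  have hc : #(Fintype.piFinset fun _ : Fin m => U) = #U ^ m := by simp
  rw [← hc]
  refine card_le_card_of_injOn (fun d => d.2 ∘ j) ?_ ?_
  · intro d hd
    rw [Finset.mem_coe, mem_filter] at hd
    simpa using fun i => hD d hd.1 _
  · intro d hd d' hd' he
    rw [Finset.mem_coe, mem_filter] at hd hd'
    have h1 := hd.2.trans hd'.2.symm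
    refine Prod.ext (funext fun i => ?_) (funext fun v => ?_)
    · have := congrFun h1 (j i)
      rwa [hj.extend_apply, hj.extend_apply] at this
    · by_cases hv : ∃ i, j i = v
      · obtain ⟨i, rfl⟩ := hv
        exact congrFun he i
      · have := congrFun h1 v
        rwa [Function.extend_apply' _ _ _ hv, Function.extend_apply' _ _ _ hv] at this

variable {G : SimpleGraph W} {U : Finset W} {x η : ℝ} {t a : ℕ}

theorem IsDense.card_touching_le (h : G.IsDense U x t η) (h1 : 1 ≤ η * #U) {v : W} (hv : v ∈ U) :
    (#(U.filter fun y => y = v ∨ G.Adj y v) : ℝ) ≤ 2 * η * #U := by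
  have hsub : (U.filter fun y => y = v ∨ G.Adj y v) ⊆ insert v (G.nbIn U v) := by
    intro y
    simp only [mem_filter, mem_insert, mem_nbIn]
    rintro ⟨hy, rfl | hyv⟩
    · exact Or.inl rfl
    · exact Or.inr ⟨hy, hyv.symm⟩
  have h2 : (#(U.filter fun y => y = v ∨ G.Adj y v) : ℝ) ≤ #(G.nbIn U v) + 1 := by
    exact_mod_cast (card_le_card hsub).trans (card_insert_le _ _)
  have := h.deg_le v hv
  linarith

set_option maxHeartbeats 400000 in
/-- Most vertices extend many members of a large family of maps. -/
theorem IsDense.card_attach_lo_lt (h : G.IsDense U x t η) (hx0 : 0 < x) (hx : x ≤ 1 / 2)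
    (hη : 0 < η) (h1 : 1 ≤ η * #U) (hat : a + 1 ≤ t) {F : Finset (V → W)}
    (hF : ∀ φ ∈ F, ∀ v, φ v ∈ U) (hFc : x ^ a * (#U : ℝ) ^ Fintype.card V ≤ #F) (S : Finset V)
    (w : V) :
    (#(U.filter fun y => (#(attach G F S w y) : ℝ) < x / 4 * #F) : ℝ) <
      4 * (Fintype.card V + 1) * η * #U := by
  by_contra! hcon
  set Y := U.filter fun y => (#(attach G F S w y) : ℝ) < x / 4 * #F with hY
  have hn := h.card_pos hx0
  obtain ⟨u₀, hu₀⟩ : U.Nonempty := Finset.card_pos.1 (by exact_mod_cast hn)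
  have hYpos : (0 : ℝ) < #Y := lt_of_lt_of_le (by positivity) hcon
  -- Maps are grouped by their values off `w`. Within a group only the value at `w` varies, so the
  -- group amounts to a set `A` of vertices, to which density applies.
  let k : (V → W) → V → W := fun φ => Function.update φ w u₀
  let K := F.image k
  let Fk : (V → W) → Finset (V → W) := fun κ => F.filter fun φ => k φ = κ
  have hkeys : (#K : ℝ) * #U ≤ (#U : ℝ) ^ Fintype.card V := by
    exact_mod_cast card_image_update_mul_le hF w u₀
  have hFsum : (#F : ℝ) = ∑ κ ∈ K, (#(Fk κ) : ℝ) := by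
    exact_mod_cast card_eq_sum_card_image k F
  -- There are at most `|U| ^ (|V| - 1)` groups, so the groups with fewer than `x ^ a |U| / 2` maps
  -- contain at most half of `F`.
  have hbadsum : ∑ κ ∈ K.filter (fun κ => ¬ x ^ a * #U / 2 ≤ #(Fk κ)), (#(Fk κ) : ℝ) ≤ #F / 2 := by
    calc ∑ κ ∈ K.filter (fun κ => ¬ x ^ a * #U / 2 ≤ #(Fk κ)), (#(Fk κ) : ℝ)
        ≤ ∑ κ ∈ K.filter (fun κ => ¬ x ^ a * #U / 2 ≤ #(Fk κ)), x ^ a * #U / 2 :=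
          sum_le_sum fun κ hκ => (not_le.1 (mem_filter.1 hκ).2).le
      _ ≤ ∑ κ ∈ K, x ^ a * #U / 2 :=
          sum_le_sum_of_subset_of_nonneg (filter_subset _ _) fun _ _ _ => by positivity
      _ = x ^ a * ((#K : ℝ) * #U) / 2 := by rw [sum_const, nsmul_eq_mul]; ring
      _ ≤ x ^ a * (#U : ℝ) ^ Fintype.card V / 2 := by gcongr
      _ ≤ #F / 2 := by gcongr
  have hgood : (#F : ℝ) / 2 ≤ ∑ κ ∈ K.filter (fun κ => x ^ a * #U / 2 ≤ #(Fk κ)), (#(Fk κ) : ℝ) := by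
    have := sum_filter_add_sum_filter_not K (fun κ => x ^ a * #U / 2 ≤ #(Fk κ))
      fun κ => (#(Fk κ) : ℝ)
    linarith
  let cnt : (V → W) → ℕ := fun φ => #(Y.filter fun y => φ ∈ attach G F S w y)
  have hdc : ∑ y ∈ Y, #(attach G F S w y) = ∑ φ ∈ F, cnt φ := by
    have h2 : ∀ y ∈ Y, #(attach G F S w y) = #(F.filter fun φ => φ ∈ attach G F S w y) := by
      intro y _
      congr 1
      rw [filter_mem_eq_inter]
      exact (inter_eq_right.2 (filter_subset _ _)).symm
    rw [sum_congr rfl h2]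
    simp only [cnt, card_filter]
    exact sum_comm
  have hfib : ∀ κ ∈ K.filter (fun κ => x ^ a * #U / 2 ≤ #(Fk κ)),
      x * #(Fk κ) * (#Y / 2) ≤ ((∑ φ ∈ Fk κ, cnt φ : ℕ) : ℝ) := by
    intro κ hκ
    rw [mem_filter] at hκ
    obtain ⟨φ₀, hφ₀, rfl⟩ := mem_image.1 hκ.1
    set A := (Fk (k φ₀)).image fun φ => φ w with hA
    have hoff : ∀ φ ∈ Fk (k φ₀), ∀ u, u ≠ w → φ u = φ₀ u := by
      intro φ hφ u hu
      have := congrFun (mem_filter.1 hφ).2 u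
      simpa [k, hu] using this
    have hinj : ∀ φ ∈ Fk (k φ₀), ∀ φ' ∈ Fk (k φ₀), φ w = φ' w → φ = φ' := by
      intro φ hφ φ' hφ' he
      ext u
      by_cases hu : u = w
      · rw [hu, he]
      · rw [hoff φ hφ u hu, hoff φ' hφ' u hu]
    have hAc : #A = #(Fk (k φ₀)) := card_image_of_injOn fun φ hφ φ' hφ' he => hinj φ hφ φ' hφ' he
    have hAU : A ⊆ U := by
      intro z hz
      obtain ⟨φ, hφ, rfl⟩ := mem_image.1 hz
      exact hF φ (mem_filter.1 hφ).1 w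
    -- Vertices touching one of the frozen values; the assumed size of `Y` makes them at most half
    -- of `Y`, and the rest is still large enough for density.
    let bad := (univ.erase w).biUnion fun u => U.filter fun y => y = φ₀ u ∨ G.Adj y (φ₀ u)
    have hbad : (#bad : ℝ) ≤ Fintype.card V * (2 * η * #U) := by
      calc (#bad : ℝ) ≤ ∑ u ∈ univ.erase w, (#(U.filter fun y => y = φ₀ u ∨ G.Adj y (φ₀ u)) : ℝ) := by
            exact_mod_cast card_biUnion_le
        _ ≤ ∑ u ∈ univ.erase w, 2 * η * #U :=
            sum_le_sum fun u _ => h.card_touching_le h1 (hF φ₀ hφ₀ u)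
        _ ≤ Fintype.card V * (2 * η * #U) := by
            rw [sum_const, nsmul_eq_mul]
            exact mul_le_mul_of_nonneg_right (by exact_mod_cast card_le_univ _)
              (by linarith [mul_pos hη hn])
    have hsd : (#Y : ℝ) - #bad ≤ #(Y \ bad) := by
      have : #Y ≤ #(Y \ bad) + #bad := card_le_card_sdiff_add_card
      have : (#Y : ℝ) ≤ #(Y \ bad) + #bad := by exact_mod_cast this
      linarith
    have hηn : 0 < η * #U := mul_pos hη hn
    have hY' : (#Y : ℝ) / 2 ≤ #(Y \ bad) := by nlinarith
    have hdense := h.le_sum A hAU (Y \ bad) (sdiff_subset.trans (filter_subset _ _)) ?_ ?_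
    · rw [sum_card_nbIn_comm, hA, sum_image (fun φ hφ φ' hφ' he => hinj φ hφ φ' hφ' he), ← hA, hAc]
        at hdense
      refine (mul_le_mul_of_nonneg_left hY' (mul_nonneg hx0.le (Nat.cast_nonneg _))).trans (hdense.trans ?_)
      norm_cast
      refine sum_le_sum fun φ hφ => card_le_card fun y hy => ?_
      rw [mem_nbIn, mem_sdiff] at hy
      refine mem_filter.2 ⟨hy.1.1,
        mem_filter.2 ⟨(mem_filter.1 hφ).1, hy.2.symm, fun u _ huw => ?_⟩⟩
      have hyU := (mem_filter.1 hy.1.1).1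
      rw [hoff φ hφ u huw]
      by_contra hcon2
      refine hy.1.2 (mem_biUnion.2 ⟨u, mem_erase.2 ⟨huw, mem_univ u⟩, mem_filter.2 ⟨hyU, ?_⟩⟩)
      tauto
    · rw [hAc]
      refine le_trans ?_ hκ.2
      have hp : x ^ t ≤ x ^ a / 2 := by
        calc x ^ t ≤ x ^ (a + 1) := pow_le_pow_of_le_one hx0.le (by linarith) hat
          _ = x ^ a * x := pow_succ _ _
          _ ≤ x ^ a * (1 / 2) := by gcongr
          _ = _ := by ring
      nlinarith
    · nlinarith
  have hlow : x / 4 * #F * #Y ≤ ((∑ φ ∈ F, cnt φ : ℕ) : ℝ) := by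
    calc x / 4 * #F * #Y = (#F / 2) * (x * (#Y / 2)) := by ring
      _ ≤ (∑ κ ∈ K.filter (fun κ => x ^ a * #U / 2 ≤ #(Fk κ)), (#(Fk κ) : ℝ)) * (x * (#Y / 2)) :=
          mul_le_mul_of_nonneg_right hgood
            (mul_nonneg hx0.le (div_nonneg hYpos.le zero_le_two))
      _ = ∑ κ ∈ K.filter (fun κ => x ^ a * #U / 2 ≤ #(Fk κ)), x * #(Fk κ) * (#Y / 2) := by
          rw [sum_mul]
          exact sum_congr rfl fun _ _ => by ring
      _ ≤ ∑ κ ∈ K.filter (fun κ => x ^ a * #U / 2 ≤ #(Fk κ)), ((∑ φ ∈ Fk κ, cnt φ : ℕ) : ℝ) :=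
          sum_le_sum hfib
      _ ≤ ∑ κ ∈ K, ((∑ φ ∈ Fk κ, cnt φ : ℕ) : ℝ) :=
          sum_le_sum_of_subset_of_nonneg (filter_subset _ _) fun _ _ _ => Nat.cast_nonneg _
      _ = ((∑ φ ∈ F, cnt φ : ℕ) : ℝ) := by
          rw [← Nat.cast_sum]
          congr 1
          exact sum_fiberwise_of_maps_to (fun φ hφ => mem_image_of_mem k hφ) cnt
  rw [← hdc] at hlow
  have hup : ((∑ y ∈ Y, #(attach G F S w y) : ℕ) : ℝ) < ∑ y ∈ Y, x / 4 * #F := by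
    push_cast
    refine sum_lt_sum_of_nonempty (Finset.card_pos.1 (by exact_mod_cast hYpos)) fun y hy => ?_
    exact (mem_filter.1 hy).2
  rw [sum_const, nsmul_eq_mul] at hup
  linarith

/-- With `η = 1 / 4`, for each value at `b` at most half of the values at `c` touch it. -/
theorem DenseClaim.two {H : SimpleGraph V} {b c : V} (hbc : b ≠ c) (hnadj : ¬ H.Adj b c) :
    DenseClaim.{u} H {b, c} := by
  refine ⟨1, 1, 1 / 4, 1 / 4, by norm_num, by norm_num, fun W G U x hx0 hx h => ?_⟩
  have hn := h.card_pos hx0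
  obtain ⟨u₀, hu₀⟩ : U.Nonempty := Finset.card_pos.1 (by exact_mod_cast hn)
  have h1 : 1 ≤ 1 / 4 * (#U : ℝ) := by
    have := h.one_le
    rw [pow_one] at this
    nlinarith
  set P : Finset (V → W) := Fintype.piFinset fun _ => U with hP
  have hPc : (#P : ℝ) = (#U : ℝ) ^ Fintype.card V := by simp [hP]
  set B := P.filter fun φ => φ c = φ b ∨ G.Adj (φ c) (φ b) with hB
  have hPU : ∀ φ ∈ P, ∀ v, φ v ∈ U := fun φ hφ v => Fintype.mem_piFinset.1 hφ v
  have hBU : ∀ φ ∈ B, ∀ v, φ v ∈ U := fun φ hφ => hPU φ (mem_filter.1 hφ).1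
  have hBc : (#B : ℝ) ≤ (#U : ℝ) ^ Fintype.card V / 2 := by
    have h2 : #B ≤ ⌊2 * (1 / 4) * (#U : ℝ)⌋₊ * #(B.image fun φ => Function.update φ c u₀) := by
      refine card_le_mul_card_image _ _ fun κ hκ => ?_
      obtain ⟨φ₀, hφ₀, rfl⟩ := mem_image.1 hκ
      rw [Nat.le_floor_iff (by positivity)]
      refine le_trans ?_ (h.card_touching_le h1 (hBU φ₀ hφ₀ b))
      norm_cast
      have hoff : ∀ φ ∈ B.filter (fun φ => Function.update φ c u₀ = Function.update φ₀ c u₀),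
          ∀ u, u ≠ c → φ u = φ₀ u := by
        intro φ hφ u hu
        have := congrFun (mem_filter.1 hφ).2 u
        simpa [hu] using this
      refine card_le_card_of_injOn (fun φ => φ c) ?_ ?_
      · intro φ hφ
        have h3 := (mem_filter.1 (mem_filter.1 hφ).1).2
        rw [hoff φ hφ b hbc] at h3
        exact mem_filter.2 ⟨hBU φ (mem_filter.1 hφ).1 c, h3⟩
      · intro φ hφ φ' hφ' he
        ext u
        by_cases hu : u = c
        · rw [hu]; exact he
        · rw [hoff φ hφ u hu, hoff φ' hφ' u hu]
    have h3 : (#(B.image fun φ => Function.update φ c u₀) : ℝ) * #U ≤ (#U : ℝ) ^ Fintype.card V := by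
      exact_mod_cast card_image_update_mul_le hBU c u₀
    have h4 : (⌊2 * (1 / 4) * (#U : ℝ)⌋₊ : ℝ) ≤ 2 * (1 / 4) * (#U : ℝ) :=
      Nat.floor_le (by positivity)
    have h5 : (#B : ℝ) ≤ ⌊2 * (1 / 4) * (#U : ℝ)⌋₊ * #(B.image fun φ => Function.update φ c u₀) := by
      exact_mod_cast h2
    have h6 : (0 : ℝ) ≤ #(B.image fun φ => Function.update φ c u₀) := by positivity
    nlinarith
  have hsub : P \ B ⊆ copies G H {b, c} U := by
    intro φ hφ
    rw [mem_sdiff, hB, mem_filter, not_and, not_or] at hφ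
    obtain ⟨h2, h3⟩ := hφ.2 hφ.1
    refine mem_filter.2 ⟨hφ.1, ?_, ?_⟩
    · intro u hu v hv he
      simp only [mem_insert, mem_singleton] at hu hv
      rcases hu with rfl | rfl <;> rcases hv with rfl | rfl <;> simp_all
    · intro u hu v hv
      simp only [mem_insert, mem_singleton] at hu hv
      have h4 : ¬ G.Adj (φ b) (φ c) := fun h => h3 h.symm
      have h5 : ¬ H.Adj c b := fun h => hnadj h.symm
      rcases hu with rfl | rfl <;> rcases hv with rfl | rfl <;> simp_all
  have h2 : (#P : ℝ) - #B ≤ #(copies G H {b, c} U) := by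
    have : #P ≤ #(P \ B) + #B := card_le_card_sdiff_add_card
    have h3 := card_le_card hsub
    have : (#P : ℝ) ≤ #(copies G H {b, c} U) + #B := by exact_mod_cast by omega
    linarith
  have h3 : (0 : ℝ) < (#U : ℝ) ^ Fintype.card V := by positivity
  rw [pow_one]
  nlinarith

/-- At least half of the vertices extend a proportion `x / 4` of the copies. The resulting factor `x
/ 8` is at least `x ^ 2`, hence the exponent `a + 2`. -/
theorem DenseClaim.leaf {H : SimpleGraph V} {S : Finset V} (hS : DenseClaim.{u} H S) {w v : V}
    (hv : v ∉ S) (hadj : ∀ u ∈ S, H.Adj v u ↔ u = w) :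
    DenseClaim.{u} H (insert v S) := by
  obtain ⟨a, t, η, x₀, hη, hx₀, hS⟩ := hS
  set r := Fintype.card V with hr
  set η' := min η (1 / (8 * (r + 1))) with hη'
  have hη'0 : 0 < η' := by positivity
  refine ⟨a + 2, max t (a + 1), η', min x₀ (min (1 / 8) η'), hη'0, by positivity,
    fun W G U x hx0 hx h => ?_⟩
  have hxx : x ≤ x₀ := hx.trans (min_le_left _ _)
  have hx8 : x ≤ 1 / 8 := hx.trans ((min_le_right _ _).trans (min_le_left _ _))
  have hxη : x ≤ η' := hx.trans ((min_le_right _ _).trans (min_le_right _ _))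
  have hn := h.card_pos hx0
  have h1 : 1 ≤ η' * #U := by
    refine h.one_le.trans (mul_le_mul_of_nonneg_right ?_ hn.le)
    calc x ^ max t (a + 1) ≤ x ^ 1 := pow_le_pow_of_le_one hx0.le (by linarith) (by omega)
      _ ≤ η' := by rwa [pow_one]
  have hF := hS W G U x hx0 hxx (h.mono hx0 (by linarith) (le_max_left _ _) (min_le_left _ _))
  set F := copies G H S U with hFdef
  have hFU : ∀ φ ∈ F, ∀ v, φ v ∈ U := fun φ hφ v =>
    Fintype.mem_piFinset.1 (mem_filter.1 hφ).1 v
  have hlo := h.card_attach_lo_lt hx0 (by linarith) hη'0 h1 (le_max_right _ _) hFU hF S w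
  have h2 : 4 * ((r : ℝ) + 1) * η' ≤ 1 / 2 := by
    calc 4 * ((r : ℝ) + 1) * η' ≤ 4 * ((r : ℝ) + 1) * (1 / (8 * (r + 1))) := by
          gcongr; exact min_le_right _ _
      _ = 1 / 2 := by field_simp; norm_num
  set Y := U.filter fun y => ¬ (#(attach G F S w y) : ℝ) < x / 4 * #F with hY
  have hYc : (#U : ℝ) / 2 ≤ #Y := by
    have h3 : (#(U.filter fun y => (#(attach G F S w y) : ℝ) < x / 4 * #F) : ℝ) + #Y = #U := by
      exact_mod_cast card_filter_add_card_filter_not _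
    nlinarith
  let D : Finset ((Fin 1 → W) × (V → W)) :=
    Y.biUnion fun y => (attach G F S w y).image fun φ => (fun _ => y, φ)
  have hDc : #D = ∑ y ∈ Y, #(attach G F S w y) := by
    rw [card_biUnion]
    · refine sum_congr rfl fun y _ => card_image_of_injective _ fun φ φ' he => ?_
      simpa using he
    · intro y _ y' _ hne
      rw [Function.onFun, Finset.disjoint_left]
      intro d hd hd'
      obtain ⟨φ, -, rfl⟩ := mem_image.1 hd
      obtain ⟨φ', -, he⟩ := mem_image.1 hd'
      rw [Prod.mk.injEq] at he
      exact hne (congrFun he.1 0).symm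
  have hmem : ∀ d ∈ D, ∃ y ∈ Y, ∃ φ ∈ attach G F S w y, d = (fun _ => y, φ) := by
    intro d hd
    obtain ⟨y, hy, hd⟩ := mem_biUnion.1 hd
    obtain ⟨φ, hφ, rfl⟩ := mem_image.1 hd
    exact ⟨y, hy, φ, hφ, rfl⟩
  have hj : Function.Injective (fun _ : Fin 1 => v) := fun i j _ => Subsingleton.elim i j
  have hD : #D ≤ #U ^ 1 * #(copies G H (insert v S) U) := by
    refine card_le_pow_mul_card_of_extend hj ?_ ?_
    · intro d hd
      obtain ⟨y, hy, φ, hφ, rfl⟩ := hmem d hd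
      exact hFU φ (mem_filter.1 hφ).1
    · intro d hd
      obtain ⟨y, hy, φ, hφ, rfl⟩ := hmem d hd
      rw [attach, mem_filter] at hφ
      obtain ⟨hφF, hyw, hyS⟩ := hφ
      have hcopy := (mem_filter.1 hφF).2
      have hev : Function.extend (fun _ : Fin 1 => v) (fun _ => y) φ v = y :=
        hj.extend_apply (fun _ => y) φ 0
      have heo : ∀ u, u ≠ v → Function.extend (fun _ : Fin 1 => v) (fun _ => y) φ u = φ u := by
        intro u hu
        exact Function.extend_apply' _ _ _ fun ⟨_, h⟩ => hu h.symm
      have hSv : ∀ u ∈ S, u ≠ v := fun u hu h => hv (h ▸ hu)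
      refine mem_filter.2 ⟨Fintype.mem_piFinset.2 fun u => ?_, ?_, ?_⟩
      · by_cases hu : u = v
        · rw [hu, hev]; exact (mem_filter.1 hy).1
        · rw [heo u hu]; exact hFU φ hφF u
      · have key : ∀ u ∈ S, y ≠ φ u := by
          intro u hu
          by_cases huw : u = w
          · rw [huw]; exact hyw.ne
          · exact (hyS u hu huw).1
        intro u hu u' hu' he
        rcases mem_insert.1 hu with rfl | hu2 <;> rcases mem_insert.1 hu' with rfl | hu2'
        · rfl
        · rw [hev, heo _ (hSv _ hu2')] at he
          exact absurd he (key _ hu2')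
        · rw [hev, heo _ (hSv _ hu2)] at he
          exact absurd he.symm (key _ hu2)
        · rw [heo _ (hSv _ hu2), heo _ (hSv _ hu2')] at he
          exact hcopy.1 u hu2 u' hu2' he
      · have key : ∀ u ∈ S, (G.Adj y (φ u) ↔ H.Adj v u) := by
          intro u hu
          rw [hadj u hu]
          by_cases huw : u = w
          · rw [huw]; simp [hyw]
          · simp [huw, (hyS u hu huw).2]
        intro u hu u' hu'
        rcases mem_insert.1 hu with rfl | hu2 <;> rcases mem_insert.1 hu' with rfl | hu2'
        · simp
        · rw [hev, heo _ (hSv _ hu2')]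
          exact key _ hu2'
        · rw [hev, heo _ (hSv _ hu2), G.adj_comm, H.adj_comm]
          exact key _ hu2
        · rw [heo _ (hSv _ hu2), heo _ (hSv _ hu2')]
          exact hcopy.2 u hu2 u' hu2'
  have hDlow : (#U : ℝ) / 2 * (x / 4 * #F) ≤ #D := by
    rw [hDc]
    push_cast
    calc (#U : ℝ) / 2 * (x / 4 * #F) ≤ #Y * (x / 4 * #F) := by gcongr
      _ = ∑ y ∈ Y, x / 4 * #F := by rw [sum_const, nsmul_eq_mul]
      _ ≤ _ := sum_le_sum fun y hy => not_lt.1 (mem_filter.1 hy).2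
  have hD' : (#D : ℝ) ≤ #U * #(copies G H (insert v S) U) := by
    rw [pow_one] at hD
    exact_mod_cast hD
  have hfin : x / 8 * #F ≤ #(copies G H (insert v S) U) := by
    refine le_of_mul_le_mul_left ?_ hn
    linarith
  refine le_trans ?_ hfin
  rw [pow_add]
  calc x ^ a * x ^ 2 * (#U : ℝ) ^ r = x ^ 2 * (x ^ a * (#U : ℝ) ^ r) := by ring
    _ ≤ x / 8 * (x ^ a * (#U : ℝ) ^ r) := by gcongr; nlinarith
    _ ≤ _ := by gcongr

end Families

end SimpleGraph

/-! ### Induced paths of length three between two sets. -/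

namespace SimpleGraph

open Finset

open scoped Classical

universe u

section RichPairs

variable {W : Type u} {G : SimpleGraph W}

theorem sum_sum_nbIn_comm (A B : Finset W) (f : W → W → ℝ) :
    ∑ b ∈ B, ∑ a ∈ G.nbIn A b, f a b = ∑ a ∈ A, ∑ b ∈ G.nbIn B a, f a b := by
  refine sum_comm' fun b a => ?_
  simp only [mem_nbIn, G.adj_comm a b]
  tauto

theorem sum_card_nbIn_eq (A B : Finset W) :
    ∑ a ∈ A, #(G.nbIn B a) = #((A ×ˢ B).filter fun e => G.Adj e.1 e.2) := by
  rw [card_filter, sum_product]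
  refine sum_congr rfl fun a _ => ?_
  rw [nbIn, card_filter]

/-- A cheap cover of a positive proportion of `T` by neighbourhoods of vertices of `L` that miss
half of the weight on `A`. -/
theorem exists_cover_avoiding {U P L T A : Finset W} {ρ η : ℝ} {m : W → ℝ} (hρ : 0 < ρ)
    (hdeg : ∀ v ∈ P, (#(G.nbIn U v) : ℝ) ≤ η * #U) (hη : η ≤ 1 / 640) (hP : P.Nonempty)
    (hLP : L ⊆ P) (hTU : T ⊆ U) (hT : (#U : ℝ) ≤ 10 * #T) (hT64 : 64 ≤ #T)
    (hTL : ∀ v ∈ T, ρ / 4 ≤ #(G.nbIn L v)) (hAP : ∀ z ∈ A, (#(G.nbIn P z) : ℝ) ≤ ρ)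
    (hm : ∀ z, 0 ≤ m z) (hM : 0 < ∑ z ∈ A, m z) :
    ∃ S ⊆ L, (#S : ℝ) * ρ ≤ #P / 2 ∧ (#T : ℝ) ≤ 128 * #(T ∩ S.biUnion (G.nbIn U)) ∧
      (∑ z ∈ A, m z) / 2 ≤ ∑ z ∈ A.filter (fun z => ∀ p ∈ S, ¬ G.Adj p z), m z := by
  set M := ∑ z ∈ A, m z with hMdef
  have hPc : (0 : ℝ) < #P := by exact_mod_cast Finset.card_pos.2 hP
  have hTc : (64 : ℝ) ≤ #T := by exact_mod_cast hT64
  have hTc0 : (0 : ℝ) < #T := by linarith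
  -- The cost of `p` is the proportion of the weight on `A` that it sees, plus `ρ / |P|` to limit
  -- the number of chosen vertices. Vertices of `A` have at most `ρ` neighbours in `P`, so the total
  -- cost is at most `2 ρ`, whereas vertices of `T` have at least `ρ / 4` neighbours in `L`. Hence
  -- any half of `T` can be covered at the rate `16 / |T|`.
  let δ : W → ℝ := fun p => (∑ z ∈ G.nbIn A p, m z) / M
  have hδ : ∀ p, 0 ≤ δ p := fun p => div_nonneg (sum_nonneg fun z _ => hm z) hM.le
  let ω : W → ℝ := fun p => δ p + ρ / #P
  have hω : ∀ p, 0 ≤ ω p := fun p => add_nonneg (hδ p) (div_nonneg hρ.le hPc.le)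
  have hδsum : ∑ p ∈ P, δ p ≤ ρ := by
    rw [← sum_div, div_le_iff₀ hM, sum_sum_nbIn_comm A P fun a _ => m a, hMdef, mul_sum]
    refine sum_le_sum fun z hz => ?_
    rw [sum_const, nsmul_eq_mul]
    exact mul_le_mul_of_nonneg_right (hAP z hz) (hm z)
  have hωsum : ∑ p ∈ P, ω p ≤ 2 * ρ := by
    rw [sum_add_distrib, sum_const, nsmul_eq_mul, mul_div_cancel₀ _ hPc.ne']
    linarith
  -- The cover stops at `|T| / 64`, overshooting by at most one degree `η |U| ≤ |T| / 64`. At the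
  -- rate `16 / |T|` its cost is at most `1 / 2`, which bounds both the weight seen and `|S| ρ /
  -- |P|`.
  have hgr := exists_greedy_cover (L := L) (T := T) (N := G.nbIn U) (ω := ω) (c := 16 / #T)
    (m := ⌊η * #U⌋₊) (τ := #T / 64) ?_ (by omega) ?_
  · obtain ⟨S, hSL, hS1, hS2, hS3⟩ := hgr
    set cov := T ∩ S.biUnion (G.nbIn U) with hcov
    have hη0 : 0 ≤ η * #U := by
      obtain ⟨v, hv⟩ := hP
      exact le_trans (Nat.cast_nonneg _) (hdeg v hv)
    have hcovle : (#cov : ℝ) ≤ #T / 64 + η * #U := by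
      have h1 : (#cov : ℝ) ≤ ((#T / 64 : ℕ) : ℝ) + (⌊η * #U⌋₊ : ℝ) := by exact_mod_cast hS2
      have h2 : ((#T / 64 : ℕ) : ℝ) ≤ #T / 64 := by exact_mod_cast Nat.cast_div_le
      have h3 := Nat.floor_le hη0
      linarith
    have hωS : ∑ p ∈ S, ω p ≤ 1 / 2 := by
      refine hS3.trans ?_
      rw [div_mul_eq_mul_div, div_le_iff₀ hTc0]
      have hU0 : (0 : ℝ) ≤ #U := Nat.cast_nonneg _
      nlinarith
    rw [sum_add_distrib, sum_const, nsmul_eq_mul] at hωS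
    have hδS0 : 0 ≤ ∑ p ∈ S, δ p := sum_nonneg fun p _ => hδ p
    have hSρ0 : 0 ≤ (#S : ℝ) * (ρ / #P) := mul_nonneg (Nat.cast_nonneg _) (div_nonneg hρ.le hPc.le)
    refine ⟨S, hSL, ?_, ?_, ?_⟩
    · have h1 : (#S : ℝ) * (ρ / #P) ≤ 1 / 2 := by linarith
      rw [← mul_div_assoc, div_le_iff₀ hPc] at h1
      linarith
    · have h1 : #T < 64 * (#T / 64) + 64 := by omega
      have h2 : #T ≤ 128 * #cov := by omega
      exact_mod_cast h2
    · have hsplit := sum_filter_add_sum_filter_not A (fun z => ∀ p ∈ S, ¬ G.Adj p z) m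
      have hle : ∑ z ∈ A.filter (fun z => ¬ ∀ p ∈ S, ¬ G.Adj p z), m z ≤
          ∑ p ∈ S, ∑ z ∈ G.nbIn A p, m z := by
        rw [sum_sum_nbIn_comm A S fun a _ => m a]
        refine (sum_le_sum (fun z hz => ?_)).trans
          (sum_le_sum_of_subset_of_nonneg (filter_subset _ _) fun z _ _ =>
            sum_nonneg fun _ _ => hm z)
        have h1 := (mem_filter.1 hz).2
        push Not at h1
        obtain ⟨p, hp, hpz⟩ := h1
        rw [sum_const, nsmul_eq_mul]
        have h2 : (1 : ℝ) ≤ #(G.nbIn S z) := by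
          exact_mod_cast Finset.card_pos.2 ⟨p, mem_nbIn.2 ⟨hp, hpz.symm⟩⟩
        nlinarith [hm z]
      have hδM : ∑ p ∈ S, ∑ z ∈ G.nbIn A p, m z ≤ M / 2 := by
        have h1 : ∑ p ∈ S, δ p ≤ 1 / 2 := by linarith
        rw [← sum_div, div_le_iff₀ hM] at h1
        linarith
      linarith
  · intro p hp
    rw [Nat.le_floor_iff (le_trans (Nat.cast_nonneg _) (hdeg p (hLP hp)))]
    refine le_trans ?_ (hdeg p (hLP hp))
    exact_mod_cast card_le_card inter_subset_right
  · intro T' hT' hTT'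
    have heq : ∀ p, T' ∩ G.nbIn U p = G.nbIn T' p := by
      intro p
      ext z
      simp only [mem_inter, mem_nbIn]
      exact ⟨fun h => ⟨h.1, h.2.2⟩, fun h => ⟨h.1, hTU (hT' h.1), h.2⟩⟩
    simp only [heq]
    have hTT'' : (#T : ℝ) ≤ 2 * #T' := by exact_mod_cast hTT'
    have hsum : ρ * #T / 8 ≤ ((∑ p ∈ L, #(G.nbIn T' p) : ℕ) : ℝ) := by
      rw [sum_card_nbIn_comm]
      push_cast
      calc ρ * #T / 8 ≤ #T' * (ρ / 4) := by nlinarith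
        _ = ∑ v ∈ T', ρ / 4 := by rw [sum_const, nsmul_eq_mul]
        _ ≤ _ := sum_le_sum fun v hv => hTL v (hT' hv)
    have hpos : 0 < ρ * #T / 8 := by
      have := mul_pos hρ hTc0
      linarith
    refine exists_pos_and_le_mul (fun p _ => hω p) (by exact_mod_cast hpos.trans_le hsum) ?_
    calc ∑ p ∈ L, ω p ≤ ∑ p ∈ P, ω p := sum_le_sum_of_subset_of_nonneg hLP fun p _ _ => hω p
      _ ≤ 2 * ρ := hωsum
      _ = 16 / #T * (ρ * #T / 8) := by field_simp; norm_num
      _ ≤ _ := mul_le_mul_of_nonneg_left hsum (by positivity)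

/-- The edges `ab` such that `p a b q` is an induced path and `a, b` lie in `U` outside `X`. -/
noncomputable def linkEdges (G : SimpleGraph W) (U X : Finset W) (p q : W) : Finset (W × W) :=
  (U ×ˢ U).filter fun e => G.Adj e.1 e.2 ∧ G.Adj p e.1 ∧ G.Adj q e.2 ∧ ¬ G.Adj q e.1 ∧
    ¬ G.Adj p e.2 ∧ e.1 ∉ X ∧ e.2 ∉ X

variable {U P Q X : Finset W} {x η : ℝ} {t : ℕ}

/-- Every edge `a b` with `a ∈ B` and `b ∈ A` completes to a path `p a b q` for some `p ∈ S`, and an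
average `p` receives its share of these edges. -/
theorem le_card_linkEdges {A B S : Finset W} {q : W} {C : ℝ} (hAU : A ⊆ U) (hBU : B ⊆ U)
    (hAq : ∀ b ∈ A, G.Adj q b ∧ b ∉ X ∧ ∀ p ∈ S, ¬ G.Adj p b)
    (hBq : ∀ a ∈ B, ¬ G.Adj q a ∧ a ∉ X ∧ ∃ p ∈ S, G.Adj p a)
    (hS : S.Nonempty) (hC : C * #S ≤ ((∑ b ∈ B, #(G.nbIn A b) : ℕ) : ℝ)) :
    ∃ p ∈ S, C ≤ #(G.linkEdges U X p q) := by
  have hsum : ∑ b ∈ B, #(G.nbIn A b) ≤ ∑ p ∈ S, ∑ b ∈ G.nbIn B p, #(G.nbIn A b) := by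
    have h1 := sum_sum_nbIn_comm (G := G) B S fun b _ => (#(G.nbIn A b) : ℝ)
    have h2 : ∑ b ∈ B, (#(G.nbIn A b) : ℝ) ≤ ∑ p ∈ S, ∑ b ∈ G.nbIn B p, (#(G.nbIn A b) : ℝ) := by
      rw [h1]
      refine sum_le_sum fun b hb => ?_
      obtain ⟨p, hp, hpb⟩ := (hBq b hb).2.2
      rw [sum_const, nsmul_eq_mul]
      have h3 : (1 : ℝ) ≤ #(G.nbIn S b) := by
        exact_mod_cast Finset.card_pos.2 ⟨p, mem_nbIn.2 ⟨hp, hpb.symm⟩⟩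
      have h4 : (0 : ℝ) ≤ #(G.nbIn A b) := Nat.cast_nonneg _
      nlinarith
    exact_mod_cast h2
  obtain ⟨p, hp, hpC⟩ : ∃ p ∈ S, C ≤ ((∑ b ∈ G.nbIn B p, #(G.nbIn A b) : ℕ) : ℝ) := by
    by_contra! hcon
    have h1 := sum_lt_sum_of_nonempty hS hcon
    rw [sum_const, nsmul_eq_mul] at h1
    have h2 : ((∑ b ∈ B, #(G.nbIn A b) : ℕ) : ℝ) ≤
        ∑ p ∈ S, ((∑ b ∈ G.nbIn B p, #(G.nbIn A b) : ℕ) : ℝ) := by exact_mod_cast hsum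
    linarith
  refine ⟨p, hp, hpC.trans ?_⟩
  rw [sum_card_nbIn_eq]
  norm_cast
  refine card_le_card fun e he => ?_
  simp only [mem_filter, mem_product, mem_nbIn] at he
  obtain ⟨⟨⟨h1, h2⟩, h3⟩, h4⟩ := he
  obtain ⟨h5, h6, h7⟩ := hAq _ h3
  obtain ⟨h8, h9, -⟩ := hBq _ h1
  exact mem_filter.2 ⟨mem_product.2 ⟨hBU h1, hAU h3⟩, h4, h2, h5, h8, h7 p hp, h9, h6⟩

/-- Each `z ∈ B` distributes one unit of mass evenly over its neighbours in `Q`. -/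
theorem sum_sum_inv_card_nbIn {B Q : Finset W} (hB : ∀ z ∈ B, 0 < #(G.nbIn Q z)) :
    ∑ q ∈ Q, ∑ z ∈ G.nbIn B q, (#(G.nbIn Q z) : ℝ)⁻¹ = #B := by
  rw [sum_sum_nbIn_comm B Q fun z _ => (#(G.nbIn Q z) : ℝ)⁻¹, card_eq_sum_ones, Nat.cast_sum]
  refine sum_congr rfl fun z hz => ?_
  have : (#(G.nbIn Q z) : ℝ) ≠ 0 := by exact_mod_cast (hB z hz).ne'
  rw [sum_const, nsmul_eq_mul, mul_inv_cancel₀ this, Nat.cast_one]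

/-- The `q` of mass below `zL / (4 |Q|)` carry at most a quarter of the total mass `zL`, and those
with `g q > τ / 2` carry at most `z / 8 ≤ zL / 2`, so some `q` is of neither kind. -/
theorem exists_heavy_of_sum {Q : Finset W} {m g : W → ℝ} {zL z τ : ℝ} (hm : ∀ q ∈ Q, 0 ≤ m q)
    (hg : ∀ q ∈ Q, 0 ≤ g q)
    (hQ : (0 : ℝ) < #Q) (hzL : 0 < zL) (hτ : 0 < τ) (hz : z ≤ 4 * zL) (hsum : ∑ q ∈ Q, m q = zL)
    (hmg : ∑ q ∈ Q, m q * g q ≤ τ * z / 16) :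
    ∃ q ∈ Q, zL / (4 * #Q) ≤ m q ∧ g q ≤ τ / 2 := by
  by_contra! hcon
  have h1 : ∑ q ∈ Q, m q ≤ ∑ q ∈ Q, (zL / (4 * #Q) + 2 / τ * (m q * g q)) := by
    refine sum_le_sum fun q hq => ?_
    rcases le_or_gt (zL / (4 * #Q)) (m q) with h | h
    · have h2 := hcon q hq h
      have h3 : 0 ≤ zL / (4 * #Q) := by positivity
      have h4 : m q ≤ 2 / τ * (m q * g q) := by
        rw [div_mul_eq_mul_div, le_div_iff₀ hτ]
        nlinarith [hm q hq]
      linarith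
    · have h3 : 0 ≤ 2 / τ * (m q * g q) :=
        mul_nonneg (by positivity) (mul_nonneg (hm q hq) (hg q hq))
      linarith
  rw [sum_add_distrib, sum_const, nsmul_eq_mul, ← mul_sum, hsum] at h1
  have h2 : (#Q : ℝ) * (zL / (4 * #Q)) = zL / 4 := by field_simp
  have h3 : 2 / τ * ∑ q ∈ Q, m q * g q ≤ 2 / τ * (τ * z / 16) := by gcongr
  have h4 : 2 / τ * (τ * z / 16) = z / 8 := by field_simp; ring
  linarith

theorem pow_four_mul_le {x n s a b : ℝ} (hx0 : 0 < x) (hx : x ≤ 1 / 20480) (hn : 0 < n)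
    (hs : x * s ≤ 1 / 2) (ha : x * n / 32 ≤ a) (hb : n / 1280 ≤ b) :
    x ^ 4 * n ^ 2 * s ≤ x * a * b := by
  have ha0 : 0 ≤ a := le_trans (by positivity) ha
  calc x ^ 4 * n ^ 2 * s = (x * s) * (x ^ 3 * n ^ 2) := by ring
    _ ≤ 1 / 2 * (x ^ 3 * n ^ 2) := mul_le_mul_of_nonneg_right hs (by positivity)
    _ = x ^ 2 * n ^ 2 * (x / 2) := by ring
    _ ≤ x ^ 2 * n ^ 2 * (1 / 40960) :=
        mul_le_mul_of_nonneg_left (by linarith) (by positivity)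
    _ = x * (x * n / 32) * (n / 1280) := by ring
    _ ≤ x * a * b :=
        mul_le_mul (mul_le_mul_of_nonneg_left ha hx0.le) hb (by positivity)
          (mul_nonneg hx0.le ha0)

set_option maxHeartbeats 1000000 in
/-- Two sets joined by a sparse relation `R` containing adjacency contain a pair, not in relation
`R`, that is linked by many induced paths of length three. -/
theorem IsDense.exists_le_card_linkEdges (h : G.IsDense U x t η) (hx0 : 0 < x)
    (hx : x ≤ 1 / 20480) (hη0 : 0 < η) (hη : η ≤ 1 / 1280) (ht : 2 ≤ t) (hPU : P ⊆ U) (hQU : Q ⊆ U)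
    (hP : 2 * (x ^ t * #U) ≤ #P) (hQ : x ^ t * #U ≤ #Q) (hX : (#X : ℝ) ≤ #U / 8)
    {R : W → W → Prop} (hRc : ∀ q ∈ Q, 32 * #(P.filter fun p => R p q) ≤ #P) :
    ∃ p ∈ P, ∃ q ∈ Q, ¬ R p q ∧ x ^ 4 * (#U : ℝ) ^ 2 ≤ #(G.linkEdges U X p q) := by
  have hn := h.card_pos hx0
  have hone := h.one_le
  have hxt : x ^ t ≤ x ^ 2 := pow_le_pow_of_le_one hx0.le (by linarith) ht
  have hn1 : (20480 : ℝ) ≤ #U := by nlinarith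
  have hQ0 : (0 : ℝ) < #Q := by linarith
  -- The vertex `b` will come from `Z`. The lower bound on its degree into `Q` caps the share `inv
  -- z` that any single neighbour receives.
  set Z := U.filter fun z => z ∉ X ∧ x * #Q ≤ #(G.nbIn Q z) with hZ
  have hZU : Z ⊆ U := filter_subset _ _
  have hloQ := h.card_lo_lt hx0 hη0 hQU hQ
  have hZc : 3 / 4 * (#U : ℝ) ≤ #Z := by
    have hsub : U ⊆ Z ∪ X ∪ U.filter fun v => (#(G.nbIn Q v) : ℝ) < x * #Q := by
      intro v hv
      simp only [hZ, mem_union, mem_filter]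
      by_cases h1 : v ∈ X
      · exact Or.inl (Or.inr h1)
      · rcases lt_or_ge (#(G.nbIn Q v) : ℝ) (x * #Q) with h2 | h2
        · exact Or.inr ⟨hv, h2⟩
        · exact Or.inl (Or.inl ⟨hv, h1, h2⟩)
    have h1 := (card_le_card hsub).trans ((card_union_le _ _).trans
      (Nat.add_le_add_right (card_union_le _ _) _))
    have h2 : (#U : ℝ) ≤ #Z + #X + #(U.filter fun v => (#(G.nbIn Q v) : ℝ) < x * #Q) := by
      exact_mod_cast h1
    nlinarith
  have hZd : ∀ z ∈ Z, 0 < #(G.nbIn Q z) := by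
    intro z hz
    have h1 := (mem_filter.1 hz).2.2
    have h2 : (0 : ℝ) < #(G.nbIn Q z) := lt_of_lt_of_le (mul_pos hx0 hQ0) h1
    exact_mod_cast h2
  let inv : W → ℝ := fun z => (#(G.nbIn Q z) : ℝ)⁻¹
  have hinv : ∀ z, 0 ≤ inv z := fun z => inv_nonneg.2 (Nat.cast_nonneg _)
  let mass : Finset W → W → ℝ := fun B q => ∑ z ∈ G.nbIn B q, inv z
  have hmass : ∀ B q, 0 ≤ mass B q := fun B q => sum_nonneg fun z _ => hinv z
  have hmassZ : ∑ q ∈ Q, mass Z q = #Z := sum_sum_inv_card_nbIn hZd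
  -- vertices of `P` whose `R`-neighbours carry little mass
  let κ : W → ℝ := fun p => ∑ q ∈ Q.filter (fun q => R p q), mass Z q
  have hκsum : ∀ B : Finset W, ∑ p ∈ B, κ p = ∑ q ∈ Q, mass Z q * #(B.filter fun p => R p q) := by
    intro B
    have h1 : ∀ q ∈ Q, mass Z q * #(B.filter fun p => R p q) =
        ∑ p ∈ B.filter (fun p => R p q), mass Z q := by
      intro q _
      rw [sum_const, nsmul_eq_mul, mul_comm]
    rw [sum_congr rfl h1]
    exact sum_comm' fun p q => by simp only [mem_filter]; tauto
  -- On average over `P`, the `R`-neighbours carry at most `|Z| / 32`, so by Markov at least half of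
  -- `P` survives.
  set Pst := P.filter fun p => ¬ (#Z / 16 : ℝ) < κ p with hPst
  have hZ0 : (0 : ℝ) < #Z := by linarith
  have hPstc : (#P : ℝ) / 2 ≤ #Pst := by
    have h1 := mul_card_filter_lt_le_sum P κ (fun p _ => sum_nonneg fun q _ => hmass Z q)
      (#Z / 16 : ℝ)
    have h2 : ∑ p ∈ P, κ p ≤ #Z * #P / 32 := by
      rw [hκsum, ← hmassZ, sum_mul, sum_div]
      refine sum_le_sum fun q hq => ?_
      have h3 : (32 : ℝ) * #(P.filter fun p => R p q) ≤ #P := by exact_mod_cast hRc q hq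
      nlinarith [hmass Z q]
    have h3 : (#(P.filter fun p => (#Z / 16 : ℝ) < κ p) : ℝ) + #Pst = #P := by
      exact_mod_cast card_filter_add_card_filter_not _
    have h4 : (#(P.filter fun p => (#Z / 16 : ℝ) < κ p) : ℝ) ≤ #P / 2 := by
      refine le_of_mul_le_mul_left ?_ hZ0
      linarith
    linarith
  have hPstU : Pst ⊆ U := (filter_subset _ _).trans hPU
  have hPst0 : (0 : ℝ) < #Pst := by linarith
  -- the median
  obtain ⟨ρ, hlow, htop⟩ := exists_quantile U (fun v => #(G.nbIn Pst v)) (θ := 1 / 2)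
    (by norm_num) (by norm_num)
  have hρ : x * #Pst ≤ ρ := by
    have hlo := h.card_lo_lt hx0 hη0 hPstU (by linarith)
    by_contra! hcon
    have hsub : (U.filter fun v => #(G.nbIn Pst v) ≤ ρ) ⊆
        U.filter fun v => (#(G.nbIn Pst v) : ℝ) < x * #Pst := by
      intro v hv
      rw [mem_filter] at hv ⊢
      exact ⟨hv.1, lt_of_le_of_lt (by exact_mod_cast hv.2) hcon⟩
    have h1 : (#(U.filter fun v => #(G.nbIn Pst v) ≤ ρ) : ℝ) ≤
        #(U.filter fun v => (#(G.nbIn Pst v) : ℝ) < x * #Pst) := by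
      exact_mod_cast card_le_card hsub
    nlinarith
  have hρ0 : (0 : ℝ) < ρ := lt_of_lt_of_le (mul_pos hx0 hPst0) hρ
  -- Candidates for `b` have at most `ρ` neighbours in `Pst`, candidates for `a`, the set `T`, at
  -- least `ρ`. This is what allows neighbourhoods of vertices of `Pst` to cover part of `T` and yet
  -- miss half of the weight on the candidates for `b`.
  set ZL := Z.filter fun v => #(G.nbIn Pst v) ≤ ρ with hZL
  have hZLZ : ZL ⊆ Z := filter_subset _ _
  have hZLc : (#U : ℝ) / 4 ≤ #ZL := by
    have h1 : #(U.filter fun v => #(G.nbIn Pst v) ≤ ρ) + #Z ≤ #U + #ZL := by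
      have h2 : ZL = (U.filter fun v => #(G.nbIn Pst v) ≤ ρ) ∩ Z := by
        ext v
        simp only [hZL, mem_filter, mem_inter]
        exact ⟨fun hv => ⟨⟨hZU hv.1, hv.2⟩, hv.1⟩, fun hv => ⟨hv.2, hv.1.2⟩⟩
      rw [h2, ← card_union_add_card_inter]
      exact Nat.add_le_add_right (card_le_card (union_subset (filter_subset _ _) hZU)) _
    have h2 : (#(U.filter fun v => #(G.nbIn Pst v) ≤ ρ) : ℝ) + #Z ≤ #U + #ZL := by
      exact_mod_cast h1
    linarith
  set T := U.filter fun v => ρ ≤ #(G.nbIn Pst v) ∧ v ∉ X with hT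
  have hTU : T ⊆ U := filter_subset _ _
  have hTc : 3 / 8 * (#U : ℝ) ≤ #T := by
    have hsub : (U.filter fun v => ρ ≤ #(G.nbIn Pst v)) ⊆ T ∪ X := by
      intro v hv
      rw [mem_filter] at hv
      by_cases h1 : v ∈ X
      · exact mem_union_right _ h1
      · exact mem_union_left _ (mem_filter.2 ⟨hv.1, hv.2, h1⟩)
    have h2 : (#(U.filter fun v => ρ ≤ #(G.nbIn Pst v)) : ℝ) ≤ #T + #X := by
      exact_mod_cast (card_le_card hsub).trans (card_union_le _ _)
    linarith
  have hTρ : ∀ v ∈ T, (ρ : ℝ) ≤ #(G.nbIn Pst v) := fun v hv => by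
    exact_mod_cast (mem_filter.1 hv).2.1
  -- For `v ∈ T` the neighbours in `Pst` have little `R`-mass, so the mean of `ratio v q` over `q`,
  -- weighted by mass, is at most `1 / 16`. Thus there is a `q` of large mass in `ZL` for which the
  -- ratios average at most `1 / 2` over `T`.
  let ratio : W → W → ℝ := fun v q => #((G.nbIn Pst v).filter fun p => R p q) / #(G.nbIn Pst v)
  have hratio : ∀ v q, 0 ≤ ratio v q := fun v q =>
    div_nonneg (Nat.cast_nonneg _) (Nat.cast_nonneg _)
  let g : W → ℝ := fun q => ∑ v ∈ T, ratio v q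
  have hmg : ∑ q ∈ Q, mass ZL q * g q ≤ #T * #Z / 16 := by
    have h1 : ∑ q ∈ Q, mass ZL q * g q ≤ ∑ q ∈ Q, ∑ v ∈ T, mass Z q * ratio v q := by
      refine sum_le_sum fun q _ => ?_
      rw [← mul_sum]
      refine mul_le_mul_of_nonneg_right ?_ (sum_nonneg fun v _ => hratio v q)
      exact sum_le_sum_of_subset_of_nonneg (nbIn_mono hZLZ q) fun z _ _ => hinv z
    refine h1.trans ?_
    rw [sum_comm]
    calc ∑ v ∈ T, ∑ q ∈ Q, mass Z q * ratio v q ≤ ∑ v ∈ T, (#Z / 16 : ℝ) := by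
          refine sum_le_sum fun v hv => ?_
          have hd : (0 : ℝ) < #(G.nbIn Pst v) := hρ0.trans_le (hTρ v hv)
          have h2 : ∑ q ∈ Q, mass Z q * ratio v q = (∑ p ∈ G.nbIn Pst v, κ p) / #(G.nbIn Pst v) := by
            rw [hκsum, sum_div]
            exact sum_congr rfl fun q _ => by rw [mul_div_assoc]
          rw [h2, div_le_iff₀ hd]
          calc ∑ p ∈ G.nbIn Pst v, κ p ≤ ∑ p ∈ G.nbIn Pst v, (#Z / 16 : ℝ) :=
                sum_le_sum fun p hp => not_lt.1 (mem_filter.1 (mem_nbIn.1 hp).1).2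
            _ = _ := by rw [sum_const, nsmul_eq_mul, mul_comm]
      _ = _ := by rw [sum_const, nsmul_eq_mul, mul_div_assoc]
  have hZLd : ∀ z ∈ ZL, 0 < #(G.nbIn Q z) := fun z hz => hZd z (hZLZ hz)
  have hT0 : (0 : ℝ) < #T := by linarith
  have hZL0 : (0 : ℝ) < #ZL := by linarith
  have hZle : (#Z : ℝ) ≤ #U := by exact_mod_cast card_le_card hZU
  obtain ⟨q, hq, hqm, hqg⟩ := exists_heavy_of_sum (fun q _ => hmass ZL q)
    (fun q _ => sum_nonneg fun v _ => hratio v q) hQ0 hZL0 hT0 (by linarith)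
    (sum_sum_inv_card_nbIn hZLd) hmg
  set T' := T.filter fun v => ¬ 3 / 4 < ratio v q ∧ ¬ G.Adj q v with hT'
  have hT'c : (#U : ℝ) ≤ 10 * #T' := by
    have h1 := mul_card_filter_lt_le_sum T (fun v => ratio v q) (fun v _ => hratio v q) (3 / 4)
    have hsub : T ⊆ T' ∪ T.filter (fun v => 3 / 4 < ratio v q) ∪ G.nbIn U q := by
      intro v hv
      simp only [hT', mem_union, mem_filter, mem_nbIn]
      have := hTU hv
      tauto
    have h2 := (card_le_card hsub).trans ((card_union_le _ _).trans
      (Nat.add_le_add_right (card_union_le _ _) _))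
    have h3 : (#T : ℝ) ≤ #T' + #(T.filter fun v => 3 / 4 < ratio v q) + #(G.nbIn U q) := by
      exact_mod_cast h2
    have h4 := h.deg_le q (hQU hq)
    have h5 : 3 / 4 * (#(T.filter fun v => 3 / 4 < ratio v q) : ℝ) ≤ #T / 2 := h1.trans hqg
    nlinarith
  have hT'T : T' ⊆ T := filter_subset _ _
  set Pq := Pst.filter fun p => ¬ R p q with hPq
  have hT'P : ∀ v ∈ T', (ρ : ℝ) / 4 ≤ #(G.nbIn Pq v) := by
    intro v hv
    have h1 := (mem_filter.1 hv).2.1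
    have h2 := hTρ v (hT'T hv)
    rw [not_lt, div_le_iff₀ (hρ0.trans_le h2)] at h1
    have h3 : (G.nbIn Pst v).filter (fun p => ¬ R p q) ⊆ G.nbIn Pq v := by
      intro p hp
      simp only [hPq, mem_filter, mem_nbIn] at hp ⊢
      exact ⟨⟨hp.1.1, hp.2⟩, hp.1.2⟩
    have h4 : (#((G.nbIn Pst v).filter fun p => R p q) : ℝ) +
        #((G.nbIn Pst v).filter fun p => ¬ R p q) = #(G.nbIn Pst v) := by
      exact_mod_cast card_filter_add_card_filter_not _
    have h5 : (#((G.nbIn Pst v).filter fun p => ¬ R p q) : ℝ) ≤ #(G.nbIn Pq v) := by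
      exact_mod_cast card_le_card h3
    linarith
  have hM : (#ZL : ℝ) / (4 * #Q) ≤ ∑ z ∈ G.nbIn ZL q, inv z := hqm
  have hM0 : 0 < ∑ z ∈ G.nbIn ZL q, inv z := lt_of_lt_of_le (div_pos hZL0 (by linarith)) hM
  obtain ⟨S, hSP, hSc, hScov, hSm⟩ := exists_cover_avoiding (G := G) (U := U) (P := Pst) (L := Pq)
    (T := T') (A := G.nbIn ZL q) (ρ := ρ) (η := η) (m := inv) hρ0
    (fun v hv => h.deg_le v (hPstU hv)) (by linarith)
    (Finset.card_pos.1 (by exact_mod_cast hPst0)) (filter_subset _ _) (hT'T.trans hTU) hT'c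
    (by
      have h1 : (64 : ℝ) ≤ #T' := by linarith
      exact_mod_cast h1) hT'P
    (fun z hz => by exact_mod_cast (mem_filter.1 (mem_nbIn.1 hz).1).2) hinv hM0
  set A := (G.nbIn ZL q).filter (fun z => ∀ p ∈ S, ¬ G.Adj p z) with hA
  set B := T' ∩ S.biUnion (G.nbIn U) with hB
  have hAU : A ⊆ U := fun z hz => hZU (hZLZ (mem_nbIn.1 (mem_filter.1 hz).1).1)
  have hBU : B ⊆ U := fun z hz => hTU (hT'T (mem_inter.1 hz).1)
  -- Single weights are at most `1 / (x |Q|)`, so half of the weight `|ZL| / (4 |Q|)` requires at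
  -- least `x |ZL| / 8` vertices.
  have hAc : x * #U / 32 ≤ #A := by
    have h1 : ∑ z ∈ A, inv z ≤ ∑ z ∈ A, (x * #Q)⁻¹ := by
      refine sum_le_sum fun z hz => ?_
      have hz' := hZLZ (mem_nbIn.1 (mem_filter.1 hz).1).1
      exact inv_anti₀ (mul_pos hx0 hQ0) (mem_filter.1 hz').2.2
    rw [sum_const, nsmul_eq_mul] at h1
    have h2 : (#ZL : ℝ) / (4 * #Q) / 2 ≤ #A * (x * #Q)⁻¹ :=
      (div_le_div_of_nonneg_right hM (by norm_num)).trans (hSm.trans h1)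
    rw [← div_eq_mul_inv, div_div, div_le_div_iff₀ (by linarith) (mul_pos hx0 hQ0)] at h2
    have h3 : x * #ZL ≤ 8 * #A := by
      refine le_of_mul_le_mul_right ?_ hQ0
      linarith
    nlinarith
  have hBc : (#U : ℝ) / 1280 ≤ #B := by linarith
  have hdense := h.le_sum A hAU B hBU
    (le_trans (by nlinarith) hAc) (le_trans (by nlinarith) hBc)
  have hSne : S.Nonempty := by
    by_contra hne
    rw [not_nonempty_iff_eq_empty] at hne
    have : B = ∅ := by simp [hB, hne]
    rw [this] at hBc
    simp at hBc
    linarith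
  have hScard : x * #S ≤ 1 / 2 := by
    have h1 : (#S : ℝ) * (x * #Pst) ≤ #Pst / 2 :=
      (mul_le_mul_of_nonneg_left hρ (Nat.cast_nonneg _)).trans hSc
    refine le_of_mul_le_mul_right ?_ hPst0
    linarith
  have hA1 : ∀ b ∈ A, G.Adj q b ∧ b ∉ X ∧ ∀ p ∈ S, ¬ G.Adj p b := by
    intro b hb
    obtain ⟨h1, h2⟩ := mem_filter.1 hb
    rw [mem_nbIn] at h1
    exact ⟨h1.2, (mem_filter.1 (hZLZ h1.1)).2.1, h2⟩
  have hB1 : ∀ a ∈ B, ¬ G.Adj q a ∧ a ∉ X ∧ ∃ p ∈ S, G.Adj p a := by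
    intro a ha
    obtain ⟨h1, h2⟩ := mem_inter.1 ha
    obtain ⟨p, hp, hpa⟩ := mem_biUnion.1 h2
    exact ⟨(mem_filter.1 h1).2.2, (mem_filter.1 (hT'T h1)).2.2, p, hp, (mem_nbIn.1 hpa).2⟩
  have hC : x ^ 4 * (#U : ℝ) ^ 2 * #S ≤ ((∑ b ∈ B, #(G.nbIn A b) : ℕ) : ℝ) := by
    refine le_trans ?_ hdense
    exact pow_four_mul_le hx0 hx hn hScard hAc hBc
  obtain ⟨p, hp, hpc⟩ := le_card_linkEdges hAU hBU hA1 hB1 hSne hC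
  have hpP := mem_filter.1 (hSP hp)
  exact ⟨p, (mem_filter.1 hpP.1).1, q, hq, hpP.2, hpc⟩

end RichPairs

end SimpleGraph

/-! ### Choosing the vertices attached to the ends of a handle. -/

namespace SimpleGraph

open Finset

open scoped Classical

universe u

section Selection

variable {V : Type*} [Fintype V] {W : Type u} {G : SimpleGraph W} {U : Finset W} {x η : ℝ} {t : ℕ}

/-- The nonadjacent pairs in `P × Q` linked by many induced paths of length three. -/
noncomputable def richPairs (G : SimpleGraph W) (U X P Q : Finset W) (c : ℝ) : Finset (W × W) :=
  (P ×ˢ Q).filter fun e => ¬ G.Adj e.1 e.2 ∧ c ≤ #(G.linkEdges U X e.1 e.2)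

/-- If fewer pairs were rich, half of `Q` would see at most `|P| / 64` rich partners. Then
`IsDense.exists_le_card_linkEdges`, with `R` meaning adjacent or rich, would produce a nonadjacent
pair with many links that is not rich. -/
theorem IsDense.card_mul_card_le_richPairs {P Q X : Finset W} (h : G.IsDense U x t η) (hx0 : 0 < x)
    (hx : x ≤ 1 / 20480) (hη0 : 0 < η) (hη : η ≤ 1 / 1280) (ht : 2 ≤ t) (hPU : P ⊆ U) (hQU : Q ⊆ U)
    (hP : 2 * (x ^ t * #U) ≤ #P) (hQ : 2 * (x ^ t * #U) ≤ #Q) (hX : (#X : ℝ) ≤ #U / 8)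
    (hPQ : ∀ q ∈ Q, 64 * #(G.nbIn P q) ≤ #P) :
    (#P : ℝ) * #Q ≤ 128 * #(G.richPairs U X P Q (x ^ 4 * (#U : ℝ) ^ 2)) := by
  by_contra! hcon
  set rich : W → W → Prop := fun p q => ¬ G.Adj p q ∧
    x ^ 4 * (#U : ℝ) ^ 2 ≤ #(G.linkEdges U X p q) with hrich
  have hone := h.one_le
  have hP0 : (0 : ℝ) < #P := by linarith
  have hcount : ∑ q ∈ Q, (#(P.filter fun p => rich p q) : ℝ) =
      #(G.richPairs U X P Q (x ^ 4 * (#U : ℝ) ^ 2)) := by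
    rw [richPairs, card_filter, sum_product_right]
    push_cast
    refine sum_congr rfl fun q _ => ?_
    rw [card_filter]
    push_cast
    rfl
  have hmk := mul_card_filter_lt_le_sum Q (fun q => (#(P.filter fun p => rich p q) : ℝ))
    (fun _ _ => Nat.cast_nonneg _) (#P / 64 : ℝ)
  rw [hcount] at hmk
  set Q' := Q.filter fun q => ¬ (#P / 64 : ℝ) < #(P.filter fun p => rich p q) with hQ'
  have hQ'c : (#Q : ℝ) / 2 ≤ #Q' := by
    have h1 : (#(Q.filter fun q => (#P / 64 : ℝ) < #(P.filter fun p => rich p q)) : ℝ) + #Q' = #Q := by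
      exact_mod_cast card_filter_add_card_filter_not _
    have h2 : (#(Q.filter fun q => (#P / 64 : ℝ) < #(P.filter fun p => rich p q)) : ℝ) ≤ #Q / 2 := by
      refine le_of_mul_le_mul_left ?_ hP0
      linarith
    linarith
  obtain ⟨R, hRdef⟩ : ∃ R : W → W → Prop, ∀ p q, R p q ↔ G.Adj p q ∨ rich p q :=
    ⟨_, fun _ _ => Iff.rfl⟩
  have hR : ∀ q ∈ Q', 32 * #(P.filter fun p => R p q) ≤ #P := by
    intro q hq
    rw [hQ', mem_filter, not_lt] at hq
    have h1 : (P.filter fun p => R p q) ⊆ G.nbIn P q ∪ P.filter fun p => rich p q := by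
      intro p hp
      simp only [mem_filter, mem_union, mem_nbIn, G.adj_comm q p, hRdef] at hp ⊢
      tauto
    have h2 := (card_le_card h1).trans (card_union_le _ _)
    have h3 := hPQ q hq.1
    have h4 : 64 * #(P.filter fun p => rich p q) ≤ #P := by
      have h5 : (64 : ℝ) * #(P.filter fun p => rich p q) ≤ #P := by linarith [hq.2]
      exact_mod_cast h5
    omega
  obtain ⟨p, hp, q, hq, hpq, hc⟩ := h.exists_le_card_linkEdges (Q := Q')
    (R := R) hx0 hx hη0 hη ht hPU
    ((filter_subset _ _).trans hQU) hP (show x ^ t * #U ≤ #Q' by linarith) hX hR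
  rw [hRdef, not_or] at hpq
  exact hpq.2 ⟨hpq.1, hc⟩

/-- Successive choice of vertices `y s` attached to many maps, with disjoint neighbourhoods. -/
theorem IsDense.exists_attachments (h : G.IsDense U x t η) (hx0 : 0 < x) (hx : x ≤ 1 / 4)
    (hη : 0 < η) (h1 : 1 ≤ η * #U) {a K : ℕ} (hat : a + 2 * K + 1 ≤ t)
    (hrη : 4 * (Fintype.card V + 1) * η ≤ 1 / 50) (hKη : 4 * K * η ≤ 1 / 50)
    {F₀ : Finset (V → W)} (hF : ∀ φ ∈ F₀, ∀ v, φ v ∈ U)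
    (hFc : x ^ a * (#U : ℝ) ^ Fintype.card V ≤ #F₀) (S : Finset V) (w : V) {A B C : Finset W}
    {ρ : ℕ} (hρ : 1 ≤ ρ) (hAU : A ⊆ U) (hCU : C ⊆ U) (hCA : ∀ y ∈ C, ρ ≤ #(G.nbIn A y))
    (hC : (#U : ℝ) / 8 ≤ #C) (hB : (#B : ℝ) ≤ #U / 50) (k : ℕ) (hk : k ≤ K) :
    ∃ (y : ℕ → W) (P : ℕ → Finset W) (F : Finset (V → W)), F ⊆ F₀ ∧
      x ^ (2 * k) * #F₀ ≤ #F ∧ ∀ s < k, y s ∈ C ∧ y s ∉ B ∧ P s ⊆ G.nbIn A (y s) ∧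
        #(P s) = (ρ + 1) / 2 ∧ (∀ s' < k, s ≠ s' → Disjoint (P s) (P s')) ∧
        ∀ φ ∈ F, φ ∈ attach G F₀ S w (y s) := by
  have hn := h.card_pos hx0
  induction k with
  | zero =>
    obtain ⟨u₀, hu₀⟩ : U.Nonempty := Finset.card_pos.1 (by exact_mod_cast hn)
    exact ⟨fun _ => u₀, fun _ => ∅, F₀, subset_rfl, by simp, by simp⟩
  | succ k ih =>
    obtain ⟨y, P, F, hFF, hFk, hs⟩ := ih (by omega)
    set X := (range k).biUnion P with hX
    have hXU : X ⊆ U := by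
      intro z hz
      obtain ⟨s, hsk, hz⟩ := mem_biUnion.1 hz
      exact hAU (mem_nbIn.1 ((hs s (mem_range.1 hsk)).2.2.1 hz)).1
    have hXc : #X ≤ k * ((ρ + 1) / 2) := by
      have := card_biUnion_le_card_mul (range k) P ((ρ + 1) / 2) fun s hsk =>
        (hs s (mem_range.1 hsk)).2.2.2.1.le
      rwa [card_range] at this
    have hK0 : (1 : ℝ) ≤ K := by exact_mod_cast (show 1 ≤ K by omega)
    have hhi := h.card_hi_le (σ := 1 / (4 * K)) hXU
    -- As `|X| ≤ K ⌈ρ / 2⌉`, a vertex outside `E₁` has at most `⌈ρ / 2⌉ / 4` neighbours in `X`, so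
    -- of its `ρ` neighbours in `A` enough remain for a set disjoint from the earlier ones.
    set E₁ := U.filter fun v => 1 / (4 * K : ℝ) * #X < #(G.nbIn X v) with hE₁
    have hE₁c : (#E₁ : ℝ) ≤ #U / 50 := by
      rw [one_div_mul_eq_div, div_le_iff₀ (by linarith)] at hhi
      nlinarith
    have hFc' : x ^ (a + 2 * k) * (#U : ℝ) ^ Fintype.card V ≤ #F := by
      refine le_trans ?_ hFk
      rw [pow_add, mul_comm (x ^ a), mul_assoc]
      exact mul_le_mul_of_nonneg_left hFc (pow_nonneg hx0.le _)
    have hlo := h.card_attach_lo_lt hx0 (by linarith) hη h1 (by omega)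
      (fun φ hφ => hF φ (hFF hφ)) hFc' S w
    set E₂ := U.filter fun y => (#(attach G F S w y) : ℝ) < x / 4 * #F with hE₂
    have hE₂c : (#E₂ : ℝ) ≤ #U / 50 := by nlinarith
    -- `C` has at least `|U| / 8` vertices, while each of `B`, `E₁`, `E₂` has at most `|U| / 50`.
    obtain ⟨v, hv⟩ : (C \ (B ∪ E₁ ∪ E₂)).Nonempty := by
      rw [← Finset.card_pos]
      have h2 : #C ≤ #(C \ (B ∪ E₁ ∪ E₂)) + #(B ∪ E₁ ∪ E₂) := card_le_card_sdiff_add_card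
      have h3 := (card_union_le (B ∪ E₁) E₂).trans (Nat.add_le_add_right (card_union_le B E₁) _)
      have h4 : (#C : ℝ) ≤ #(C \ (B ∪ E₁ ∪ E₂)) + (#B + #E₁ + #E₂) := by
        exact_mod_cast h2.trans (Nat.add_le_add_left h3 _)
      have h5 : (0 : ℝ) < #(C \ (B ∪ E₁ ∪ E₂)) := by linarith
      exact_mod_cast h5
    simp only [mem_sdiff, mem_union, not_or] at hv
    obtain ⟨hvC, ⟨hvB, hvE₁⟩, hvE₂⟩ := hv
    have hvU := hCU hvC
    have hvX : 4 * #(G.nbIn X v) ≤ (ρ + 1) / 2 := by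
      have h2 : (#(G.nbIn X v) : ℝ) ≤ 1 / (4 * K : ℝ) * #X := by
        by_contra! h3
        exact hvE₁ (mem_filter.2 ⟨hvU, h3⟩)
      rw [one_div_mul_eq_div, le_div_iff₀ (by linarith)] at h2
      have h3 : #(G.nbIn X v) * (4 * K) ≤ #X := by exact_mod_cast h2
      have h4 : k * ((ρ + 1) / 2) ≤ K * ((ρ + 1) / 2) := Nat.mul_le_mul_right _ (by omega)
      have h5 : K * (4 * #(G.nbIn X v)) ≤ K * ((ρ + 1) / 2) := by
        calc K * (4 * #(G.nbIn X v)) = #(G.nbIn X v) * (4 * K) := by ring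
          _ ≤ K * ((ρ + 1) / 2) := h3.trans (hXc.trans h4)
      exact le_of_mul_le_mul_left h5 (by omega)
    obtain ⟨Pv, hPv, hPvc⟩ : ∃ Pv ⊆ G.nbIn A v \ X, #Pv = (ρ + 1) / 2 := by
      refine exists_subset_card_eq ?_
      have h2 : #(G.nbIn A v) ≤ #(G.nbIn A v \ X) + #(G.nbIn X v) := by
        have h3 := card_sdiff_add_card_inter (G.nbIn A v) X
        have h4 : G.nbIn A v ∩ X ⊆ G.nbIn X v := by
          intro z hz
          rw [mem_inter, mem_nbIn] at hz
          exact mem_nbIn.2 ⟨hz.2, hz.1.2⟩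
        have := card_le_card h4
        omega
      have := hCA v hvC
      omega
    refine ⟨Function.update y k v, Function.update P k Pv, attach G F S w v,
      (filter_subset _ _).trans hFF, ?_, ?_⟩
    · have h2 : x / 4 * #F ≤ #(attach G F S w v) := by
        by_contra! h3
        exact hvE₂ (mem_filter.2 ⟨hvU, h3⟩)
      refine le_trans ?_ h2
      calc x ^ (2 * (k + 1)) * #F₀ = x ^ 2 * (x ^ (2 * k) * #F₀) := by ring
        _ ≤ x / 4 * #F := by
          refine mul_le_mul (by nlinarith) hFk ?_ (by linarith)
          exact mul_nonneg (pow_nonneg hx0.le _) (Nat.cast_nonneg _)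
    · have hPvX : ∀ s < k, Disjoint Pv (P s) := by
        intro s hsk
        rw [Finset.disjoint_left]
        intro z hz hz'
        exact (mem_sdiff.1 (hPv hz)).2 (mem_biUnion.2 ⟨s, mem_range.2 hsk, hz'⟩)
      intro s hsk
      rcases Nat.lt_succ_iff_lt_or_eq.1 hsk with hlt | rfl
      · obtain ⟨i1, i2, i3, i4, i5, i6⟩ := hs s hlt
        rw [Function.update_of_ne hlt.ne, Function.update_of_ne hlt.ne]
        refine ⟨i1, i2, i3, i4, ?_, fun φ hφ => i6 φ (mem_filter.1 hφ).1⟩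
        intro s' hs' hne
        rcases Nat.lt_succ_iff_lt_or_eq.1 hs' with hlt' | rfl
        · rw [Function.update_of_ne hlt'.ne]
          exact i5 s' hlt' hne
        · rw [Function.update_self]
          exact (hPvX s hlt).symm
      · rw [Function.update_self, Function.update_self]
        refine ⟨hvC, hvB, hPv.trans sdiff_subset, hPvc, ?_, fun φ hφ => ?_⟩
        · intro s' hs' hne
          rw [Function.update_of_ne hne.symm]
          exact hPvX s' (by omega)
        · obtain ⟨j1, j2⟩ := mem_filter.1 hφ
          exact mem_filter.2 ⟨hFF j1, j2⟩

/-- The vertices of `A` equal or adjacent to `v`. -/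
noncomputable def touching (G : SimpleGraph W) (A : Finset W) (v : W) : Finset W :=
  A.filter fun z => z = v ∨ G.Adj z v

/-- Because the `P s` are disjoint, the vertices counted are distinct: neighbours of `v` in `A` and
possibly `v` itself, at most `ρ + 1 ≤ 2 ρ`. The bound does not grow with `K`, so for large `K` an
average `P s` is almost untouched. -/
theorem sum_card_touching_le {A : Finset W} {P : ℕ → Finset W} {K ρ : ℕ} {v : W} (hρ : 1 ≤ ρ)
    (hv : #(G.nbIn A v) ≤ ρ) (hP : ∀ s < K, P s ⊆ A)
    (hd : ∀ s < K, ∀ s' < K, s ≠ s' → Disjoint (P s) (P s')) :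
    ∑ s ∈ range K, #(G.touching (P s) v) ≤ 2 * ρ := by
  rw [← card_biUnion]
  · have hsub : (range K).biUnion (fun s => G.touching (P s) v) ⊆ insert v (G.nbIn A v) := by
      intro z hz
      obtain ⟨s, hs, hz⟩ := mem_biUnion.1 hz
      obtain ⟨hz1, hz2⟩ := mem_filter.1 hz
      rcases hz2 with rfl | hz2
      · exact mem_insert_self _ _
      · exact mem_insert_of_mem (mem_nbIn.2 ⟨hP s (mem_range.1 hs) hz1, hz2.symm⟩)
    have := (card_le_card hsub).trans (card_insert_le _ _)
    omega
  · intro s hs s' hs' hne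
    rw [coe_range, Set.mem_Iio] at hs hs'
    exact disjoint_filter_filter (hd s hs s' hs' hne)

theorem sum_card_nbIn_le {A : Finset W} {P : ℕ → Finset W} {K ρ : ℕ} {v : W}
    (hv : #(G.nbIn A v) ≤ ρ) (hP : ∀ s < K, P s ⊆ A)
    (hd : ∀ s < K, ∀ s' < K, s ≠ s' → Disjoint (P s) (P s')) :
    ∑ s ∈ range K, #(G.nbIn (P s) v) ≤ ρ := by
  rw [← card_biUnion]
  · refine (card_le_card fun z hz => ?_).trans hv
    obtain ⟨s, hs, hz⟩ := mem_biUnion.1 hz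
    obtain ⟨hz1, hz2⟩ := mem_nbIn.1 hz
    exact mem_nbIn.2 ⟨hP s (mem_range.1 hs) hz1, hz2⟩
  · intro s hs s' hs' hne
    rw [coe_range, Set.mem_Iio] at hs hs'
    exact disjoint_filter_filter (hd s hs s' hs' hne)

theorem exists_mul_le_sum {K : ℕ} (hK : 0 < K) (f : ℕ → ℝ) :
    ∃ s < K, K * f s ≤ ∑ s ∈ range K, f s := by
  by_contra! hcon
  have hK' : (0 : ℝ) < K := by exact_mod_cast hK
  have h1 : ∑ s ∈ range K, (∑ s ∈ range K, f s) / K < ∑ s ∈ range K, f s := by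
    refine sum_lt_sum_of_nonempty ⟨0, mem_range.2 hK⟩ fun s hs => ?_
    rw [div_lt_iff₀ hK', mul_comm]
    exact hcon s (mem_range.1 hs)
  rw [sum_const, card_range, nsmul_eq_mul, mul_div_cancel₀ _ hK'.ne'] at h1
  exact lt_irrefl _ h1

end Selection

end SimpleGraph

/-! ### Completing two attached vertices to a handle. -/

namespace SimpleGraph

open Finset

open scoped Classical

universe u

section Completions

variable {V : Type*} {W : Type u} {G : SimpleGraph W} {U : Finset W} {x η : ℝ} {t : ℕ}

theorem exists_nat_mul_le_sum {K : ℕ} (hK : 0 < K) (f : ℕ → ℕ) :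
    ∃ s < K, K * f s ≤ ∑ s ∈ range K, f s := by
  obtain ⟨s, hs, h⟩ := exists_mul_le_sum hK fun s => (f s : ℝ)
  exact ⟨s, hs, by exact_mod_cast h⟩

/-- The vertices of `U` touching `y`, `y'` or the image of `S`. -/
noncomputable def blocked (G : SimpleGraph W) (U : Finset W) (S : Finset V) (φ : V → W) (y y' : W) :
    Finset W :=
  G.touching U y ∪ G.touching U y' ∪ S.biUnion fun u => G.touching U (φ u)

/-- The ways `((p, q), (a, b))` of completing `y` and `y'` to an induced path `y p a b q y'` whose
inner vertices do not touch the image of `S`. -/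
noncomputable def completions (G : SimpleGraph W) (U : Finset W) (S : Finset V) (φ : V → W)
    (y y' : W) : Finset ((W × W) × (W × W)) :=
  ((U ×ˢ U) ×ˢ (U ×ˢ U)).filter fun e =>
    (G.Adj y e.1.1 ∧ G.Adj y' e.1.2 ∧ ¬ G.Adj e.1.1 e.1.2 ∧ ¬ G.Adj e.1.1 y' ∧ ¬ G.Adj e.1.2 y ∧
      ∀ u ∈ S, (e.1.1 ≠ φ u ∧ ¬ G.Adj e.1.1 (φ u)) ∧ (e.1.2 ≠ φ u ∧ ¬ G.Adj e.1.2 (φ u))) ∧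
    e.2 ∈ G.linkEdges U (blocked G U S φ y y') e.1.1 e.1.2

theorem mem_completions {S : Finset V} {φ : V → W} {y y' : W} {e : (W × W) × (W × W)} :
    e ∈ completions G U S φ y y' ↔ e ∈ (U ×ˢ U) ×ˢ (U ×ˢ U) ∧
      (G.Adj y e.1.1 ∧ G.Adj y' e.1.2 ∧ ¬ G.Adj e.1.1 e.1.2 ∧ ¬ G.Adj e.1.1 y' ∧ ¬ G.Adj e.1.2 y ∧
      ∀ u ∈ S, (e.1.1 ≠ φ u ∧ ¬ G.Adj e.1.1 (φ u)) ∧ (e.1.2 ≠ φ u ∧ ¬ G.Adj e.1.2 (φ u))) ∧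
    e.2 ∈ G.linkEdges U (blocked G U S φ y y') e.1.1 e.1.2 := mem_filter

theorem IsDense.card_blocked_le (h : G.IsDense U x t η) (h1 : 1 ≤ η * #U)
    {S : Finset V} (hS : ((#S : ℝ) + 2) * (2 * η) ≤ 1 / 8) {φ : V → W} (hφ : ∀ u ∈ S, φ u ∈ U)
    {y y' : W} (hy : y ∈ U) (hy' : y' ∈ U) : (#(blocked G U S φ y y') : ℝ) ≤ #U / 8 := by
  have h2 : #(blocked G U S φ y y') ≤ #(G.touching U y) + #(G.touching U y') +
      ∑ u ∈ S, #(G.touching U (φ u)) :=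
    (card_union_le _ _).trans (Nat.add_le_add (card_union_le _ _) card_biUnion_le)
  have h3 : (#(blocked G U S φ y y') : ℝ) ≤ #(G.touching U y) + #(G.touching U y') +
      ∑ u ∈ S, (#(G.touching U (φ u)) : ℝ) := by exact_mod_cast h2
  have h4 : ∑ u ∈ S, (#(G.touching U (φ u)) : ℝ) ≤ ∑ u ∈ S, 2 * η * #U :=
    sum_le_sum fun u hu => h.card_touching_le h1 (hφ u hu)
  rw [sum_const, nsmul_eq_mul] at h4
  have h5 : (#(G.touching U y) : ℝ) ≤ 2 * η * #U := h.card_touching_le h1 hy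
  have h6 : (#(G.touching U y') : ℝ) ≤ 2 * η * #U := h.card_touching_le h1 hy'
  have hn : (0 : ℝ) ≤ #U := Nat.cast_nonneg _
  nlinarith

theorem card_richPairs_mul_le_completions {S : Finset V} {φ : V → W} {y y' : W} {P Q : Finset W}
    {c : ℝ} (hPU : P ⊆ U) (hQU : Q ⊆ U)
    (hP : ∀ p ∈ P, G.Adj y p ∧ ¬ G.Adj p y' ∧ ∀ u ∈ S, p ≠ φ u ∧ ¬ G.Adj p (φ u))
    (hQ : ∀ q ∈ Q, G.Adj y' q ∧ ¬ G.Adj q y ∧ ∀ u ∈ S, q ≠ φ u ∧ ¬ G.Adj q (φ u)) :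
    #(G.richPairs U (blocked G U S φ y y') P Q c) * c ≤ #(completions G U S φ y y') := by
  set R := G.richPairs U (blocked G U S φ y y') P Q c with hR
  have hsub : ((R ×ˢ (U ×ˢ U)).filter fun e =>
      e.2 ∈ G.linkEdges U (blocked G U S φ y y') e.1.1 e.1.2) ⊆ completions G U S φ y y' := by
    intro e he
    obtain ⟨h1, h2⟩ := mem_filter.1 he
    obtain ⟨h3, h4⟩ := mem_product.1 h1
    rw [hR, richPairs, mem_filter, mem_product] at h3
    obtain ⟨⟨h5, h6⟩, h7, -⟩ := h3
    obtain ⟨i1, i2, i3⟩ := hP _ h5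
    obtain ⟨j1, j2, j3⟩ := hQ _ h6
    exact mem_filter.2 ⟨mem_product.2 ⟨mem_product.2 ⟨hPU h5, hQU h6⟩, h4⟩,
      ⟨i1, j1, h7, i2, j2, fun u hu => ⟨i3 u hu, j3 u hu⟩⟩, h2⟩
  have hcard : #((R ×ˢ (U ×ˢ U)).filter fun e =>
      e.2 ∈ G.linkEdges U (blocked G U S φ y y') e.1.1 e.1.2) =
      ∑ r ∈ R, #(G.linkEdges U (blocked G U S φ y y') r.1 r.2) := by
    rw [card_filter, sum_product]
    refine sum_congr rfl fun r _ => ?_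
    rw [← card_filter]
    congr 1
    ext i
    exact ⟨fun h => (mem_filter.1 h).2, fun h => mem_filter.2 ⟨(mem_filter.1 h).1, h⟩⟩
  have h1 : (#R : ℝ) * c ≤ ((∑ r ∈ R, #(G.linkEdges U (blocked G U S φ y y') r.1 r.2) : ℕ) : ℝ) := by
    rw [← nsmul_eq_mul, Nat.cast_sum]
    exact card_nsmul_le_sum _ _ _ fun r hr => (mem_filter.1 hr).2.2
  refine h1.trans ?_
  rw [← hcard]
  exact_mod_cast card_le_card hsub

/-- Choice of `s, s'` such that the sets `P s` and `P' s'` are almost untouched, and almost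
anticomplete to each other. -/
theorem exists_untouched {A : Finset W} {S : Finset V} {φ : V → W} {ρ ρ' K K' : ℕ} {y y' : ℕ → W}
    {P P' : ℕ → Finset W} (hρ : 1 ≤ ρ) (hρ' : 1 ≤ ρ')
    (hAρ : ∀ q ∈ A, #(G.nbIn U q) ≤ ρ)
    (hφρ : ∀ u ∈ S, #(G.nbIn U (φ u)) ≤ ρ) (hφρ' : ∀ u ∈ S, #(G.nbIn A (φ u)) ≤ ρ')
    (hyρ : ∀ s < K, #(G.nbIn A (y s)) ≤ ρ')
    (hP : ∀ s < K, P s ⊆ U) (hPc : ∀ s < K, #(P s) = (ρ + 1) / 2)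
    (hPd : ∀ s < K, ∀ s' < K, s ≠ s' → Disjoint (P s) (P s'))
    (hP' : ∀ s < K', P' s ⊆ A) (hPc' : ∀ s < K', #(P' s) = (ρ' + 1) / 2)
    (hPd' : ∀ s < K', ∀ s' < K', s ≠ s' → Disjoint (P' s) (P' s'))
    (hyP : ∀ s < K, ∀ s' < K', 50 * #(G.nbIn (P s) (y' s')) ≤ (ρ + 1) / 2)
    (hK : 400 * (4 * #S + 2) ≤ K) (hK' : 200 * (#S + K) ≤ K') :
    ∃ s < K, ∃ s' < K', ∃ P₁ ⊆ P s, ∃ Q₁ ⊆ P' s', ρ ≤ 3 * #P₁ ∧ ρ' ≤ 4 * #Q₁ ∧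
      (∀ p ∈ P₁, ¬ G.Adj p (y' s') ∧ ∀ u ∈ S, p ≠ φ u ∧ ¬ G.Adj p (φ u)) ∧
      (∀ q ∈ Q₁, ¬ G.Adj q (y s) ∧ ∀ u ∈ S, q ≠ φ u ∧ ¬ G.Adj q (φ u)) ∧
      ∀ q ∈ Q₁, 64 * #(G.nbIn P₁ q) ≤ #P₁ := by
  -- The index `s'` comes first. Over all `s'` together, the image of `S` and all the `y s` touch at
  -- most `(|S| + K) 2 ρ'` vertices, so with `K' ≥ 200 (|S| + K)` some `P' s'` loses at most a
  -- fiftieth, whatever `s` will be.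
  obtain ⟨s', hs', hf⟩ := exists_nat_mul_le_sum (K := K') (by omega) fun s' =>
    ∑ u ∈ S, #(G.touching (P' s') (φ u)) + ∑ s ∈ range K, #(G.touching (P' s') (y s))
  have hf' : ∑ s' ∈ range K', (∑ u ∈ S, #(G.touching (P' s') (φ u)) +
      ∑ s ∈ range K, #(G.touching (P' s') (y s))) ≤ (#S + K) * (2 * ρ') := by
    rw [sum_add_distrib, sum_comm, sum_comm (s := range K'), add_mul]
    refine Nat.add_le_add (sum_le_card_nsmul _ _ _ fun u hu => ?_) ?_
    · exact sum_card_touching_le hρ' (hφρ' u hu) hP' hPd'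
    · refine (sum_le_card_nsmul (range K) _ (2 * ρ') fun s hs => ?_).trans (by simp)
      exact sum_card_touching_le hρ' (hyρ s (mem_range.1 hs)) hP' hPd'
  set f := ∑ u ∈ S, #(G.touching (P' s') (φ u)) + ∑ s ∈ range K, #(G.touching (P' s') (y s)) with hfd
  have hf50 : 50 * f ≤ (ρ' + 1) / 2 := by
    have h1 : (#S + K) * (200 * f) ≤ (#S + K) * (4 * ((ρ' + 1) / 2)) := by
      calc (#S + K) * (200 * f) = 200 * (#S + K) * f := by ring
        _ ≤ K' * f := Nat.mul_le_mul_right _ hK'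
        _ ≤ (#S + K) * (2 * ρ') := hf.trans hf'
        _ ≤ (#S + K) * (4 * ((ρ' + 1) / 2)) := Nat.mul_le_mul_left _ (by omega)
    have h2 := le_of_mul_le_mul_left h1 (by omega)
    omega
  set Q₀ := P' s' \ (S.biUnion (fun u => G.touching (P' s') (φ u)) ∪
    (range K).biUnion fun s => G.touching (P' s') (y s)) with hQ₀
  have hQ₀c : (ρ' + 1) / 2 ≤ #Q₀ + f := by
    rw [← hPc' s' hs']
    refine card_le_card_sdiff_add_card.trans (Nat.add_le_add_left ?_ _)
    exact (card_union_le _ _).trans (Nat.add_le_add card_biUnion_le card_biUnion_le)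
  have hQ₀A : Q₀ ⊆ A := sdiff_subset.trans (hP' s' hs')
  -- The touched part of `P s` and the edges from `Q₀` to `P s` must both be small; with the weight
  -- `|Q₀|` on the first, one average controls both.
  obtain ⟨s, hs, hg⟩ := exists_nat_mul_le_sum (K := K) (by omega) fun s =>
    #Q₀ * ∑ u ∈ S, #(G.touching (P s) (φ u)) + ∑ q ∈ Q₀, #(G.nbIn (P s) q)
  have hg' : ∑ s ∈ range K, (#Q₀ * ∑ u ∈ S, #(G.touching (P s) (φ u)) +
      ∑ q ∈ Q₀, #(G.nbIn (P s) q)) ≤ #Q₀ * ((2 * #S + 1) * ρ) := by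
    rw [sum_add_distrib, ← mul_sum, sum_comm, sum_comm (s := range K)]
    have h1 : ∑ u ∈ S, ∑ s ∈ range K, #(G.touching (P s) (φ u)) ≤ #S * (2 * ρ) :=
      sum_le_card_nsmul _ _ _ fun u hu => sum_card_touching_le hρ (hφρ u hu) hP hPd
    have h2 : ∑ q ∈ Q₀, ∑ s ∈ range K, #(G.nbIn (P s) q) ≤ #Q₀ * ρ :=
      sum_le_card_nsmul _ _ _ fun q hq => sum_card_nbIn_le (hAρ q (hQ₀A hq)) hP hPd
    calc _ ≤ #Q₀ * (#S * (2 * ρ)) + #Q₀ * ρ := Nat.add_le_add (Nat.mul_le_mul_left _ h1) h2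
      _ = _ := by ring
  set τ := ∑ u ∈ S, #(G.touching (P s) (φ u)) with hτ
  set g := ∑ q ∈ Q₀, #(G.nbIn (P s) q) with hgd
  have hQ₀0 : 0 < #Q₀ := by omega
  have hg400 : 400 * (#Q₀ * τ + g) ≤ #Q₀ * ((ρ + 1) / 2) := by
    have h1 : (4 * #S + 2) * (400 * (#Q₀ * τ + g)) ≤ (4 * #S + 2) * (#Q₀ * ((ρ + 1) / 2)) := by
      calc (4 * #S + 2) * (400 * (#Q₀ * τ + g)) = 400 * (4 * #S + 2) * (#Q₀ * τ + g) := by ring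
        _ ≤ K * (#Q₀ * τ + g) := Nat.mul_le_mul_right _ hK
        _ ≤ #Q₀ * ((2 * #S + 1) * ρ) := hg.trans hg'
        _ ≤ #Q₀ * ((2 * #S + 1) * (2 * ((ρ + 1) / 2))) :=
            Nat.mul_le_mul_left _ (Nat.mul_le_mul_left _ (by omega))
        _ = _ := by ring
    exact le_of_mul_le_mul_left h1 (by omega)
  have hτ400 : 400 * τ ≤ (ρ + 1) / 2 := by
    refine le_of_mul_le_mul_left (a := #Q₀) ?_ hQ₀0
    calc #Q₀ * (400 * τ) ≤ 400 * (#Q₀ * τ + g) := by nlinarith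
      _ ≤ _ := hg400
  have hgg : 400 * g ≤ #Q₀ * ((ρ + 1) / 2) := by nlinarith
  set P₁ := P s \ (S.biUnion (fun u => G.touching (P s) (φ u)) ∪ G.nbIn (P s) (y' s')) with hP₁
  have hP₁c : (ρ + 1) / 2 ≤ #P₁ + (τ + #(G.nbIn (P s) (y' s'))) := by
    rw [← hPc s hs]
    refine card_le_card_sdiff_add_card.trans (Nat.add_le_add_left ?_ _)
    exact (card_union_le _ _).trans (Nat.add_le_add_right card_biUnion_le _)
  have hyPs := hyP s hs s' hs'
  have hP₁391 : 391 * ((ρ + 1) / 2) ≤ 400 * #P₁ := by omega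
  set Q₁ := Q₀.filter fun q => 64 * #(G.nbIn P₁ q) ≤ #P₁ with hQ₁
  set Qb := Q₀.filter fun q => ¬ 64 * #(G.nbIn P₁ q) ≤ #P₁ with hQb
  have hsplit : #Q₁ + #Qb = #Q₀ := card_filter_add_card_filter_not _
  have hbad : 391 * #Qb ≤ 64 * #Q₀ := by
    have h1 : #Qb * #P₁ ≤ 64 * g := by
      calc #Qb * #P₁ = ∑ q ∈ Qb, #P₁ := by rw [sum_const, smul_eq_mul]
        _ ≤ ∑ q ∈ Qb, 64 * #(G.nbIn (P s) q) := by
            refine sum_le_sum fun q hq => ?_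
            have h2 := (mem_filter.1 hq).2
            have h3 : #(G.nbIn P₁ q) ≤ #(G.nbIn (P s) q) := card_le_card (nbIn_mono sdiff_subset q)
            omega
        _ ≤ ∑ q ∈ Q₀, 64 * #(G.nbIn (P s) q) :=
            sum_le_sum_of_subset_of_nonneg (filter_subset _ _) fun _ _ _ => Nat.zero_le _
        _ = 64 * g := by rw [mul_sum]
    have h2 : (ρ + 1) / 2 * (391 * #Qb) ≤ (ρ + 1) / 2 * (64 * #Q₀) := by nlinarith
    exact le_of_mul_le_mul_left h2 (by omega)
  refine ⟨s, hs, s', hs', P₁, sdiff_subset, Q₁, (filter_subset _ _).trans sdiff_subset, by omega,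
    by omega, ?_, ?_, fun q hq => (mem_filter.1 hq).2⟩
  · intro p hp
    simp only [hP₁, mem_sdiff, mem_union, mem_biUnion, touching, mem_filter, mem_nbIn, not_or,
      not_exists, not_and] at hp
    obtain ⟨h1, h2, h3⟩ := hp
    exact ⟨fun h4 => h3 h1 h4.symm, fun u hu => h2 u hu h1⟩
  · intro q hq
    have hq0 := (mem_filter.1 hq).1
    simp only [hQ₀, mem_sdiff, mem_union, mem_biUnion, touching, mem_filter, mem_range, not_or,
      not_exists, not_and] at hq0
    obtain ⟨h1, h2, h3⟩ := hq0
    exact ⟨(h3 s hs h1).2, fun u hu => h2 u hu h1⟩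

/-- Untouched sets `P₁` and `Q₁` have about `x |U|` vertices each, a constant proportion of their
pairs is rich, and each rich pair has `x ^ 4 |U| ^ 2` links. This gives the power six of `x`; the
seventh absorbs the constants. -/
theorem IsDense.exists_le_card_completions (h : G.IsDense U x t η) (hx0 : 0 < x)
    (hx : x ≤ 1 / 20480) (hη0 : 0 < η) (hη : η ≤ 1 / 1280) (h1 : 1 ≤ η * #U) (ht : 2 ≤ t)
    {A : Finset W} {S : Finset V} (hS : ((#S : ℝ) + 2) * (2 * η) ≤ 1 / 8)
    {φ : V → W} {ρ ρ' K K' : ℕ} {y y' : ℕ → W}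
    {P P' : ℕ → Finset W} (hAU : A ⊆ U) (hρ : x * #U ≤ 2 * ρ) (hρ' : x * #U ≤ 2 * ρ')
    (hAρ : ∀ q ∈ A, #(G.nbIn U q) ≤ ρ) (hφU : ∀ u ∈ S, φ u ∈ U)
    (hφρ : ∀ u ∈ S, #(G.nbIn U (φ u)) ≤ ρ) (hφρ' : ∀ u ∈ S, #(G.nbIn A (φ u)) ≤ ρ')
    (hyU : ∀ s < K, y s ∈ U) (hyρ : ∀ s < K, #(G.nbIn A (y s)) ≤ ρ')
    (hP : ∀ s < K, P s ⊆ G.nbIn U (y s)) (hPc : ∀ s < K, #(P s) = (ρ + 1) / 2)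
    (hPd : ∀ s < K, ∀ s' < K, s ≠ s' → Disjoint (P s) (P s'))
    (hyU' : ∀ s < K', y' s ∈ U)
    (hP' : ∀ s < K', P' s ⊆ G.nbIn A (y' s)) (hPc' : ∀ s < K', #(P' s) = (ρ' + 1) / 2)
    (hPd' : ∀ s < K', ∀ s' < K', s ≠ s' → Disjoint (P' s) (P' s'))
    (hyP : ∀ s < K, ∀ s' < K', 50 * #(G.nbIn (P s) (y' s')) ≤ (ρ + 1) / 2)
    (hK : 400 * (4 * #S + 2) ≤ K) (hK' : 200 * (#S + K) ≤ K') :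
    ∃ s < K, ∃ s' < K', x ^ 7 * (#U : ℝ) ^ 4 ≤ #(completions G U S φ (y s) (y' s')) := by
  have hn := h.card_pos hx0
  have hxn := mul_pos hx0 hn
  have hρ1 : 1 ≤ ρ := by
    by_contra! h0
    have : ρ = 0 := by omega
    rw [this] at hρ
    norm_num at hρ
    linarith
  have hρ1' : 1 ≤ ρ' := by
    by_contra! h0
    have : ρ' = 0 := by omega
    rw [this] at hρ'
    norm_num at hρ'
    linarith
  obtain ⟨s, hs, s', hs', P₁, hP₁, Q₁, hQ₁, hP₁c, hQ₁c, hP₁t, hQ₁t, hPQ⟩ :=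
    exists_untouched (G := G) (U := U) (y := y) (y' := y') hρ1 hρ1' hAρ hφρ hφρ' hyρ
    (fun s hs => (hP s hs).trans (nbIn_subset _ _)) hPc hPd
    (fun s hs => (hP' s hs).trans (nbIn_subset _ _)) hPc' hPd' hyP hK hK'
  refine ⟨s, hs, s', hs', ?_⟩
  have hP₁U : P₁ ⊆ U := hP₁.trans ((hP s hs).trans (nbIn_subset _ _))
  have hQ₁U : Q₁ ⊆ U := hQ₁.trans ((hP' s' hs').trans ((nbIn_subset _ _).trans hAU))
  have hP₁r : (ρ : ℝ) ≤ 3 * #P₁ := by exact_mod_cast hP₁c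
  have hQ₁r : (ρ' : ℝ) ≤ 4 * #Q₁ := by exact_mod_cast hQ₁c
  have hxt : x ^ t * #U ≤ x * (x * #U) := by
    calc x ^ t * #U ≤ x ^ 2 * #U :=
          mul_le_mul_of_nonneg_right (pow_le_pow_of_le_one hx0.le (by linarith) ht) hn.le
      _ = _ := by ring
  have hxx : x * (x * #U) ≤ 1 / 20480 * (x * #U) := mul_le_mul_of_nonneg_right hx hxn.le
  have hrich := h.card_mul_card_le_richPairs hx0 hx hη0 hη ht hP₁U hQ₁U (by linarith) (by linarith)
    (h.card_blocked_le h1 hS hφU (hyU s hs) (hyU' s' hs')) hPQ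
  have hcomp := card_richPairs_mul_le_completions (G := G) (U := U) (S := S) (φ := φ) (y := y s)
    (y' := y' s') (c := x ^ 4 * (#U : ℝ) ^ 2) hP₁U hQ₁U
    (fun p hp => ⟨(mem_nbIn.1 (hP s hs (hP₁ hp))).2, hP₁t p hp⟩)
    (fun q hq => ⟨(mem_nbIn.1 (hP' s' hs' (hQ₁ hq))).2, hQ₁t q hq⟩)
  refine le_trans ?_ hcomp
  have hPP : x * #U / 6 ≤ #P₁ := by linarith
  have hQQ : x * #U / 8 ≤ #Q₁ := by linarith
  have hm : x * #U / 6 * (x * #U / 8) ≤ #P₁ * #Q₁ :=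
    mul_le_mul hPP hQQ (by linarith) (by linarith)
  have hm2 : x * (x * #U * (x * #U)) ≤ 1 / 20480 * (x * #U * (x * #U)) :=
    mul_le_mul_of_nonneg_right hx (mul_nonneg hxn.le hxn.le)
  have hm3 : x * (x * #U * (x * #U)) ≤
      #(G.richPairs U (blocked G U S φ (y s) (y' s')) P₁ Q₁ (x ^ 4 * (#U : ℝ) ^ 2)) := by
    nlinarith
  calc x ^ 7 * (#U : ℝ) ^ 4 = x * (x * #U * (x * #U)) * (x ^ 4 * (#U : ℝ) ^ 2) := by ring
    _ ≤ _ := mul_le_mul_of_nonneg_right hm3 (mul_nonneg (pow_nonneg hx0.le _) (sq_nonneg _))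

end Completions

section Extension

variable {V : Type*} {W : Type u} {G : SimpleGraph W} {H : SimpleGraph V}

/-- Extending a copy along an attached path. -/
theorem IsCopyOn.handle {S : Finset V} {ℓ : ℕ} {p : ℕ → V} {φ ψ : V → W} {z : ℕ → W}
    (hφ : IsCopyOn G H S φ) (hp : H.IsAttachedPath S ℓ p) (hψS : ∀ v ∈ S, ψ v = φ v)
    (hψp : ∀ i, 0 < i → i < ℓ → ψ (p i) = z i)
    (hne : ∀ i, 0 < i → i < ℓ → ∀ v ∈ S, z i ≠ φ v)
    (hadj : ∀ i, 0 < i → i < ℓ → ∀ v ∈ S,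
      (G.Adj (z i) (φ v) ↔ (i = 1 ∧ v = p 0) ∨ (i + 1 = ℓ ∧ v = p ℓ)))
    (hz : ∀ i j, 0 < i → i < j → j < ℓ → z i ≠ z j ∧ (G.Adj (z i) (z j) ↔ i + 1 = j)) :
    IsCopyOn G H (S ∪ (Ioo 0 ℓ).image p) ψ := by
  have hzz : ∀ i j, 0 < i → i < ℓ → 0 < j → j < ℓ →
      (z i = z j → i = j) ∧ (G.Adj (z i) (z j) ↔ i + 1 = j ∨ j + 1 = i) := by
    intro i j hi hi' hj hj'
    rcases lt_trichotomy i j with h | rfl | h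
    · obtain ⟨h1, h2⟩ := hz i j hi h hj'
      exact ⟨fun h3 => absurd h3 h1, by rw [h2]; omega⟩
    · exact ⟨fun _ => rfl, by simp⟩
    · obtain ⟨h1, h2⟩ := hz j i hj h hi'
      exact ⟨fun h3 => absurd h3.symm h1, by rw [G.adj_comm, h2]; omega⟩
  have hcases : ∀ u ∈ S ∪ (Ioo 0 ℓ).image p, u ∈ S ∨ ∃ i, 0 < i ∧ i < ℓ ∧ p i = u := by
    intro u hu
    rcases mem_union.1 hu with h | h
    · exact Or.inl h
    · obtain ⟨i, hi, rfl⟩ := mem_image.1 h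
      exact Or.inr ⟨i, (mem_Ioo.1 hi).1, (mem_Ioo.1 hi).2, rfl⟩
  constructor
  · intro u hu v hv huv
    rcases hcases u hu with hu | ⟨i, hi, hi', rfl⟩ <;> rcases hcases v hv with hv | ⟨j, hj, hj', rfl⟩
    · rw [hψS u hu, hψS v hv] at huv
      exact hφ.1 u hu v hv huv
    · rw [hψS u hu, hψp j hj hj'] at huv
      exact absurd huv.symm (hne j hj hj' u hu)
    · rw [hψS v hv, hψp i hi hi'] at huv
      exact absurd huv (hne i hi hi' v hv)
    · rw [hψp i hi hi', hψp j hj hj'] at huv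
      rw [(hzz i j hi hi' hj hj').1 huv]
  · intro u hu v hv
    rcases hcases u hu with hu | ⟨i, hi, hi', rfl⟩ <;> rcases hcases v hv with hv | ⟨j, hj, hj', rfl⟩
    · rw [hψS u hu, hψS v hv]
      exact hφ.2 u hu v hv
    · rw [hψS u hu, hψp j hj hj', G.adj_comm, hadj j hj hj' u hu, H.adj_comm,
        hp.adj_mem_iff j hj hj' u hu]
    · rw [hψS v hv, hψp i hi hi', hadj i hi hi' v hv, hp.adj_mem_iff i hi hi' v hv]
    · rw [hψp i hi hi', hψp j hj hj', (hzz i j hi hi' hj hj').2,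
        hp.adj_iff i hi'.le j hj'.le]

end Extension

end SimpleGraph

/-! ### Handles of length seven in dense sets. -/

namespace SimpleGraph

open Finset

open scoped Classical

universe u

section DenseHandle

variable {V : Type*} [Fintype V] {W : Type u} {G : SimpleGraph W} {H : SimpleGraph V}
  {U : Finset W} {x η : ℝ} {t : ℕ}

/-- Triples `(φ, y, y')` of a copy `φ` and vertices attached to it at `w` and `w'` that can be
joined in many ways. -/
noncomputable def goodTriples (G : SimpleGraph W) (H : SimpleGraph V) (U : Finset W) (S : Finset V)
    (w w' : V) (c : ℝ) : Finset ((V → W) × (W × W)) :=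
  (copies G H S U ×ˢ (U ×ˢ U)).filter fun e =>
    e.1 ∈ attach G (copies G H S U) S w e.2.1 ∧ e.1 ∈ attach G (copies G H S U) S w' e.2.2 ∧
    e.2.1 ≠ e.2.2 ∧ ¬ G.Adj e.2.1 e.2.2 ∧ c ≤ #(completions G U S e.1 e.2.1 e.2.2)

theorem copies_mono {U' : Finset W} (hU : U' ⊆ U) (S : Finset V) :
    copies G H S U' ⊆ copies G H S U :=
  filter_subset_filter _ (Fintype.piFinset_subset _ _ fun _ => hU)

theorem mem_of_mem_copies {S : Finset V} {φ : V → W} (hφ : φ ∈ copies G H S U) (v : V) : φ v ∈ U :=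
  Fintype.mem_piFinset.1 (mem_filter.1 hφ).1 v

theorem attach_mono {F F' : Finset (V → W)} (hF : F ⊆ F') (S : Finset V) (w : V) (y : W) :
    attach G F S w y ⊆ attach G F' S w y :=
  filter_subset_filter _ hF

theorem IsDense.mul_card_le_of_le_card (h : G.IsDense U x t η) (hx0 : 0 < x) (hη : 0 < η)
    {A : Finset W} (hA : A ⊆ U) (hAc : x ^ t * #U ≤ #A) {ρ : ℕ}
    (hρ : η * #U ≤ #(U.filter fun v => #(G.nbIn A v) ≤ ρ)) : x * #A ≤ ρ := by
  have hlo := h.card_lo_lt hx0 hη hA hAc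
  by_contra! hcon
  have hsub : (U.filter fun v => #(G.nbIn A v) ≤ ρ) ⊆
      U.filter fun v => (#(G.nbIn A v) : ℝ) < x * #A := by
    intro v hv
    rw [mem_filter] at hv ⊢
    exact ⟨hv.1, lt_of_le_of_lt (by exact_mod_cast hv.2) hcon⟩
  have h1 : (#(U.filter fun v => #(G.nbIn A v) ≤ ρ) : ℝ) ≤
      #(U.filter fun v => (#(G.nbIn A v) : ℝ) < x * #A) := by
    exact_mod_cast card_le_card hsub
  linarith

theorem card_add_card_le_card_add_inter {A B : Finset W} (hA : A ⊆ U) (hB : B ⊆ U) :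
    (#A : ℝ) + #B ≤ #U + #(A ∩ B) := by
  have h1 : #A + #B ≤ #U + #(A ∩ B) := by
    rw [← card_union_add_card_inter]
    exact Nat.add_le_add_right (card_le_card (union_subset hA hB)) _
  exact_mod_cast h1

theorem card_filter_le_of_sum_lt {Y : Finset W} {f : W → ℕ} {b n N : ℝ} (hb : 0 < b)
    (hsum : ((∑ y ∈ Y, f y : ℕ) : ℝ) ≤ N) (hN : N ≤ b * n) :
    (#(Y.filter fun y => b ≤ (f y : ℝ)) : ℝ) ≤ n := by
  have h1 := mul_card_filter_le_le_sum Y (fun y => (f y : ℝ)) (fun _ _ => Nat.cast_nonneg _) b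
  push_cast at hsum
  exact le_of_mul_le_mul_left (h1.trans (hsum.trans hN)) hb

-- Suppose there are few good triples. Vertices `y s` attached at `w`, and then `y' s'` attached at
-- `w'`, are chosen so that a large family of copies stays attached to all of them, and no chosen
-- vertex or pair lies in many good triples. Then some copy in the family is in no good triple with
-- any pair `(y s, y' s')`, contrary to `IsDense.exists_le_card_completions`.
--
-- The quantiles balance the degrees. The copies have degree at most `ρ` into `U` and at most `ρ'`
-- into `Low`, whereas each `y s` has at least `ρ` neighbours in `U` and each `y' s'` at least `ρ'`
-- in `Low`. So the many disjoint neighbour sets exceed by far what a vertex of the copy can touch.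
-- Taking `P' s'` inside `Low`, and `y s` inside `Low'`, does the same for the other unwanted
-- adjacencies.
set_option maxHeartbeats 1000000 in
theorem IsDense.le_card_goodTriples (h : G.IsDense U x t η) (hx0 : 0 < x) (hη0 : 0 < η)
    {S : Finset V} {w w' : V} {a K K' N : ℕ} (hN : Fintype.card V + K + K' + 2 ≤ N)
    (hK : 400 * (4 * Fintype.card V + 2) ≤ K) (hK' : 200 * (Fintype.card V + K) ≤ K')
    (hη : N * η ≤ 1 / 100000) (hx : N ^ 2 * x ≤ 1 / 100000) (hxη : x ≤ η)
    (ht : a + 2 * K + 2 * K' + 1 ≤ t)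
    (hIH : ∀ U' ⊆ U, (#U : ℝ) ≤ 2 * #U' → x ^ a * (#U : ℝ) ^ Fintype.card V ≤ #(copies G H S U')) :
    x ^ (a + 2 * K + 2 * K' + 3) * (#U : ℝ) ^ (Fintype.card V + 2) ≤
      #(goodTriples G H U S w w' (x ^ 7 * (#U : ℝ) ^ 4)) := by
  set r := Fintype.card V with hr
  have hn := h.card_pos hx0
  have hSr : #S ≤ r := card_le_univ S
  have hN' : (r : ℝ) + K + K' + 2 ≤ N := by exact_mod_cast hN
  have hr0 : (0 : ℝ) ≤ r := Nat.cast_nonneg _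
  have hK0 : (0 : ℝ) ≤ K := Nat.cast_nonneg _
  have hK0' : (0 : ℝ) ≤ K' := Nat.cast_nonneg _
  have hηs : η ≤ 1 / 200000 := by nlinarith
  have hNx : N * x ≤ 1 / 100000 := by nlinarith
  have hxs : x ≤ 1 / 200000 := by nlinarith
  have hrη : (r : ℝ) * η ≤ 1 / 100000 := by nlinarith
  have hKη : (K : ℝ) * η ≤ 1 / 100000 := by nlinarith
  have hKη' : (K' : ℝ) * η ≤ 1 / 100000 := by nlinarith
  have hKx : (K : ℝ) * x ≤ 1 / 100000 := by nlinarith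
  have hKKx : (K : ℝ) * K' * x < 1 := by
    have h2 : (K : ℝ) * K' ≤ (N : ℝ) ^ 2 := by nlinarith
    nlinarith
  have h1 : 1 ≤ η * #U := by
    refine h.one_le.trans (mul_le_mul_of_nonneg_right ?_ hn.le)
    calc x ^ t ≤ x ^ 1 := pow_le_pow_of_le_one hx0.le (by linarith) (by omega)
      _ ≤ η := by rwa [pow_one]
  have hxt : x ^ t * #U ≤ #U / 2 := by
    have h2 : x ^ t ≤ x ^ 1 := pow_le_pow_of_le_one hx0.le (by linarith) (by omega)
    rw [pow_one] at h2
    nlinarith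
  by_contra! hcon
  set 𝒢 := goodTriples G H U S w w' (x ^ 7 * (#U : ℝ) ^ 4) with h𝒢
  -- quantiles
  obtain ⟨ρ, hlow, htop⟩ := exists_quantile U (fun v => #(G.nbIn U v)) (θ := 3 / 4)
    (by norm_num) (by norm_num)
  set Low := U.filter fun v => #(G.nbIn U v) ≤ ρ with hLow
  set Top := U.filter fun v => ρ ≤ #(G.nbIn U v) with hTop
  have hLowU : Low ⊆ U := filter_subset _ _
  obtain ⟨ρ', hlow', htop'⟩ := exists_quantile U (fun v => #(G.nbIn Low v)) (θ := 7 / 8)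
    (by norm_num) (by norm_num)
  set Low' := U.filter fun v => #(G.nbIn Low v) ≤ ρ' with hLow'
  set Top' := U.filter fun v => ρ' ≤ #(G.nbIn Low v) with hTop'
  have hηn : η * #U ≤ #U / 2 := by nlinarith
  have hρ := h.mul_card_le_of_le_card hx0 hη0 (subset_refl U) (by linarith) (ρ := ρ) (by linarith)
  have hρ' := h.mul_card_le_of_le_card hx0 hη0 hLowU (by linarith) (ρ := ρ') (by linarith)
  have hρ2 : x * #U ≤ 2 * ρ := by nlinarith
  have hρ2' : x * #U ≤ 2 * ρ' := by nlinarith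
  have hxn := mul_pos hx0 hn
  have hρ1 : 1 ≤ ρ := by
    have : (0 : ℝ) < ρ := by linarith
    exact_mod_cast this
  have hρ1' : 1 ≤ ρ' := by
    have : (0 : ℝ) < ρ' := by linarith
    exact_mod_cast this
  -- the copies of low degree
  have hmid := card_add_card_le_card_add_inter hLowU (filter_subset _ _ : Low' ⊆ U)
  have hF₀c := hIH (Low ∩ Low') (inter_subset_left.trans hLowU) (by linarith)
  set F₀ := copies G H S (Low ∩ Low') with hF₀
  have hF₀U : ∀ φ ∈ F₀, ∀ v, φ v ∈ U := fun φ hφ v =>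
    hLowU (mem_inter.1 (mem_of_mem_copies hφ v)).1
  -- first choice
  have hpow1 : 0 < x ^ (a + 2 * K + 2 * K' + 2) * (#U : ℝ) ^ (r + 1) :=
    mul_pos (pow_pos hx0 _) (pow_pos hn _)
  have hpow2 : 0 < x ^ (a + 2 * K + 2 * K' + 1) * (#U : ℝ) ^ r :=
    mul_pos (pow_pos hx0 _) (pow_pos hn _)
  -- The threshold is the assumed bound on all good triples divided by `x |U|`, so at most `x |U|`
  -- vertices reach it. The same division is repeated for pairs in `B₂`.
  set B₁ := U.filter fun y => x ^ (a + 2 * K + 2 * K' + 2) * (#U : ℝ) ^ (r + 1) ≤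
    (#(𝒢.filter fun e => e.2.1 = y) : ℝ) with hB₁
  have hB₁c : (#B₁ : ℝ) ≤ #U / 50 := by
    have h2 : (#B₁ : ℝ) ≤ x * #U := by
      refine card_filter_le_of_sum_lt hpow1 (N := #𝒢) ?_ ?_
      · have h3 : #𝒢 = ∑ y ∈ U, #(𝒢.filter fun e => e.2.1 = y) :=
          card_eq_sum_card_fiberwise fun e he =>
            (mem_product.1 (mem_product.1 (mem_filter.1 he).1).2).1
        exact_mod_cast h3.ge
      · refine hcon.le.trans (le_of_eq ?_)
        ring
    nlinarith
  have hC₁ := card_add_card_le_card_add_inter (filter_subset _ _ : Top ⊆ U)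
    (filter_subset _ _ : Low' ⊆ U)
  obtain ⟨y, P, F₁, hF₁, hF₁c, hyP⟩ := h.exists_attachments hx0 (by linarith) hη0 h1 (a := a)
    (K := K) (by omega) (by linarith) (by linarith) hF₀U hF₀c S w (A := U) (B := B₁)
    (C := Top ∩ Low') hρ1 subset_rfl (inter_subset_left.trans (filter_subset _ _))
    (fun y hy => (mem_filter.1 (mem_inter.1 hy).1).2) (by linarith) hB₁c K le_rfl
  have hyU : ∀ s < K, y s ∈ U := fun s hs => (mem_filter.1 (mem_inter.1 (hyP s hs).1).1).1
  have hPU : ∀ s < K, P s ⊆ U := fun s hs => (hyP s hs).2.2.1.trans (nbIn_subset _ _)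
  -- second choice
  let B₂ : ℕ → Finset W := fun s => (U.filter fun y' =>
      x ^ (a + 2 * K + 2 * K' + 1) * (#U : ℝ) ^ r ≤ (#(𝒢.filter fun e => e.2 = (y s, y')) : ℝ)) ∪
    G.touching U (y s) ∪ U.filter fun v => 1 / 50 * (#(P s) : ℝ) < #(G.nbIn (P s) v)
  have hB₂s : ∀ s < K, (#(B₂ s) : ℝ) ≤ (x + 52 * η) * #U := by
    intro s hs
    have h2 : (#(U.filter fun y' => x ^ (a + 2 * K + 2 * K' + 1) * (#U : ℝ) ^ r ≤
        (#(𝒢.filter fun e => e.2 = (y s, y')) : ℝ)) : ℝ) ≤ x * #U := by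
      refine card_filter_le_of_sum_lt hpow2 (N := #(𝒢.filter fun e => e.2.1 = y s)) ?_ ?_
      · rw [card_eq_sum_card_fiberwise (f := fun e => e.2.2) (t := U)]
        · norm_cast
          refine sum_le_sum fun y' _ => card_le_card fun e he => ?_
          obtain ⟨h3, h4⟩ := mem_filter.1 he
          exact mem_filter.2 ⟨mem_filter.2 ⟨h3, by rw [h4]⟩, by rw [h4]⟩
        · intro e he
          exact (mem_product.1 (mem_product.1 (mem_filter.1 (mem_filter.1 he).1).1).2).2
      · have h3 : ¬ x ^ (a + 2 * K + 2 * K' + 2) * (#U : ℝ) ^ (r + 1) ≤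
            (#(𝒢.filter fun e => e.2.1 = y s) : ℝ) := fun h4 =>
          (hyP s hs).2.1 (mem_filter.2 ⟨hyU s hs, h4⟩)
        refine (not_le.1 h3).le.trans (le_of_eq ?_)
        ring
    have h3 : (#(G.touching U (y s)) : ℝ) ≤ 2 * η * #U := h.card_touching_le h1 (hyU s hs)
    have h4 := h.card_hi_le (σ := 1 / 50) (hPU s hs)
    have h5 := (card_union_le ((U.filter fun y' => x ^ (a + 2 * K + 2 * K' + 1) * (#U : ℝ) ^ r ≤
        (#(𝒢.filter fun e => e.2 = (y s, y')) : ℝ)) ∪ G.touching U (y s))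
        (U.filter fun v => 1 / 50 * (#(P s) : ℝ) < #(G.nbIn (P s) v))).trans
      (Nat.add_le_add_right (card_union_le _ _) _)
    have h6 : (#(B₂ s) : ℝ) ≤ #(U.filter fun y' => x ^ (a + 2 * K + 2 * K' + 1) * (#U : ℝ) ^ r ≤
        (#(𝒢.filter fun e => e.2 = (y s, y')) : ℝ)) + #(G.touching U (y s)) +
        #(U.filter fun v => 1 / 50 * (#(P s) : ℝ) < #(G.nbIn (P s) v)) := by
      have h7 := (Nat.cast_le (α := ℝ)).2 h5
      rw [Nat.cast_add, Nat.cast_add] at h7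
      exact h7
    linarith
  have hB₂c : (#((range K).biUnion B₂) : ℝ) ≤ #U / 50 := by
    have h2 : (#((range K).biUnion B₂) : ℝ) ≤ ∑ s ∈ range K, (#(B₂ s) : ℝ) := by
      exact_mod_cast card_biUnion_le
    have h3 : ∑ s ∈ range K, (#(B₂ s) : ℝ) ≤ ∑ s ∈ range K, (x + 52 * η) * #U :=
      sum_le_sum fun s hs => hB₂s s (mem_range.1 hs)
    rw [sum_const, card_range, nsmul_eq_mul] at h3
    nlinarith
  have hF₁c' : x ^ (a + 2 * K) * (#U : ℝ) ^ r ≤ #F₁ := by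
    refine le_trans ?_ hF₁c
    rw [pow_add, mul_comm (x ^ a), mul_assoc]
    exact mul_le_mul_of_nonneg_left hF₀c (pow_nonneg hx0.le _)
  obtain ⟨y', P', F₂, hF₂, hF₂c, hyP'⟩ := h.exists_attachments hx0 (by linarith) hη0 h1
    (a := a + 2 * K) (K := K') (by omega) (by linarith) (by linarith)
    (fun φ hφ => hF₀U φ (hF₁ hφ)) hF₁c' S w' (A := Low) (B := (range K).biUnion B₂)
    (C := Top') hρ1' hLowU (filter_subset _ _)
    (fun y hy => (mem_filter.1 hy).2) (by linarith) hB₂c K' le_rfl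
  have hyU' : ∀ s < K', y' s ∈ U := fun s hs => (mem_filter.1 (hyP' s hs).1).1
  have hnB₂ : ∀ s < K, ∀ s' < K', y' s' ∉ B₂ s := fun s hs s' hs' h2 =>
    (hyP' s' hs').2.1 (mem_biUnion.2 ⟨s, mem_range.2 hs, h2⟩)
  -- a copy outside all the bad sets
  let bad : Finset (V → W) := (range K ×ˢ range K').biUnion fun i =>
    (𝒢.filter fun e => e.2 = (y i.1, y' i.2)).image Prod.fst
  have hF₂c' : x ^ (a + 2 * K + 2 * K') * (#U : ℝ) ^ r ≤ #F₂ := by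
    refine le_trans ?_ hF₂c
    rw [pow_add, mul_comm (x ^ (a + 2 * K)), mul_assoc]
    exact mul_le_mul_of_nonneg_left hF₁c' (pow_nonneg hx0.le _)
  -- Each of the `K K'` pairs spoils at most a proportion `x` of the lower bound for the size of
  -- `F₂`, and `K K' x < 1`.
  have hbadc : (#bad : ℝ) < #F₂ := by
    have h2 : (#bad : ℝ) ≤ ∑ i ∈ range K ×ˢ range K',
        (#((𝒢.filter fun e => e.2 = (y i.1, y' i.2)).image Prod.fst) : ℝ) := by
      exact_mod_cast card_biUnion_le
    have h3 : ∑ i ∈ range K ×ˢ range K',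
        (#((𝒢.filter fun e => e.2 = (y i.1, y' i.2)).image Prod.fst) : ℝ) ≤
        ∑ i ∈ range K ×ˢ range K', x ^ (a + 2 * K + 2 * K' + 1) * (#U : ℝ) ^ r := by
      refine sum_le_sum fun i hi => ?_
      rw [mem_product, mem_range, mem_range] at hi
      have h4 : (#((𝒢.filter fun e => e.2 = (y i.1, y' i.2)).image Prod.fst) : ℝ) ≤
          #(𝒢.filter fun e => e.2 = (y i.1, y' i.2)) := by exact_mod_cast card_image_le
      refine h4.trans ?_
      by_contra! h5
      exact hnB₂ i.1 hi.1 i.2 hi.2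
        (mem_union_left _ (mem_union_left _ (mem_filter.2 ⟨hyU' i.2 hi.2, h5.le⟩)))
    rw [sum_const, card_product, card_range, card_range, nsmul_eq_mul, Nat.cast_mul] at h3
    have h4 : (K : ℝ) * K' * (x ^ (a + 2 * K + 2 * K' + 1) * (#U : ℝ) ^ r) =
        (K * K' * x) * (x ^ (a + 2 * K + 2 * K') * (#U : ℝ) ^ r) := by ring
    have h5 : 0 < x ^ (a + 2 * K + 2 * K') * (#U : ℝ) ^ r := mul_pos (pow_pos hx0 _) (pow_pos hn _)
    have h6 := mul_lt_mul_of_pos_right hKKx h5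
    linarith
  obtain ⟨φ, hφ, hφbad⟩ : ∃ φ ∈ F₂, φ ∉ bad := by
    by_contra! h2
    have h3 : #F₂ ≤ #bad := card_le_card h2
    have h4 : #bad < #F₂ := by exact_mod_cast hbadc
    omega
  have hφ₀ : φ ∈ F₀ := hF₁ (hF₂ hφ)
  have hφL : ∀ v, φ v ∈ Low ∩ Low' := mem_of_mem_copies hφ₀
  have hSrr : (#S : ℝ) ≤ r := by exact_mod_cast hSr
  have hSη : (#S : ℝ) * η ≤ r * η := mul_le_mul_of_nonneg_right hSrr hη0.le
  have hy50 : ∀ s < K, ∀ s' < K', 50 * #(G.nbIn (P s) (y' s')) ≤ (ρ + 1) / 2 := by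
    intro s hs s' hs'
    have h2 : ¬ 1 / 50 * (#(P s) : ℝ) < #(G.nbIn (P s) (y' s')) := fun h3 =>
      hnB₂ s hs s' hs' (mem_union_right _ (mem_filter.2 ⟨hyU' s' hs', h3⟩))
    rw [← (hyP s hs).2.2.2.1]
    have h3 : (50 : ℝ) * #(G.nbIn (P s) (y' s')) ≤ #(P s) := by linarith
    exact_mod_cast h3
  obtain ⟨s, hs, s', hs', hc⟩ := h.exists_le_card_completions hx0 (by linarith) hη0 (by linarith) h1
    (by omega) (A := Low) (S := S) (by linarith) (φ := φ) (y := y) (y' := y') (P := P) (P' := P')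
    (K := K) (K' := K') hLowU hρ2 hρ2' (fun q hq => (mem_filter.1 hq).2) (fun u _ => hF₀U φ hφ₀ u)
    (fun u _ => (mem_filter.1 (mem_inter.1 (hφL u)).1).2)
    (fun u _ => (mem_filter.1 (mem_inter.1 (hφL u)).2).2) hyU
    (fun s hs => (mem_filter.1 (mem_inter.1 (hyP s hs).1).2).2)
    (fun s hs => (hyP s hs).2.2.1) (fun s hs => (hyP s hs).2.2.2.1)
    (fun s hs => (hyP s hs).2.2.2.2.1) hyU' (fun s hs => (hyP' s hs).2.2.1)
    (fun s hs => (hyP' s hs).2.2.2.1) (fun s hs => (hyP' s hs).2.2.2.2.1) hy50 (by omega) (by omega)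
  · refine hφbad (mem_biUnion.2 ⟨(s, s'), mem_product.2 ⟨mem_range.2 hs, mem_range.2 hs'⟩,
      mem_image.2 ⟨(φ, (y s, y' s')), mem_filter.2 ⟨?_, rfl⟩, rfl⟩⟩)
    have hφU : φ ∈ copies G H S U := copies_mono (inter_subset_left.trans hLowU) S hφ₀
    have hnt : y' s' ∉ G.touching U (y s) := fun h2 =>
      hnB₂ s hs s' hs' (mem_union_left _ (mem_union_right _ h2))
    have hnt' : ¬ (y' s' = y s ∨ G.Adj (y' s') (y s)) := fun h2 =>
      hnt (mem_filter.2 ⟨hyU' s' hs', h2⟩)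
    rw [not_or] at hnt'
    exact mem_filter.2 ⟨mem_product.2 ⟨hφU, mem_product.2 ⟨hyU s hs, hyU' s' hs'⟩⟩,
      attach_mono (copies_mono (inter_subset_left.trans hLowU) S) S w _
        ((hyP s hs).2.2.2.2.2 φ (hF₂ hφ)),
      attach_mono (hF₁.trans (copies_mono (inter_subset_left.trans hLowU) S)) S w' _
        ((hyP' s' hs').2.2.2.2.2 φ hφ),
      fun h2 => hnt'.1 h2.symm, fun h2 => hnt'.2 h2.symm, hc⟩

theorem isCopyOn_extend_of_goodTriple {S : Finset V} {p : ℕ → V} (hp : H.IsAttachedPath S 7 p)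
    {c : ℝ} {φ : V → W} {y y' p₁ q₁ a b : W}
    (hg : (φ, (y, y')) ∈ goodTriples G H U S (p 0) (p 7) c)
    (hc : ((p₁, q₁), (a, b)) ∈ completions G U S φ y y') :
    Function.extend (fun i : Fin 6 => p (i + 1)) ![y, p₁, a, b, q₁, y'] φ ∈
      copies G H (S ∪ (Ioo 0 7).image p) U := by
  obtain ⟨hg1, hg2, hg3, hg4, hg5, -⟩ := mem_filter.1 hg
  simp only [mem_product] at hg1 hg2 hg3 hg4 hg5
  obtain ⟨hφ, hyU, hyU'⟩ := hg1
  obtain ⟨-, hy1, hy2⟩ := mem_filter.1 hg2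
  obtain ⟨-, hy1', hy2'⟩ := mem_filter.1 hg3
  obtain ⟨hc1, ⟨hc2, hc3, hc4, hc5, hc6, hc7⟩, hc8⟩ := mem_completions.1 hc
  simp only [mem_product] at hc1 hc2 hc3 hc4 hc5 hc6 hc7 hc8
  obtain ⟨⟨hpU, hqU⟩, haU, hbU⟩ := hc1
  obtain ⟨-, hab, hpa, hqb, hqa, hpb, haX, hbX⟩ := mem_filter.1 hc8
  simp only at hab hpa hqb hqa hpb haX hbX
  simp only [blocked, touching, mem_union, mem_filter, mem_biUnion, not_or, not_and, not_exists]
    at haX hbX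
  obtain ⟨⟨ha1, ha2⟩, ha3⟩ := haX
  obtain ⟨⟨hb1, hb2⟩, hb3⟩ := hbX
  have ha1 := ha1 haU
  have ha2 := ha2 haU
  have hb1 := hb1 hbU
  have hb2 := hb2 hbU
  have hj : Function.Injective (fun i : Fin 6 => p (i + 1)) := by
    intro i j hij
    have := hp.inj _ (by omega) _ (by omega) hij
    exact Fin.ext (by omega)
  set ψ := Function.extend (fun i : Fin 6 => p (i + 1)) ![y, p₁, a, b, q₁, y'] φ with hψ
  let z : ℕ → W := fun i => ψ (p i)
  have hz1 : z 1 = y := hj.extend_apply ![y, p₁, a, b, q₁, y'] φ 0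
  have hz2 : z 2 = p₁ := hj.extend_apply ![y, p₁, a, b, q₁, y'] φ 1
  have hz3 : z 3 = a := hj.extend_apply ![y, p₁, a, b, q₁, y'] φ 2
  have hz4 : z 4 = b := hj.extend_apply ![y, p₁, a, b, q₁, y'] φ 3
  have hz5 : z 5 = q₁ := hj.extend_apply ![y, p₁, a, b, q₁, y'] φ 4
  have hz6 : z 6 = y' := hj.extend_apply ![y, p₁, a, b, q₁, y'] φ 5
  have hψo : ∀ v, (¬ ∃ i : Fin 6, p (i + 1) = v) → ψ v = φ v := fun v hv =>
    Function.extend_apply' _ _ _ hv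
  have hψS : ∀ v ∈ S, ψ v = φ v := by
    intro v hv
    refine hψo v ?_
    rintro ⟨i, rfl⟩
    exact hp.notMem _ (by omega) (by omega) hv
  refine mem_filter.2 ⟨Fintype.mem_piFinset.2 fun v => ?_, ?_⟩
  · by_cases hv : ∃ i : Fin 6, p (i + 1) = v
    · obtain ⟨i, rfl⟩ := hv
      have : ψ (p (i + 1)) = ![y, p₁, a, b, q₁, y'] i := hj.extend_apply _ _ i
      rw [this]
      fin_cases i
      exacts [hyU, hpU, haU, hbU, hqU, hyU']
    · rw [hψo v hv]
      exact mem_of_mem_copies hφ v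
  · refine (mem_filter.1 hφ).2.handle hp hψS (z := z) (fun _ _ _ => rfl) ?_ ?_ ?_
    · intro i h0 h7 v hv
      interval_cases i
      · rw [hz1]
        by_cases h : v = p 0
        · rw [h]; exact hy1.ne
        · exact (hy2 v hv h).1
      · rw [hz2]; exact (hc7 v hv).1.1
      · rw [hz3]; exact (ha3 v hv haU).1
      · rw [hz4]; exact (hb3 v hv hbU).1
      · rw [hz5]; exact (hc7 v hv).2.1
      · rw [hz6]
        by_cases h : v = p 7
        · rw [h]; exact hy1'.ne
        · exact (hy2' v hv h).1
    · intro i h0 h7 v hv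
      interval_cases i
      · rw [hz1]
        by_cases h : v = p 0
        · simp [h, hy1]
        · simp [h, (hy2 v hv h).2]
      · rw [hz2]; simpa using (hc7 v hv).1.2
      · rw [hz3]; simpa using (ha3 v hv haU).2
      · rw [hz4]; simpa using (hb3 v hv hbU).2
      · rw [hz5]; simpa using (hc7 v hv).2.2
      · rw [hz6]
        by_cases h : v = p 7
        · simp [h, hy1']
        · simp [h, (hy2' v hv h).2]
    · intro i j h0 hij h7
      -- These vertices are distinct because in each case one has a neighbour that the other lacks.
      have e1 : y ≠ q₁ := fun h => hg5 (h ▸ hc3.symm)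
      have e2 : p₁ ≠ b := fun h => hc4 (h ▸ hqb.symm)
      have e3 : p₁ ≠ q₁ := fun h => hqa (h ▸ hpa)
      have e4 : p₁ ≠ y' := fun h => hg5 (h ▸ hc2)
      have e5 : a ≠ q₁ := fun h => hc4 (h ▸ hpa)
      have f1 : ¬ G.Adj y a := fun h => ha1.2 h.symm
      have f2 : ¬ G.Adj y b := fun h => hb1.2 h.symm
      have f3 : ¬ G.Adj y q₁ := fun h => hc6 h.symm
      have f4 : ¬ G.Adj a q₁ := fun h => hqa h.symm
      have hi7 : i < 7 := hij.trans h7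
      interval_cases i <;> interval_cases j <;>
        simp only [hz1, hz2, hz3, hz4, hz5, hz6] <;> norm_num
      · exact ⟨hc2.ne, hc2⟩
      · exact ⟨fun h => ha1.1 h.symm, f1⟩
      · exact ⟨fun h => hb1.1 h.symm, f2⟩
      · exact ⟨e1, f3⟩
      · exact ⟨hg4, hg5⟩
      · exact ⟨hpa.ne, hpa⟩
      · exact ⟨e2, hpb⟩
      · exact ⟨e3, hc4⟩
      · exact ⟨e4, hc5⟩
      · exact ⟨hab.ne, hab⟩
      · exact ⟨e5, f4⟩
      · exact ⟨ha2.1, ha2.2⟩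
      · exact ⟨hqb.ne', hqb.symm⟩
      · exact ⟨hb2.1, hb2.2⟩
      · exact ⟨hc3.ne', hc3.symm⟩

theorem card_goodTriples_mul_le {S : Finset V} {p : ℕ → V} (hp : H.IsAttachedPath S 7 p) (c : ℝ) :
    #(goodTriples G H U S (p 0) (p 7) c) * c ≤
      (#U : ℝ) ^ 6 * #(copies G H (S ∪ (Ioo 0 7).image p) U) := by
  set 𝒢 := goodTriples G H U S (p 0) (p 7) c with h𝒢
  let E := (𝒢 ×ˢ ((U ×ˢ U) ×ˢ (U ×ˢ U))).filter fun e => e.2 ∈ completions G U S e.1.1 e.1.2.1 e.1.2.2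
  have hE : #E = ∑ g ∈ 𝒢, #(completions G U S g.1 g.2.1 g.2.2) := by
    rw [card_filter, sum_product]
    refine sum_congr rfl fun r _ => ?_
    rw [← card_filter]
    congr 1
    ext i
    exact ⟨fun h => (mem_filter.1 h).2, fun h => mem_filter.2 ⟨(mem_completions.1 h).1, h⟩⟩
  have h1 : (#𝒢 : ℝ) * c ≤ #E := by
    rw [hE, ← nsmul_eq_mul, Nat.cast_sum]
    exact card_nsmul_le_sum _ _ _ fun r hr => (mem_filter.1 hr).2.2.2.2.2
  let f : ((V → W) × (W × W)) × ((W × W) × (W × W)) → (Fin 6 → W) × (V → W) := fun e =>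
    (![e.1.2.1, e.2.1.1, e.2.2.1, e.2.2.2, e.2.1.2, e.1.2.2], e.1.1)
  have hf : Function.Injective f := by
    rintro ⟨⟨φ, y, y'⟩, ⟨p, q⟩, a, b⟩ ⟨⟨φ₂, y₂, y₂'⟩, ⟨p₂, q₂⟩, a₂, b₂⟩ he
    simp only [f, Prod.mk.injEq] at he
    obtain ⟨he, rfl⟩ := he
    have h0 := congrFun he 0
    have h1 := congrFun he 1
    have h2 := congrFun he 2
    have h3 := congrFun he 3
    have h4 := congrFun he 4
    have h5 := congrFun he 5
    simp at h0 h1 h2 h3 h4 h5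
    subst h0 h1 h2 h3 h4 h5
    rfl
  have hj : Function.Injective (fun i : Fin 6 => p (i + 1)) := by
    intro i j hij
    have := hp.inj _ (by omega) _ (by omega) hij
    exact Fin.ext (by omega)
  have h2 : #(E.image f) ≤ #U ^ 6 * #(copies G H (S ∪ (Ioo 0 7).image p) U) := by
    refine card_le_pow_mul_card_of_extend hj ?_ ?_
    · intro d hd
      obtain ⟨e, he, rfl⟩ := mem_image.1 hd
      have h3 := (mem_product.1 (mem_filter.1 he).1).1
      exact mem_of_mem_copies (mem_product.1 (mem_filter.1 h3).1).1
    · intro d hd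
      obtain ⟨⟨⟨φ, y, y'⟩, ⟨p, q⟩, a, b⟩, he, rfl⟩ := mem_image.1 hd
      obtain ⟨h3, h4⟩ := mem_filter.1 he
      exact isCopyOn_extend_of_goodTriple hp (mem_product.1 h3).1 h4
  rw [card_image_of_injective _ hf] at h2
  refine h1.trans ?_
  exact_mod_cast h2

/-- The good triples need copies inside subsets of half the size, where `(|U| / 2) ^ r ≥ x ^ r |U| ^
r`; this is the `r` in the exponent. The final `7` is that of the completions, and the six new
coordinates account for a factor `|U| ^ 6` on both sides. -/
theorem DenseClaim.handle {S : Finset V} {p : ℕ → V} (hS : DenseClaim.{u} H S)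
    (hp : H.IsAttachedPath S 7 p) : DenseClaim.{u} H (S ∪ (Ioo 0 7).image p) := by
  obtain ⟨a, t, η, x₀, hη, hx₀, hS⟩ := hS
  set r := Fintype.card V with hr
  obtain ⟨K, hK⟩ : ∃ K, K = 400 * (4 * r + 2) := ⟨_, rfl⟩
  obtain ⟨K', hK'⟩ : ∃ K', K' = 200 * (r + K) := ⟨_, rfl⟩
  obtain ⟨N, hN⟩ : ∃ N, N = r + K + K' + 2 := ⟨_, rfl⟩
  have hN0 : (0 : ℝ) < N := by
    have : 0 < N := by omega
    exact_mod_cast this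
  have hη'0 : 0 < min (η / 2) (1 / (100000 * N)) := by positivity
  refine ⟨(a + r) + 2 * K + 2 * K' + 3 + 7, max (t + 1) ((a + r) + 2 * K + 2 * K' + 1),
    min (η / 2) (1 / (100000 * N)),
    min x₀ (min (1 / 2) (min (1 / (100000 * N ^ 2)) (min (η / 2) (1 / (100000 * N))))), hη'0,
    by positivity, fun W G U x hx0 hx h => ?_⟩
  set η' := min (η / 2) (1 / (100000 * N)) with hη'
  have hxx : x ≤ x₀ := hx.trans (min_le_left _ _)
  have hx' := hx.trans (min_le_right _ _)
  have hx2 : x ≤ 1 / 2 := hx'.trans (min_le_left _ _)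
  have hx'' := hx'.trans (min_le_right _ _)
  have hxN : x ≤ 1 / (100000 * N ^ 2) := hx''.trans (min_le_left _ _)
  have hxη : x ≤ η' := hx''.trans (min_le_right _ _)
  have hn := h.card_pos hx0
  have hgood := (h.mono hx0 (by linarith) (le_max_right _ _) le_rfl).le_card_goodTriples (H := H)
    (S := S) (w := p 0) (w' := p 7) hx0 hη'0 (a := a + r) (K := K) (K' := K') (N := N) hN.ge
    hK.ge hK'.ge ?_ ?_ hxη le_rfl ?_
  · have h2 := card_goodTriples_mul_le (G := G) (U := U) hp (x ^ 7 * (#U : ℝ) ^ 4)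
    have h3 := (mul_le_mul_of_nonneg_right hgood
      (mul_nonneg (pow_nonneg hx0.le 7) (pow_nonneg hn.le 4))).trans h2
    refine le_of_mul_le_mul_left (le_trans (le_of_eq ?_) h3) (pow_pos hn 6)
    ring
  · have h2 : η' ≤ 1 / (100000 * N) := min_le_right _ _
    rw [le_div_iff₀ (by positivity)] at h2
    linarith
  · rw [le_div_iff₀ (by positivity)] at hxN
    linarith
  · intro U' hU' hU'c
    have hd := (h.mono hx0 (by linarith) (le_max_left _ _) le_rfl).subset hη'0.le hx0 hx2 hU' hU'c
    have hd' := hd.mono hx0 (by linarith) le_rfl (show 2 * η' ≤ η by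
      have h2 : η' ≤ η / 2 := min_le_left _ _
      linarith)
    refine le_trans ?_ (hS W G U' x hx0 hxx hd')
    rw [pow_add, mul_assoc, ← mul_pow]
    refine mul_le_mul_of_nonneg_left (pow_le_pow_left₀ (by positivity) ?_ _) (pow_nonneg hx0.le _)
    nlinarith

theorem LeafBuildable.denseClaim {S : Finset V} (hS : H.LeafBuildable S) : DenseClaim.{u} H S := by
  induction hS with
  | two a b hab h => exact DenseClaim.two hab h
  | leaf S w v hS hw hv h ih => exact ih.leaf hv h
  | handle S p hS hp ih => exact ih.handle hp

end DenseHandle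

end SimpleGraph

/-! ### Sparse regime: pigeonholing, ports and induced subpaths. -/

namespace SimpleGraph

open Finset

open scoped Classical

universe u

section Uniform

variable {ι W : Type*}

theorem exists_card_le_mul_card_filter_eq (s : Finset ι) (f : ι → ℕ) {k : ℕ} (hk : 0 < k)
    (hf : ∀ i ∈ s, f i < k) : ∃ a < k, #s ≤ k * #(s.filter fun i => f i = a) := by
  by_contra! hcon
  have h1 : #s = ∑ a ∈ range k, #(s.filter fun i => f i = a) :=
    card_eq_sum_card_fiberwise fun i hi => by
      rw [Finset.mem_coe, mem_range]
      exact hf i hi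
  have h2 : ∑ a ∈ range k, k * #(s.filter fun i => f i = a) < ∑ a ∈ range k, #s :=
    sum_lt_sum_of_nonempty ⟨0, mem_range.2 hk⟩ fun a ha => hcon a (mem_range.1 ha)
  rw [← mul_sum, ← h1, sum_const, card_range, smul_eq_mul] at h2
  exact lt_irrefl _ h2

/-- A bounded label becomes constant on large parts of many sets of a family. -/
theorem exists_uniform (C : ℕ → Finset W) (I : Finset ℕ) (f : W → ℕ) {k : ℕ} (hk : 0 < k)
    (hf : ∀ i ∈ I, ∀ v ∈ C i, f v < k) :
    ∃ a < k, ∃ I' ⊆ I, #I ≤ k * #I' ∧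
      ∀ i ∈ I', #(C i) ≤ k * #((C i).filter fun v => f v = a) := by
  have h1 : ∀ i, ∃ a < k, i ∈ I → #(C i) ≤ k * #((C i).filter fun v => f v = a) := by
    intro i
    by_cases hi : i ∈ I
    · obtain ⟨a, ha, h⟩ := exists_card_le_mul_card_filter_eq (C i) f hk (hf i hi)
      exact ⟨a, ha, fun _ => h⟩
    · exact ⟨0, hk, fun h => absurd h hi⟩
  choose g hg hgi using h1
  obtain ⟨a, ha, h⟩ := exists_card_le_mul_card_filter_eq I g hk fun i _ => hg i
  refine ⟨a, ha, I.filter fun i => g i = a, filter_subset _ _, h, fun i hi => ?_⟩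
  obtain ⟨hi1, rfl⟩ := mem_filter.1 hi
  exact hgi i hi1

end Uniform

section Ports

variable {W : Type u} {G : SimpleGraph W}

/-- A set `Y ⊆ L` whose neighbourhood is a substantial part of `C j` but a small part of the other
`C i`. -/
theorem exists_port {C : ℕ → Finset W} {I : Finset ℕ} {L : Finset W} {M : ℕ} {Q d δ : ℝ} {j : ℕ}
    (hM : 1 ≤ M) (hIM : #I ≤ M) (hQ : 1 ≤ Q) (hd : 0 < d) (hδ : 1 ≤ δ)
    (hhi : ∀ i ∈ I, ∀ w ∈ C i, (#(G.nbIn L w) : ℝ) ≤ Q * d)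
    (hlo : ∀ w ∈ C j, d ≤ #(G.nbIn L w)) (hdeg : ∀ y ∈ L, (#(G.nbIn (C j) y) : ℝ) ≤ δ)
    (hC : 16 * M ^ 2 * Q * δ ≤ #(C j)) :
    ∃ Y ⊆ L, (#(C j) : ℝ) ≤ 32 * M ^ 2 * Q * #((C j).filter fun w => ∃ y ∈ Y, G.Adj y w) ∧
      ∀ i ∈ I, i ≠ j →
        (#((C i).filter fun w => ∃ y ∈ Y, G.Adj y w) : ℝ) ≤ 1 / (4 * M) * #(C i) := by
  have hM1 : (1 : ℝ) ≤ M := by exact_mod_cast hM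
  have hMsq : (1 : ℝ) ≤ (M : ℝ) ^ 2 := by nlinarith
  have hMQ : 1 ≤ (M : ℝ) ^ 2 * Q := by nlinarith
  have hCQ : 16 * M ^ 2 * Q ≤ #(C j) := by nlinarith
  have hC0 : (0 : ℝ) < #(C j) := by nlinarith
  have hM0 : (0 : ℝ) < M := by linarith
  -- The cost of `y` adds up the proportions of the other sets that it sees. Degrees into `L` agree
  -- up to the factor `Q`, so the total cost is at most `M Q d`, against at least `d |C j| / 2`
  -- incidences with any half of `C j`.
  let ω : W → ℝ := fun y => ∑ i ∈ I.erase j, (#(G.nbIn (C i) y) : ℝ) / #(C i)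
  have hω : ∀ y, 0 ≤ ω y := fun y =>
    sum_nonneg fun i _ => div_nonneg (Nat.cast_nonneg _) (Nat.cast_nonneg _)
  have hωsum : ∑ y ∈ L, ω y ≤ M * (Q * d) := by
    rw [sum_comm]
    calc ∑ i ∈ I.erase j, ∑ y ∈ L, (#(G.nbIn (C i) y) : ℝ) / #(C i)
        ≤ ∑ i ∈ I.erase j, Q * d := by
          refine sum_le_sum fun i hi => ?_
          rw [← sum_div]
          refine div_le_of_le_mul₀ (Nat.cast_nonneg _) (by positivity) ?_
          have h1 : ∑ y ∈ L, (#(G.nbIn (C i) y) : ℝ) = ∑ w ∈ C i, (#(G.nbIn L w) : ℝ) := by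
            exact_mod_cast sum_card_nbIn_comm (C i) L
          rw [h1, mul_comm, ← nsmul_eq_mul]
          exact sum_le_card_nsmul _ _ _ (hhi i (mem_of_mem_erase hi))
      _ = #(I.erase j) * (Q * d) := by rw [sum_const, nsmul_eq_mul]
      _ ≤ M * (Q * d) := by
          have h1 : #(I.erase j) ≤ M := (card_le_card (erase_subset _ _)).trans hIM
          exact mul_le_mul_of_nonneg_right (by exact_mod_cast h1) (by positivity)
  -- Including the overshoot `δ`, at most twice `|C j| / (16 M ^ 2 Q)` vertices get covered; at the
  -- rate `2 M Q / |C j|` this costs at most `1 / (4 M)`.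
  set τ := ⌊(#(C j) : ℝ) / (16 * M ^ 2 * Q)⌋₊ with hτ
  have h16 : (0 : ℝ) < 16 * M ^ 2 * Q := by positivity
  have hτle : (τ : ℝ) ≤ #(C j) / (16 * M ^ 2 * Q) := Nat.floor_le (by positivity)
  have hτ2 : 2 * τ ≤ #(C j) := by
    have h1 : (τ : ℝ) * (16 * M ^ 2 * Q) ≤ #(C j) := by rwa [le_div_iff₀ h16] at hτle
    have h2 : (0 : ℝ) ≤ τ := Nat.cast_nonneg _
    have h3 : 2 * (τ : ℝ) ≤ #(C j) := by nlinarith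
    exact_mod_cast h3
  have hτge : (#(C j) : ℝ) ≤ 32 * M ^ 2 * Q * τ := by
    have h1 := Nat.lt_floor_add_one ((#(C j) : ℝ) / (16 * M ^ 2 * Q))
    rw [← hτ, div_lt_iff₀ h16] at h1
    have h2 : 1 ≤ τ := by
      rw [hτ, Nat.one_le_floor_iff, le_div_iff₀ h16]
      linarith
    have h3 : (1 : ℝ) ≤ τ := by exact_mod_cast h2
    nlinarith
  obtain ⟨Y, hYL, hY1, hY2, hY3⟩ := exists_greedy_cover (L := L) (T := C j) (N := G.nbIn (C j))
    (ω := ω) (c := 2 * M * Q / #(C j)) (m := ⌊δ⌋₊) (τ := τ)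
    (fun y hy => by
      rw [Nat.le_floor_iff (by linarith)]
      refine le_trans ?_ (hdeg y hy)
      exact_mod_cast card_le_card inter_subset_right) hτ2
    (fun T' hT' hTT' => by
      have heq : ∀ y, T' ∩ G.nbIn (C j) y = G.nbIn T' y := by
        intro y
        ext z
        simp only [mem_inter, mem_nbIn]
        exact ⟨fun h => ⟨h.1, h.2.2⟩, fun h => ⟨h.1, hT' h.1, h.2⟩⟩
      simp only [heq]
      have hTr : (#(C j) : ℝ) ≤ 2 * #T' := by exact_mod_cast hTT'
      have hsum : d * #(C j) / 2 ≤ ((∑ y ∈ L, #(G.nbIn T' y) : ℕ) : ℝ) := by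
        rw [sum_card_nbIn_comm]
        push_cast
        calc d * #(C j) / 2 ≤ #T' * d := by nlinarith
          _ = ∑ w ∈ T', d := by rw [sum_const, nsmul_eq_mul]
          _ ≤ _ := sum_le_sum fun w hw => hlo w (hT' hw)
      have hpos : 0 < d * #(C j) / 2 := by positivity
      refine exists_pos_and_le_mul (fun y _ => hω y) (by exact_mod_cast hpos.trans_le hsum) ?_
      calc ∑ y ∈ L, ω y ≤ M * (Q * d) := hωsum
        _ = 2 * M * Q / #(C j) * (d * #(C j) / 2) := by field_simp
        _ ≤ _ := mul_le_mul_of_nonneg_left hsum (by positivity))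
  have hcov : C j ∩ Y.biUnion (G.nbIn (C j)) = (C j).filter fun w => ∃ y ∈ Y, G.Adj y w := by
    ext w
    simp only [mem_inter, mem_biUnion, mem_nbIn, mem_filter]
    exact ⟨fun ⟨h1, y, h2, _, h3⟩ => ⟨h1, y, h2, h3⟩, fun ⟨h1, y, h2, h3⟩ => ⟨h1, y, h2, h1, h3⟩⟩
  rw [hcov] at hY1 hY2 hY3
  have hωY : ∑ y ∈ Y, ω y ≤ 1 / (4 * M) := by
    refine hY3.trans ?_
    have h1 : (#((C j).filter fun w => ∃ y ∈ Y, G.Adj y w) : ℝ) ≤ τ + δ := by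
      have h2 : (#((C j).filter fun w => ∃ y ∈ Y, G.Adj y w) : ℝ) ≤ (τ : ℝ) + (⌊δ⌋₊ : ℝ) := by
        exact_mod_cast hY2
      have h3 := Nat.floor_le (show 0 ≤ δ by linarith)
      linarith
    have h4 : δ ≤ #(C j) / (16 * M ^ 2 * Q) := by
      rw [le_div_iff₀ h16]
      linarith
    have h5 : (#((C j).filter fun w => ∃ y ∈ Y, G.Adj y w) : ℝ) ≤
        2 * (#(C j) / (16 * M ^ 2 * Q)) := by linarith
    calc 2 * M * Q / #(C j) * (#((C j).filter fun w => ∃ y ∈ Y, G.Adj y w) : ℝ)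
        ≤ 2 * M * Q / #(C j) * (2 * (#(C j) / (16 * M ^ 2 * Q))) :=
          mul_le_mul_of_nonneg_left h5 (by positivity)
      _ = 1 / (4 * M) := by field_simp; norm_num
  refine ⟨Y, hYL, hτge.trans ?_, fun i hi hij => ?_⟩
  · exact mul_le_mul_of_nonneg_left (by exact_mod_cast hY1) (by positivity)
  · have h1 : (#((C i).filter fun w => ∃ y ∈ Y, G.Adj y w) : ℝ) ≤ ∑ y ∈ Y, (#(G.nbIn (C i) y) : ℝ) := by
      have h2 : ((C i).filter fun w => ∃ y ∈ Y, G.Adj y w) ⊆ Y.biUnion (G.nbIn (C i)) := by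
        intro w hw
        obtain ⟨h3, y, h4, h5⟩ := mem_filter.1 hw
        exact mem_biUnion.2 ⟨y, h4, mem_nbIn.2 ⟨h3, h5⟩⟩
      exact_mod_cast (card_le_card h2).trans card_biUnion_le
    rcases Nat.eq_zero_or_pos #(C i) with h0 | h0
    · have h2 : C i = ∅ := card_eq_zero.1 h0
      simp [h2]
    · have h0' : (0 : ℝ) < #(C i) := by exact_mod_cast h0
      have h2 : ∑ y ∈ Y, (#(G.nbIn (C i) y) : ℝ) / #(C i) ≤ ∑ y ∈ Y, ω y :=
        sum_le_sum fun y _ => single_le_sum (f := fun i => (#(G.nbIn (C i) y) : ℝ) / #(C i))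
          (fun i _ => div_nonneg (Nat.cast_nonneg _) (Nat.cast_nonneg _)) (mem_erase.2 ⟨hij, hi⟩)
      rw [← sum_div] at h2
      have h3 := (h2.trans hωY)
      rw [div_le_iff₀ h0'] at h3
      linarith

/-- `Y i` is a set of ports of `C i`: all vertices of `C i`, but no vertices of the other sets, have
neighbours in `Y i`. -/
def IsPorts (G : SimpleGraph W) (C : ℕ → Finset W) (I : Finset ℕ) (L : Finset W)
    (Y : ℕ → Finset W) : Prop :=
  ∀ i ∈ I, Y i ⊆ L ∧ (∀ w ∈ C i, ∃ y ∈ Y i, G.Adj y w) ∧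
    ∀ i' ∈ I, i' ≠ i → ∀ w ∈ C i', ∀ y ∈ Y i, ¬ G.Adj y w

/-- The sets take turns with `exists_port`: in its own turn a set keeps only the covered vertices,
and in the turns of others it drops the covered ones. The heavy loss occurs once, and at most `M`
losses of a proportion `1 / (4 M)` leave at least half. -/
theorem exists_isPorts {C : ℕ → Finset W} {I : Finset ℕ} {L : Finset W} {M : ℕ} {Q d δ : ℝ}
    (hIM : #I ≤ M) (hQ : 1 ≤ Q) (hd : 0 < d) (hδ : 1 ≤ δ)
    (hhi : ∀ i ∈ I, ∀ w ∈ C i, (#(G.nbIn L w) : ℝ) ≤ Q * d)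
    (hlo : ∀ i ∈ I, ∀ w ∈ C i, d ≤ #(G.nbIn L w))
    (hdeg : ∀ y ∈ L, ∀ i ∈ I, (#(G.nbIn (C i) y) : ℝ) ≤ δ)
    (hC : ∀ i ∈ I, 32 * M ^ 2 * Q * δ ≤ #(C i)) :
    ∃ C' Y : ℕ → Finset W, IsPorts G C' I L Y ∧
      ∀ i ∈ I, C' i ⊆ C i ∧ (#(C i) : ℝ) ≤ 64 * M ^ 2 * Q * #(C' i) := by
  rcases Nat.eq_zero_or_pos M with h0 | hM
  · have hI : I = ∅ := card_eq_zero.1 (by omega)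
    exact ⟨C, C, by simp [IsPorts, hI], by simp [hI]⟩
  have hM1 : (1 : ℝ) ≤ M := by exact_mod_cast hM
  set ρ : ℝ := 1 - 1 / (4 * M) with hρ
  have hinv : (1 : ℝ) / (4 * M) ≤ 1 / 4 := by
    rw [div_le_div_iff₀ (by linarith) (by norm_num)]
    linarith
  have hinv0 : (0 : ℝ) ≤ 1 / (4 * M) := by positivity
  have hρ0 : 0 ≤ ρ := by linarith
  have hρ1 : ρ ≤ 1 := by linarith
  have hρM : ∀ c ≤ M, 1 / 2 ≤ ρ ^ c := by
    intro c hc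
    have h1 := one_add_mul_le_pow (show (-2 : ℝ) ≤ -(1 / (4 * M)) by linarith) c
    have h2 : (c : ℝ) * (1 / (4 * M)) ≤ 1 / 2 := by
      have h3 : (c : ℝ) ≤ M := by exact_mod_cast hc
      rw [mul_one_div, div_le_div_iff₀ (by linarith) (by norm_num)]
      linarith
    have h4 : 1 + -(1 / (4 * (M : ℝ))) = ρ := by rw [hρ]; ring
    rw [h4] at h1
    linarith
  have hMsq : (1 : ℝ) ≤ (M : ℝ) ^ 2 := by nlinarith
  have hA : 1 ≤ 32 * (M : ℝ) ^ 2 * Q := by nlinarith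
  have key : ∀ J ⊆ I, ∃ C' Y : ℕ → Finset W,
      (∀ i ∈ J, Y i ⊆ L ∧ (∀ w ∈ C' i, ∃ y ∈ Y i, G.Adj y w) ∧
        ∀ i' ∈ I, i' ≠ i → ∀ w ∈ C' i', ∀ y ∈ Y i, ¬ G.Adj y w) ∧
      ∀ i ∈ I, C' i ⊆ C i ∧ (i ∉ J → ρ ^ #J * #(C i) ≤ #(C' i)) ∧
        ρ ^ #J * #(C i) ≤ 32 * M ^ 2 * Q * #(C' i) := by
    intro J
    induction J using Finset.induction_on with
    | empty =>
      intro _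
      refine ⟨C, C, by simp, fun i hi => ⟨subset_rfl, by simp, ?_⟩⟩
      have : (0 : ℝ) ≤ #(C i) := Nat.cast_nonneg _
      simp only [card_empty, pow_zero, one_mul]
      nlinarith
    | insert j J hj ih =>
      intro hJ
      obtain ⟨C', Y, hY, hC'⟩ := ih ((subset_insert _ _).trans hJ)
      have hjI : j ∈ I := hJ (mem_insert_self _ _)
      have hJM : #J ≤ M := (card_le_card ((subset_insert _ _).trans hJ)).trans hIM
      have hCj := (hC' j hjI).2.1 hj
      obtain ⟨Yj, hYj, hcov, hkill⟩ := exists_port (G := G) (C := C') (I := I) (L := L) (M := M)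
        (Q := Q) (d := d) (δ := δ) (j := j) hM hIM hQ hd hδ
        (fun i hi w hw => hhi i hi w ((hC' i hi).1 hw))
        (fun w hw => hlo j hjI w ((hC' j hjI).1 hw))
        (fun y hy => le_trans (by exact_mod_cast card_le_card (nbIn_mono (hC' j hjI).1 y))
          (hdeg y hy j hjI))
        (by
          have h1 := hC j hjI
          have h2 := hρM #J hJM
          have h3 : (0 : ℝ) ≤ #(C j) := Nat.cast_nonneg _
          nlinarith)
      refine ⟨fun i => if i = j then (C' i).filter fun w => ∃ y ∈ Yj, G.Adj y w
        else (C' i).filter fun w => ¬ ∃ y ∈ Yj, G.Adj y w, Function.update Y j Yj, ?_, ?_⟩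
      · intro i hi
        rcases eq_or_ne i j with rfl | hij
        · rw [Function.update_self]
          refine ⟨hYj, fun w hw => ?_, fun i' hi' hne w hw y hy hadj => ?_⟩
          · simp only [if_true] at hw
            exact (mem_filter.1 hw).2
          · simp only [if_neg hne] at hw
            exact (mem_filter.1 hw).2 ⟨y, hy, hadj⟩
        · rw [Function.update_of_ne hij]
          obtain ⟨h1, h2, h3⟩ := hY i ((mem_insert.1 hi).resolve_left hij)
          refine ⟨h1, fun w hw => h2 w ?_, fun i' hi' hne w hw => h3 i' hi' hne w ?_⟩
          · dsimp only at hw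
            split_ifs at hw <;> exact (mem_filter.1 hw).1
          · dsimp only at hw
            split_ifs at hw <;> exact (mem_filter.1 hw).1
      · intro i hi
        obtain ⟨h1, h2, h3⟩ := hC' i hi
        rw [card_insert_of_notMem hj, pow_succ]
        have hCi : (0 : ℝ) ≤ #(C i) := Nat.cast_nonneg _
        have hpw : 0 ≤ ρ ^ #J * #(C i) := mul_nonneg (pow_nonneg hρ0 _) hCi
        rcases eq_or_ne i j with rfl | hij
        · simp only [if_true]
          refine ⟨(filter_subset _ _).trans h1, fun h => absurd (mem_insert_self _ _) h, ?_⟩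
          have h4 := h2 hj
          nlinarith
        · simp only [if_neg hij]
          have h4 := hkill i hi hij
          have h5 : (#((C' i).filter fun w => ∃ y ∈ Yj, G.Adj y w) : ℝ) +
              #((C' i).filter fun w => ¬ ∃ y ∈ Yj, G.Adj y w) = #(C' i) := by
            exact_mod_cast card_filter_add_card_filter_not _
          have h6 : ρ * #(C' i) ≤ #((C' i).filter fun w => ¬ ∃ y ∈ Yj, G.Adj y w) := by
            rw [hρ, sub_mul, one_mul]
            linarith
          refine ⟨(filter_subset _ _).trans h1, fun h => ?_, ?_⟩
          · have h7 := h2 fun h8 => h (mem_insert_of_mem h8)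
            have h8 := mul_le_mul_of_nonneg_left h7 hρ0
            linarith
          · have h8 := mul_le_mul_of_nonneg_left h3 hρ0
            have h9 := mul_le_mul_of_nonneg_left h6 (show 0 ≤ 32 * (M : ℝ) ^ 2 * Q by linarith)
            linarith
  obtain ⟨C', Y, hY, hC'⟩ := key I subset_rfl
  refine ⟨C', Y, hY, fun i hi => ⟨(hC' i hi).1, ?_⟩⟩
  have h1 := (hC' i hi).2.2
  have h2 := hρM #I hIM
  have h3 : (0 : ℝ) ≤ #(C i) := Nat.cast_nonneg _
  nlinarith

/-- Ports in a set `L` in which all vertices of the family have neighbours. -/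
theorem exists_isPorts_of_adj {C : ℕ → Finset W} {I : Finset ℕ} {L : Finset W} {M E : ℕ} {q δ σ : ℝ}
    (hIM : #I ≤ M) (hq : 1 ≤ q) (hδ : 1 ≤ δ) (hL : (#L : ℝ) ≤ q ^ E)
    (hadj : ∀ i ∈ I, ∀ w ∈ C i, ∃ y ∈ L, G.Adj y w)
    (hdeg : ∀ y ∈ L, ∀ i ∈ I, (#(G.nbIn (C i) y) : ℝ) ≤ δ) (hqM : 64 * M ^ 2 * (E + 1) ≤ q)
    (hσ : q ^ 2 * δ ≤ σ) (hC : ∀ i ∈ I, σ ≤ #(C i)) :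
    ∃ I' ⊆ I, #I ≤ (E + 1) * #I' ∧ ∃ C' Y : ℕ → Finset W, IsPorts G C' I' L Y ∧
      ∀ i ∈ I', C' i ⊆ C i ∧ (#(C i) : ℝ) ≤ q ^ 2 * #(C' i) := by
  rcases I.eq_empty_or_nonempty with rfl | hI
  · exact ⟨∅, subset_rfl, by simp, C, C, by simp [IsPorts], by simp⟩
  have hM : 1 ≤ M := le_trans (Finset.card_pos.2 hI) hIM
  have hM1 : (1 : ℝ) ≤ M := by exact_mod_cast hM
  have hMsq : (1 : ℝ) ≤ (M : ℝ) ^ 2 := by nlinarith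
  have hE0 : (0 : ℝ) ≤ E := Nat.cast_nonneg _
  have hq1 : 1 < q := by nlinarith
  -- Nonzero degrees into `L` lie between `1` and `q ^ E`. Sorting them by powers of `q` gives `E +
  -- 1` classes, within each of which degrees agree up to the factor `q`, as `exists_isPorts`
  -- requires.
  have hcls : ∀ w, ∃ a ≤ E, 0 < #(G.nbIn L w) →
      q ^ a ≤ #(G.nbIn L w) ∧ (#(G.nbIn L w) : ℝ) ≤ q * q ^ a := by
    intro w
    have hex : ∃ a, (#(G.nbIn L w) : ℝ) ≤ q * q ^ a := by
      refine ⟨E, ?_⟩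
      have h1 : (#(G.nbIn L w) : ℝ) ≤ #L := by exact_mod_cast card_le_card (nbIn_subset _ _)
      have h2 : 0 ≤ q ^ E := by positivity
      nlinarith
    refine ⟨Nat.find hex, Nat.find_min' hex ?_, fun hpos => ⟨?_, Nat.find_spec hex⟩⟩
    · have h1 : (#(G.nbIn L w) : ℝ) ≤ #L := by exact_mod_cast card_le_card (nbIn_subset _ _)
      have h2 : 0 ≤ q ^ E := by positivity
      nlinarith
    · rcases Nat.eq_zero_or_pos (Nat.find hex) with h0 | h0
      · rw [h0, pow_zero]
        exact_mod_cast hpos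
      · have h1 := Nat.find_min hex (show Nat.find hex - 1 < Nat.find hex by omega)
        rw [not_le, ← pow_succ', Nat.sub_add_cancel h0] at h1
        exact h1.le
  choose f hf hfw using hcls
  obtain ⟨a, -, I', hI', hIc, hCc⟩ := exists_uniform C I f (k := E + 1) (by omega)
    fun i _ v _ => Nat.lt_succ_of_le (hf v)
  have hpos : ∀ i ∈ I', ∀ w ∈ C i, 0 < #(G.nbIn L w) := by
    intro i hi w hw
    obtain ⟨y, hy, hyw⟩ := hadj i (hI' hi) w hw
    exact Finset.card_pos.2 ⟨y, mem_nbIn.2 ⟨hy, hyw.symm⟩⟩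
  have hCr : ∀ i ∈ I', (#(C i) : ℝ) ≤ (E + 1) * #((C i).filter fun v => f v = a) := fun i hi => by
    exact_mod_cast hCc i hi
  obtain ⟨C', Y, hY, hC'⟩ := exists_isPorts (G := G) (C := fun i => (C i).filter fun v => f v = a)
    (I := I') (L := L) (M := M) (Q := q) (d := q ^ a) (δ := δ) ((card_le_card hI').trans hIM) hq
    (by positivity) hδ
    (fun i hi w hw => by
      obtain ⟨h1, rfl⟩ := mem_filter.1 hw
      exact (hfw w (hpos i hi w h1)).2)
    (fun i hi w hw => by
      obtain ⟨h1, rfl⟩ := mem_filter.1 hw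
      exact (hfw w (hpos i hi w h1)).1)
    (fun y hy i hi => le_trans
      (by exact_mod_cast card_le_card (nbIn_mono (filter_subset _ _) y)) (hdeg y hy i (hI' hi)))
    (fun i hi => by
      have h1 := hCr i hi
      have h2 := hC i (hI' hi)
      have h3 : q * δ * (64 * M ^ 2 * (E + 1)) ≤ q * δ * q :=
        mul_le_mul_of_nonneg_left hqM (by positivity)
      have h4 : 32 * (M : ℝ) ^ 2 * q * δ * (E + 1) ≤ (E + 1) * #((C i).filter fun v => f v = a) := by
        have h5 : 0 ≤ q * δ * M ^ 2 * (E + 1) := by positivity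
        nlinarith
      nlinarith)
  refine ⟨I', hI', hIc, C', Y, hY, fun i hi => ⟨(hC' i hi).1.trans (filter_subset _ _), ?_⟩⟩
  have h1 := (hC' i hi).2
  have h2 := hCr i hi
  have h3 : (0 : ℝ) ≤ #(C' i) := Nat.cast_nonneg _
  calc (#(C i) : ℝ) ≤ (E + 1) * (64 * M ^ 2 * q * #(C' i)) :=
        h2.trans (mul_le_mul_of_nonneg_left h1 (by positivity))
    _ = 64 * M ^ 2 * (E + 1) * (q * #(C' i)) := by ring
    _ ≤ q * (q * #(C' i)) := mul_le_mul_of_nonneg_right hqM (by positivity)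
    _ = _ := by ring

end Ports

section InducedSubpath

variable {W : Type u} {G : SimpleGraph W}

/-- Every walk has an induced subpath with the same ends. -/
theorem exists_induced_subpath (L : ℕ) (x : ℕ → W) (hx : ∀ t < L, G.Adj (x t) (x (t + 1))) :
    ∃ L' ≤ L, ∃ g : ℕ → ℕ, g 0 = 0 ∧ g L' = L ∧ (∀ s t, s < t → t ≤ L' → g s < g t) ∧
      ∀ s t, s < t → t ≤ L' → (G.Adj (x (g s)) (x (g t)) ↔ s + 1 = t) := by
  induction L using Nat.strong_induction_on generalizing x with
  | _ L ih =>
    rcases Nat.eq_zero_or_pos L with rfl | hL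
    · exact ⟨0, le_rfl, fun _ => 0, rfl, rfl, fun s t h1 h2 => by omega, fun s t h1 h2 => by omega⟩
    have hne : ((range (L + 1)).filter fun j => G.Adj (x 0) (x j)).Nonempty :=
      ⟨1, by simpa using ⟨hL, hx 0 hL⟩⟩
    -- Jump from `x 0` to its last neighbour on the walk and continue from there; no later vertex is
    -- adjacent to `x 0`.
    obtain ⟨j, hj, hmax⟩ := exists_max_image _ id hne
    obtain ⟨hjL, hj0⟩ := mem_filter.1 hj
    rw [mem_range] at hjL
    have hjpos : 0 < j := by
      rcases Nat.eq_zero_or_pos j with rfl | h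
      · exact absurd rfl hj0.ne
      · exact h
    obtain ⟨L', hL', g, hg0, hgL, hgm, hga⟩ := ih (L - j) (by omega) (fun t => x (t + j))
      (fun t ht => by
        have := hx (t + j) (by omega)
        rwa [show t + j + 1 = t + 1 + j by omega] at this)
    refine ⟨L' + 1, by omega, fun t => if t = 0 then 0 else g (t - 1) + j, by simp, ?_, ?_, ?_⟩
    · simp [hgL]
      omega
    · intro s t hst ht
      simp only [if_neg (show t ≠ 0 by omega)]
      split_ifs with hs
      · omega
      · have := hgm (s - 1) (t - 1) (by omega) (by omega)
        omega
    · intro s t hst ht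
      simp only [if_neg (show t ≠ 0 by omega)]
      split_ifs with hs
      · subst hs
        rcases Nat.lt_or_ge 1 t with h1 | h1
        · have h2 := hgm 0 (t - 1) (by omega) (by omega)
          have h3 : g (t - 1) ≤ L - j := by
            rcases Nat.lt_or_ge (t - 1) L' with h4 | h4
            · have := hgm (t - 1) L' h4 le_rfl
              omega
            · have : t - 1 = L' := by omega
              rw [this, hgL]
          constructor
          · intro h5
            have := hmax (g (t - 1) + j) (mem_filter.2 ⟨mem_range.2 (by omega), h5⟩)
            simp at this
            omega
          · intro h5
            omega
        · have : t = 1 := by omega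
          subst this
          simpa [hg0] using hj0
      · rw [hga (s - 1) (t - 1) (by omega) (by omega)]
        omega

end InducedSubpath

end SimpleGraph

/-! ### Expansion and levels. -/

namespace SimpleGraph

open Finset

open scoped Classical

universe u

variable {W : Type u} {G : SimpleGraph W}

/-- Any two disjoint sets of at least `m` vertices are joined by an edge. -/
def LinksLarge (G : SimpleGraph W) (m : ℕ) : Prop :=
  ∀ A B : Finset W, Disjoint A B → m ≤ #A → m ≤ #B → ∃ a ∈ A, ∃ b ∈ B, G.Adj a b

/-- The vertices of `A` with a neighbour in `X`. -/
noncomputable def nbOf (G : SimpleGraph W) (A X : Finset W) : Finset W :=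
  A.filter fun v => ∃ x ∈ X, G.Adj x v

theorem mem_nbOf {A X : Finset W} {v : W} : v ∈ G.nbOf A X ↔ v ∈ A ∧ ∃ x ∈ X, G.Adj x v :=
  mem_filter

theorem nbOf_subset (A X : Finset W) : G.nbOf A X ⊆ A := filter_subset _ _

theorem LinksLarge.card_lt {m : ℕ} (h : G.LinksLarge m) {A X : Finset W} (hAX : Disjoint X A)
    (hX : m ≤ #X) : #A < #(G.nbOf A X) + m := by
  by_contra hcon
  have h1 : #(A \ G.nbOf A X) = #A - #(G.nbOf A X) := card_sdiff_of_subset (nbOf_subset A X)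
  obtain ⟨a, ha, b, hb, hab⟩ := h X (A \ G.nbOf A X) (hAX.mono_right sdiff_subset) hX (by omega)
  exact (mem_sdiff.1 hb).2 (mem_nbOf.2 ⟨(mem_sdiff.1 hb).1, a, ha, hab⟩)

/-- Small subsets of the sets of the family have many neighbours in the other sets. -/
def IsExpanding (G : SimpleGraph W) (C : ℕ → Finset W) (I : Finset ℕ) (r m : ℕ) : Prop :=
  ∀ i ∈ I, ∀ j ∈ I, i ≠ j → ∀ X ⊆ C i, X.Nonempty → #X < m → r * #X ≤ #(G.nbOf (C j) X)

/-- Sets `Z (i, j)` of fewer than `m` vertices with at most `r |Z (i, j)|` neighbours in what is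
left of `C j` are deleted from `C i`. If the rest does not expand, a violating `X` is added to some
`Z (i, j)`. The union has fewer than `2 m` vertices, and it cannot have `m` of them: it would then
see all but `m` of the remaining vertices of `C j`, which is more than `2 r m`. So the process could
continue for ever, although the total size of the `Z (i, j)` is bounded. -/
theorem exists_isExpanding {C : ℕ → Finset W} {I : Finset ℕ} {M r m : ℕ}
    (hdisj : ∀ i ∈ I, ∀ j ∈ I, i ≠ j → Disjoint (C i) (C j)) (hlink : G.LinksLarge m) (hm : 1 ≤ m)
    (hI : #I ≤ M) (hC : ∀ i ∈ I, (2 * r + M + 1) * m ≤ #(C i)) :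
    ∃ C' : ℕ → Finset W, (∀ i ∈ I, C' i ⊆ C i ∧ #(C i) ≤ #(C' i) + M * m) ∧
      G.IsExpanding C' I r m := by
  let D : (ℕ × ℕ → Finset W) → ℕ → Finset W := fun Z i => C i \ (I.erase i).biUnion fun j => Z (i, j)
  let P : (ℕ × ℕ → Finset W) → Prop := fun Z => ∀ e ∈ I.offDiag,
    Z e ⊆ C e.1 ∧ #(Z e) < m ∧ #(G.nbOf (D Z e.2) (Z e)) ≤ r * #(Z e)
  have hDsub : ∀ Z i, D Z i ⊆ C i := fun Z i => sdiff_subset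
  have hDcard : ∀ Z i, i ∈ I → (∀ e ∈ I.offDiag, e.1 = i → #(Z e) < m) →
      #(C i) ≤ #(D Z i) + M * m := by
    intro Z i hi hZ
    have h1 : #((I.erase i).biUnion fun j => Z (i, j)) ≤ #(I.erase i) * m :=
      card_biUnion_le_card_mul _ _ _ fun j hj => (hZ (i, j) (mem_offDiag.2
        ⟨hi, mem_of_mem_erase hj, (ne_of_mem_erase hj).symm⟩) rfl).le
    have h2 : #(I.erase i) * m ≤ M * m :=
      Nat.mul_le_mul_right _ ((card_le_card (erase_subset _ _)).trans hI)
    have h3 := le_card_sdiff ((I.erase i).biUnion fun j => Z (i, j)) (C i)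
    change _ ≤ #(D Z i) at h3
    omega
  by_contra! hcon
  have step : ∀ n : ℕ, ∃ Z, P Z ∧ n ≤ ∑ e ∈ I.offDiag, #(Z e) := by
    intro n
    induction n with
    | zero => exact ⟨fun _ => ∅, fun e _ => ⟨empty_subset _, by simpa using Nat.lt_of_lt_of_le Nat.zero_lt_one hm,
        by simp [nbOf]⟩, Nat.zero_le _⟩
    | succ n ih =>
      obtain ⟨Z, hZ, hn⟩ := ih
      have h1 := hcon (D Z) fun i hi => ⟨hDsub Z i, hDcard Z i hi fun e he _ => (hZ e he).2.1⟩
      rw [IsExpanding] at h1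
      push Not at h1
      obtain ⟨i, hi, j, hj, hij, X, hX, hXne, hXm, hXr⟩ := h1
      have hmem : (i, j) ∈ I.offDiag := mem_offDiag.2 ⟨hi, hj, hij⟩
      have hXZ : Disjoint (Z (i, j)) X := by
        rw [Finset.disjoint_right]
        intro x hx hxZ
        exact (mem_sdiff.1 (hX hx)).2 (mem_biUnion.2 ⟨j, mem_erase.2 ⟨hij.symm, hj⟩, hxZ⟩)
      set Z' := Function.update Z (i, j) (Z (i, j) ∪ X) with hZ'
      have hZle : ∀ e, Z e ⊆ Z' e := by
        intro e
        rcases eq_or_ne e (i, j) with rfl | he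
        · rw [hZ', Function.update_self]
          exact subset_union_left
        · rw [hZ', Function.update_of_ne he]
      have hDle : ∀ h, D Z' h ⊆ D Z h := fun h =>
        sdiff_subset_sdiff subset_rfl (biUnion_mono fun e _ => hZle _)
      have hnb : ∀ A B Y : Finset W, A ⊆ B → #(G.nbOf A Y) ≤ #(G.nbOf B Y) := fun A B Y hAB =>
        card_le_card (filter_subset_filter _ hAB)
      have hself : Z' (i, j) = Z (i, j) ∪ X := by rw [hZ', Function.update_self]
      have hcardu : #(Z' (i, j)) = #(Z (i, j)) + #X := by
        rw [hself, card_union_of_disjoint hXZ]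
      have hnbu : #(G.nbOf (D Z' j) (Z' (i, j))) ≤ r * #(Z' (i, j)) := by
        have h2 : G.nbOf (D Z' j) (Z' (i, j)) ⊆ G.nbOf (D Z j) (Z (i, j)) ∪ G.nbOf (D Z j) X := by
          intro v hv
          obtain ⟨hv1, x, hx, hxv⟩ := mem_nbOf.1 hv
          rw [hself, mem_union] at hx
          rcases hx with hx | hx
          · exact mem_union_left _ (mem_nbOf.2 ⟨hDle _ hv1, x, hx, hxv⟩)
          · exact mem_union_right _ (mem_nbOf.2 ⟨hDle _ hv1, x, hx, hxv⟩)
        have h3 := (card_le_card h2).trans (card_union_le _ _)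
        have h4 := (hZ _ hmem).2.2
        rw [hcardu, mul_add]
        exact h3.trans (add_le_add h4 hXr.le)
      have hsub : Z' (i, j) ⊆ C i := by
        rw [hself]
        exact union_subset (hZ _ hmem).1 (hX.trans (hDsub _ _))
      have hlt : #(Z' (i, j)) < m := by
        by_contra! hge
        have h5 : Disjoint (Z' (i, j)) (D Z' j) :=
          (hdisj i hi j hj hij).mono hsub (hDsub _ _)
        have h6 := hlink.card_lt h5 hge
        have h7 := hDcard Z' j hj fun e he hej => by
          rw [hZ', Function.update_of_ne (by rintro rfl; exact hij hej)]
          exact (hZ e he).2.1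
        have h8 := hC j hj
        have h9 : r * #(Z' (i, j)) ≤ r * (2 * m) :=
          Nat.mul_le_mul_left _ (by have := (hZ _ hmem).2.1; omega)
        have h10 : (2 * r + M + 1) * m = r * (2 * m) + M * m + m := by ring
        omega
      refine ⟨Z', fun e he => ?_, ?_⟩
      · rcases eq_or_ne e (i, j) with rfl | hne
        · exact ⟨hsub, hlt, hnbu⟩
        · have h2 := hZ e he
          rw [show Z' e = Z e by rw [hZ', Function.update_of_ne hne]]
          exact ⟨h2.1, h2.2.1, (hnb _ _ _ (hDle _)).trans h2.2.2⟩
      · refine Nat.succ_le_of_lt (hn.trans_lt (sum_lt_sum (fun e _ => card_le_card (hZle e))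
          ⟨(i, j), hmem, ?_⟩))
        have := hXne.card_pos
        omega
  obtain ⟨Z, hZ, hn⟩ := step (#I.offDiag * m + 1)
  have h1 : ∑ e ∈ I.offDiag, #(Z e) ≤ #I.offDiag * m :=
    sum_le_card_nsmul _ _ _ fun e he => (hZ e he).2.1.le
  omega

/-- Sets `S 0 = {z}, S 1, …, S T` of vertices of different colours, each of whose vertices has a
neighbour in the previous set. -/
structure IsLevels (G : SimpleGraph W) (col : W → ℕ) (c : ℕ → ℕ) (S : ℕ → Finset W) (T : ℕ)
    (z : W) : Prop where
  zero : S 0 = {z}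
  succ : ∀ t < T, ∀ y ∈ S (t + 1), ∃ x ∈ S t, G.Adj x y
  col_eq : ∀ t ≤ T, ∀ y ∈ S t, col y = c t
  ne : ∀ s t, s < t → t ≤ T → c s ≠ c t

/-- As long as levels have fewer than `m` vertices, they grow by the factor `r`; level `k - 1` would
then have `r ^ (k - 1) ≥ m` vertices. -/
theorem IsExpanding.exists_isLevels {C : ℕ → Finset W} {I : Finset ℕ} {r m k : ℕ}
    (h : G.IsExpanding C I r m) {col : W → ℕ} (hcol : ∀ i ∈ I, ∀ v ∈ C i, col v = i)
    (hm : 1 < m) (hr : 1 ≤ r) (hrm : m ≤ r ^ (k - 1)) {c : ℕ → ℕ} (hc : ∀ t < k, c t ∈ I)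
    (hne : ∀ s t, s < t → t < k → c s ≠ c t) {z : W} (hz : z ∈ C (c 0)) :
    ∃ T < k, ∃ S : ℕ → Finset W, IsLevels G col c S T z ∧ (∀ t ≤ T, S t ⊆ C (c t)) ∧ m ≤ #(S T) := by
  have hk : 1 ≤ k - 1 := by
    by_contra hcon
    rw [show k - 1 = 0 by omega, pow_zero] at hrm
    omega
  let S : ℕ → Finset W := fun t => Nat.rec {z} (fun t A => G.nbOf (C (c (t + 1))) A) t
  have hS : ∀ t, S (t + 1) = G.nbOf (C (c (t + 1))) (S t) := fun t => rfl
  have hSC : ∀ t, S t ⊆ C (c t) := by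
    intro t
    cases t with
    | zero => exact singleton_subset_iff.2 hz
    | succ t =>
      rw [hS]
      exact nbOf_subset _ _
  have hex : ∃ T < k, m ≤ #(S T) := by
    by_contra! hcon
    have h1 : ∀ t < k, r ^ t ≤ #(S t) := by
      intro t
      induction t with
      | zero =>
        intro _
        rw [pow_zero]
        exact card_pos.2 ⟨z, mem_singleton_self z⟩
      | succ t ih =>
        intro ht
        have h2 := ih (by omega)
        have h3 := h (c t) (hc t (by omega)) (c (t + 1)) (hc _ ht) (hne _ _ (by omega) ht) (S t)
          (hSC t) (card_pos.1 (lt_of_lt_of_le (Nat.pow_pos hr) h2)) (hcon t (by omega))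
        rw [← hS] at h3
        rw [pow_succ, mul_comm]
        exact (Nat.mul_le_mul_left _ h2).trans h3
    have := h1 (k - 1) (by omega)
    have := hcon (k - 1) (by omega)
    omega
  obtain ⟨T, hT, hTm⟩ := hex
  refine ⟨T, hT, S, ⟨rfl, fun t _ y hy => ?_, fun t ht y hy => ?_, fun s t hst ht =>
    hne s t hst (by omega)⟩, fun t _ => hSC t, hTm⟩
  · rw [hS] at hy
    exact (mem_nbOf.1 hy).2
  · exact hcol _ (hc t (by omega)) y (hSC t hy)

/-- A bounded value with a given property becomes constant on large parts of many sets of a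
family. -/
theorem exists_uniform_of_exists {C : ℕ → Finset W} {I : Finset ℕ} {k : ℕ} (hk : 0 < k)
    {P : ℕ → W → ℕ → Prop} (hP : ∀ i ∈ I, ∀ v ∈ C i, ∃ a < k, P i v a) :
    ∃ a < k, ∃ I' ⊆ I, #I ≤ k * #I' ∧ ∃ C' : ℕ → Finset W,
      ∀ i ∈ I', C' i ⊆ C i ∧ #(C i) ≤ k * #(C' i) ∧ ∀ v ∈ C' i, P i v a := by
  have h1 : ∀ i, ∃ a < k, i ∈ I → ∃ D ⊆ C i, #(C i) ≤ k * #D ∧ ∀ v ∈ D, P i v a := by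
    intro i
    by_cases hi : i ∈ I
    · have h2 : ∀ v, ∃ a < k, v ∈ C i → P i v a := fun v => by
        by_cases hv : v ∈ C i
        · obtain ⟨a, ha, h⟩ := hP i hi v hv
          exact ⟨a, ha, fun _ => h⟩
        · exact ⟨0, hk, fun h => absurd h hv⟩
      choose f hf hfP using h2
      obtain ⟨a, ha, h⟩ := exists_card_le_mul_card_filter_eq (C i) f hk fun v _ => hf v
      refine ⟨a, ha, fun _ => ⟨_, filter_subset _ _, h, fun v hv => ?_⟩⟩
      obtain ⟨hv1, rfl⟩ := mem_filter.1 hv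
      exact hfP v hv1
    · exact ⟨0, hk, fun h => absurd h hi⟩
  choose g hg hgi using h1
  obtain ⟨a, ha, h⟩ := exists_card_le_mul_card_filter_eq I g hk fun i _ => hg i
  have h2 : ∀ i, ∃ D, i ∈ I.filter (fun i => g i = a) →
      D ⊆ C i ∧ #(C i) ≤ k * #D ∧ ∀ v ∈ D, P i v a := by
    intro i
    by_cases hi : i ∈ I.filter fun i => g i = a
    · obtain ⟨hi1, rfl⟩ := mem_filter.1 hi
      obtain ⟨D, hD⟩ := hgi i hi1
      exact ⟨D, fun _ => hD⟩
    · exact ⟨∅, fun h => absurd h hi⟩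
  choose D hD using h2
  exact ⟨a, ha, _, filter_subset _ _, h, D, fun i hi => hD i hi⟩

end SimpleGraph

/-! ### Access paths to a common vertex. -/

namespace SimpleGraph

open Finset

open scoped Classical

universe u

variable {W : Type u} {G : SimpleGraph W}

/-- The sequence `p 0, …, p ℓ` is an induced path from `u ∈ C h` to `z`, with vertices of different
colours which apart from `u` lie in `K` and have no neighbours in the other sets of the family. -/
structure IsAccessPath (G : SimpleGraph W) (col : W → ℕ) (C : ℕ → Finset W) (I : Finset ℕ)
    (K : Set W) (h : ℕ) (u z : W) (ℓ : ℕ) (p : ℕ → W) : Prop where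
  left : p 0 = u
  right : p ℓ = z
  adj_iff : ∀ s t, s < t → t ≤ ℓ → (G.Adj (p s) (p t) ↔ s + 1 = t)
  mem : ∀ t, 0 < t → t ≤ ℓ → p t ∈ K
  ne : ∀ s t, 0 < s → s < t → t ≤ ℓ → col (p s) ≠ col (p t)
  not_adj : ∀ t, 0 < t → t ≤ ℓ → ∀ i ∈ I, i ≠ h → ∀ w ∈ C i, ¬ G.Adj (p t) w

/-- All vertices of the family have access to `z` along paths of length `ℓ`. -/
def HasAccess (G : SimpleGraph W) (col : W → ℕ) (C : ℕ → Finset W) (I : Finset ℕ) (K : Set W)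
    (z : W) (ℓ : ℕ) : Prop :=
  ∀ h ∈ I, ∀ u ∈ C h, ∃ p, G.IsAccessPath col C I K h u z ℓ p

theorem HasAccess.subset {col : W → ℕ} {C C' : ℕ → Finset W} {I I' : Finset ℕ} {K : Set W} {z : W}
    {ℓ : ℕ} (h : G.HasAccess col C I K z ℓ) (hI : I' ⊆ I) (hC : ∀ i ∈ I', C' i ⊆ C i) :
    G.HasAccess col C' I' K z ℓ := fun i hi u hu => by
  obtain ⟨p, h1, h2, h3, h4, h5, h6⟩ := h i (hI hi) u (hC i hi hu)
  exact ⟨p, h1, h2, h3, h4, h5, fun t ht0 ht j hj hji w hw =>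
    h6 t ht0 ht j (hI hj) hji w (hC j hj hw)⟩

/-- The last level has at least `m` vertices, so at least half of every set sees it, and descending
through the levels leads to `z`. The other sets must not see the path. For this, only vertices whose
first level with a neighbour is one common `a` are kept, so that no set sees the levels below `a`;
and on level `a` ports give each set private neighbours. Finally the lengths of the induced subpaths
are made equal by pigeonhole. -/
theorem IsLevels.exists_hasAccess [Fintype W] {col : W → ℕ} {c : ℕ → ℕ} {S : ℕ → Finset W}
    {T m M E : ℕ} {z : W} {C : ℕ → Finset W} {I : Finset ℕ} {K : Set W} {q δ σ : ℝ}
    (hS : G.IsLevels col c S T z) (hlink : G.LinksLarge m) (hm : 2 ≤ m) (hST : m ≤ #(S T))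
    (hcol : ∀ i ∈ I, ∀ v ∈ C i, col v = i) (hcI : ∀ t ≤ T, c t ∉ I)
    (hK : ∀ t ≤ T, ∀ y ∈ S t, y ∈ K) (hIM : #I ≤ M) (hW : (Fintype.card W : ℝ) ≤ q ^ E)
    (hq : 64 * M ^ 2 * (E + 1) ≤ q) (hqT : 2 * (T + 1) * (T + 2) ≤ q) (hδ : 1 ≤ δ)
    (hdeg : ∀ t ≤ T, ∀ y ∈ S t, ∀ i ∈ I, (#(G.nbIn (C i) y) : ℝ) ≤ δ) (hσδ : q ^ 3 * δ ≤ σ)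
    (hσm : 2 * m ≤ σ) (hC : ∀ i ∈ I, σ ≤ #(C i)) :
    ∃ I' ⊆ I, #I ≤ (T + 2) * (T + 1) * (E + 1) * #I' ∧ ∃ (C' : ℕ → Finset W) (ℓ : ℕ),
      0 < ℓ ∧ ℓ ≤ T + 1 ∧ (∀ i ∈ I', C' i ⊆ C i ∧ (#(C i) : ℝ) ≤ q ^ 3 * #(C' i)) ∧
        G.HasAccess col C' I' K z ℓ := by
  rcases I.eq_empty_or_nonempty with rfl | hI
  · exact ⟨∅, subset_rfl, by simp, C, 1, one_pos, by omega, by simp, by simp [HasAccess]⟩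
  have hT0 : (0 : ℝ) ≤ T := Nat.cast_nonneg _
  have hq4 : 4 ≤ q := by nlinarith
  have hq1 : 1 ≤ q := by linarith
  let C₁ : ℕ → Finset W := fun i => G.nbOf (C i) (S T)
  have hC₁ : ∀ i ∈ I, (#(C i) : ℝ) ≤ 2 * #(C₁ i) := by
    intro i hi
    have h1 : Disjoint (S T) (C i) := by
      rw [Finset.disjoint_left]
      intro v hv hvi
      have h2 := hS.col_eq T le_rfl v hv
      rw [hcol i hi v hvi] at h2
      exact hcI T le_rfl (h2 ▸ hi)
    have h4 : (#(C i) : ℝ) ≤ #(C₁ i) + m := by exact_mod_cast (hlink.card_lt h1 hST).le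
    have h6 := hC i hi
    linarith
  have hC₁C : ∀ i, C₁ i ⊆ C i := fun i => nbOf_subset _ _
  -- the first level with a neighbour
  obtain ⟨a, haT, I₂, hI₂, hI₂c, C₂, hC₂⟩ := exists_uniform_of_exists (C := C₁) (I := I)
    (k := T + 1) (Nat.succ_pos T)
    (P := fun _ v a => (∃ y ∈ S a, G.Adj y v) ∧ ∀ b < a, ∀ y ∈ S b, ¬ G.Adj y v)
    (fun i _ v hv => by
      have h1 : ∃ a, ∃ y ∈ S a, G.Adj y v := ⟨T, (mem_nbOf.1 hv).2⟩
      refine ⟨Nat.find h1, Nat.lt_succ_of_le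
        (Nat.find_min' h1 (mem_nbOf.1 hv).2), Nat.find_spec h1, ?_⟩
      intro b hb y hy hyv
      exact Nat.find_min h1 hb ⟨y, hy, hyv⟩)
  have hC₂C : ∀ i ∈ I₂, C₂ i ⊆ C i := fun i hi => (hC₂ i hi).1.trans (hC₁C i)
  have hsz₂ : ∀ i ∈ I₂, (#(C i) : ℝ) ≤ 2 * (T + 1) * #(C₂ i) := by
    intro i hi
    have h1 := hC₁ i (hI₂ hi)
    have h2 : (#(C₁ i) : ℝ) ≤ (T + 1) * #(C₂ i) := by exact_mod_cast (hC₂ i hi).2.1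
    linarith
  -- ports
  obtain ⟨I₃, hI₃, hI₃c, C₃, Y, hY, hC₃⟩ := exists_isPorts_of_adj (G := G) (C := C₂) (I := I₂)
    (L := S a) (M := M) (E := E) (q := q) (δ := δ) (σ := q ^ 2 * δ) ((card_le_card hI₂).trans hIM)
    hq1 hδ (le_trans (by exact_mod_cast card_le_univ _) hW)
    (fun i hi w hw => ((hC₂ i hi).2.2 w hw).1)
    (fun y hy i hi => le_trans (by exact_mod_cast card_le_card (nbIn_mono (hC₂C i hi) y))
      (hdeg a (by omega) y hy i (hI₂ hi))) hq le_rfl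
    (fun i hi => by
      have h1 := hsz₂ i hi
      have h2 := hC i (hI₂ hi)
      have h3 : 2 * ((T : ℝ) + 1) ≤ q := by nlinarith
      have h4 : 2 * ((T : ℝ) + 1) * #(C₂ i) ≤ q * #(C₂ i) :=
        mul_le_mul_of_nonneg_right h3 (Nat.cast_nonneg _)
      have h5 : q * (q ^ 2 * δ) ≤ q * #(C₂ i) := by
        calc q * (q ^ 2 * δ) = q ^ 3 * δ := by ring
          _ ≤ _ := by linarith
      exact le_of_mul_le_mul_left h5 (by linarith))
  have hC₃C : ∀ i ∈ I₃, C₃ i ⊆ C i := fun i hi => (hC₃ i hi).1.trans (hC₂C i (hI₃ hi))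
  -- induced paths
  have hpath : ∀ i ∈ I₃, ∀ u ∈ C₃ i, ∃ ℓ < T + 2, 0 < ℓ ∧
      ∃ p, G.IsAccessPath col C₃ I₃ K i u z ℓ p := by
    intro i hi u hu
    obtain ⟨hYL, hYadj, hYnot⟩ := hY i hi
    obtain ⟨y, hy, hyu⟩ := hYadj u hu
    have hback : ∀ b ≤ T, ∀ y ∈ S b, ∃ x : ℕ → W, x 0 = y ∧ (∀ t < b, G.Adj (x t) (x (t + 1))) ∧
        ∀ t ≤ b, x t ∈ S (b - t) := by
      intro b
      induction b with
      | zero => exact fun _ y hy => ⟨fun _ => y, rfl, fun t ht => absurd ht (Nat.not_lt_zero _),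
          fun t ht => by simpa using hy⟩
      | succ b ih =>
        intro hb y hy
        obtain ⟨y', hy', hadj⟩ := hS.succ b hb y hy
        obtain ⟨x, hx0, hx1, hx2⟩ := ih (by omega) y' hy'
        refine ⟨fun t => if t = 0 then y else x (t - 1), by simp, fun t ht => ?_, fun t ht => ?_⟩
        · rcases Nat.eq_zero_or_pos t with rfl | h0
          · simpa [hx0] using hadj.symm
          · simp only [if_neg h0.ne', if_neg (Nat.succ_ne_zero t), Nat.add_sub_cancel]
            have := hx1 (t - 1) (by omega)
            rwa [Nat.sub_add_cancel h0] at this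
        · rcases Nat.eq_zero_or_pos t with rfl | h0
          · simpa using hy
          · simp only [if_neg h0.ne']
            have := hx2 (t - 1) (by omega)
            rwa [show b - (t - 1) = b + 1 - t by omega] at this
    obtain ⟨x, hx0, hx1, hx2⟩ := hback a (by omega) y (hYL hy)
    -- Position `t ≥ 1` of this walk lies on level `a + 1 - t`, so the port at position one is its
    -- only vertex on level `a`.
    let x' : ℕ → W := fun t => if t = 0 then u else x (t - 1)
    have hx'0 : x' 0 = u := rfl
    have hx's : ∀ t, x' (t + 1) = x t := fun t => rfl
    obtain ⟨ℓ, hℓ, g, hg0, hgℓ, hgm, hga⟩ := exists_induced_subpath (G := G) (a + 1) x'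
      (fun t ht => by
        rcases Nat.eq_zero_or_pos t with rfl | h0
        · rw [hx's, hx'0, hx0]
          exact hyu.symm
        · obtain ⟨t, rfl⟩ := Nat.exists_eq_add_of_le' h0
          rw [hx's, hx's]
          exact hx1 t (by omega))
    have hgle : ∀ t ≤ ℓ, g t ≤ a + 1 := by
      intro t ht
      rcases ht.eq_or_lt with rfl | ht
      · exact hgℓ.le
      · exact (hgm t ℓ ht le_rfl).le.trans hgℓ.le
    have hgpos : ∀ t, 0 < t → t ≤ ℓ → 0 < g t := fun t h0 ht => by
      have := hgm 0 t h0 ht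
      omega
    have hxg : ∀ t, 0 < t → t ≤ ℓ → x' (g t) ∈ S (a + 1 - g t) := by
      intro t h0 ht
      have h1 := hgpos t h0 ht
      have h2 := hgle t ht
      have h3 := hx2 (g t - 1) (by omega)
      rw [← hx's, Nat.sub_add_cancel h1] at h3
      rwa [show a - (g t - 1) = a + 1 - g t by omega] at h3
    refine ⟨ℓ, by omega, ?_, fun t => x' (g t), by simp [hg0, hx'0], ?_, hga, ?_, ?_, ?_⟩
    · rcases Nat.eq_zero_or_pos ℓ with h0 | h0
      · rw [h0, hg0] at hgℓ
        omega
      · exact h0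
    · simp only [hgℓ, hx's]
      have := hx2 a le_rfl
      rwa [Nat.sub_self, hS.zero, mem_singleton] at this
    · intro t h0 ht
      have := hgpos t h0 ht
      exact hK _ (by omega) _ (hxg t h0 ht)
    · intro s t h0 hst ht
      have h1 := hgm s t hst ht
      have h2 := hgle t ht
      have h3 := hgpos s h0 (by omega)
      rw [hS.col_eq _ (by omega) _ (hxg s h0 (by omega)),
        hS.col_eq _ (by omega) _ (hxg t (by omega) ht)]
      exact (hS.ne _ _ (by omega) (by omega)).symm
    · intro t h0 ht j hj hji w hw
      rcases Nat.lt_or_ge 1 (g t) with h1 | h1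
      · have hj₂ := hI₃ hj
        have h2 := hgle t ht
        exact ((hC₂ j hj₂).2.2 w ((hC₃ j hj).1 hw)).2 _ (by omega) _ (hxg t h0 ht)
      · have h2 : g t = 0 + 1 := le_antisymm h1 (hgpos t h0 ht)
        simp only [h2, hx's, hx0]
        exact hYnot j hj hji w hw y hy
  obtain ⟨ℓ, hℓ, I₄, hI₄, hI₄c, C₄, hC₄⟩ := exists_uniform_of_exists (C := C₃) (I := I₃)
    (k := T + 2) (Nat.succ_pos _)
    (P := fun i u ℓ => 0 < ℓ ∧ ∃ p, G.IsAccessPath col C₃ I₃ K i u z ℓ p) hpath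
  have hcard : #I ≤ (T + 2) * (T + 1) * (E + 1) * #I₄ := by
    calc #I ≤ (T + 1) * #I₂ := hI₂c
      _ ≤ (T + 1) * ((E + 1) * #I₃) := Nat.mul_le_mul_left _ hI₃c
      _ ≤ (T + 1) * ((E + 1) * ((T + 2) * #I₄)) :=
        Nat.mul_le_mul_left _ (Nat.mul_le_mul_left _ hI₄c)
      _ = _ := by ring
  have hsize : ∀ i ∈ I₄, (#(C i) : ℝ) ≤ q ^ 3 * #(C₄ i) := by
    intro i hi
    have h1 := hsz₂ i (hI₃ (hI₄ hi))
    have h2 := (hC₃ i (hI₄ hi)).2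
    have h3 : (#(C₃ i) : ℝ) ≤ (T + 2) * #(C₄ i) := by exact_mod_cast (hC₄ i hi).2.1
    have h4 : (0 : ℝ) ≤ #(C₄ i) := Nat.cast_nonneg _
    calc (#(C i) : ℝ) ≤ 2 * (T + 1) * (q ^ 2 * ((T + 2) * #(C₄ i))) :=
          h1.trans (mul_le_mul_of_nonneg_left
            (h2.trans (mul_le_mul_of_nonneg_left h3 (by positivity))) (by positivity))
      _ = 2 * (T + 1) * (T + 2) * (q ^ 2 * #(C₄ i)) := by ring
      _ ≤ q * (q ^ 2 * #(C₄ i)) := mul_le_mul_of_nonneg_right hqT (by positivity)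
      _ = _ := by ring
  rcases I₄.eq_empty_or_nonempty with h0 | ⟨i, hi⟩
  · rw [h0, card_empty, mul_zero] at hcard
    exact absurd (card_pos.2 hI) (by omega)
  · have hne : 0 < #(C₄ i) := by
      rcases Nat.eq_zero_or_pos #(C₄ i) with h0 | h0
      · have h1 := hsize i hi
        have h2 := hC i (hI₂ (hI₃ (hI₄ hi)))
        rw [h0] at h1
        have h3 : (2 : ℝ) ≤ m := by exact_mod_cast hm
        simp only [Nat.cast_zero, mul_zero] at h1
        linarith
      · exact h0
    obtain ⟨u, hu⟩ := card_pos.1 hne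
    refine ⟨I₄, hI₄.trans (hI₃.trans hI₂), hcard, C₄, ℓ, ((hC₄ i hi).2.2 u hu).1, by omega,
      fun j hj => ⟨(hC₄ j hj).1.trans (hC₃C j (hI₄ hj)), hsize j hj⟩, ?_⟩
    have h1 : G.HasAccess col C₄ I₄ K z ℓ := fun j hj v hv => by
      obtain ⟨p, h1, h2, h3, h4, h5, h6⟩ := ((hC₄ j hj).2.2 v hv).2
      exact ⟨p, h1, h2, h3, h4, h5, fun t ht0 ht i hi hij w hw =>
        h6 t ht0 ht i (hI₄ hi) hij w ((hC₄ i hi).1 hw)⟩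
    exact h1

end SimpleGraph

/-! ### Blockades, and joining access paths. -/

namespace SimpleGraph

open Finset

open scoped Classical

universe u

variable {W : Type u} {G : SimpleGraph W}

/-- Sets of at least `σ` vertices of colours in `I`, whose vertices have at most `δ` neighbours in
each of the other sets. -/
structure IsBlockade (G : SimpleGraph W) (col : W → ℕ) (C : ℕ → Finset W) (I : Finset ℕ)
    (σ δ : ℝ) : Prop where
  col_eq : ∀ i ∈ I, ∀ v ∈ C i, col v = i
  le_card : ∀ i ∈ I, σ ≤ #(C i)
  deg_le : ∀ i ∈ I, ∀ v ∈ C i, ∀ j ∈ I, j ≠ i → (#(G.nbIn (C j) v) : ℝ) ≤ δ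

theorem IsBlockade.subset {col : W → ℕ} {C C' : ℕ → Finset W} {I I' : Finset ℕ} {σ σ' δ : ℝ}
    (h : G.IsBlockade col C I σ δ) (hI : I' ⊆ I) (hC : ∀ i ∈ I', C' i ⊆ C i)
    (hσ : ∀ i ∈ I', σ' ≤ #(C' i)) : G.IsBlockade col C' I' σ' δ where
  col_eq i hi v hv := h.col_eq i (hI hi) v (hC i hi hv)
  le_card := hσ
  deg_le i hi v hv j hj hji := le_trans (by exact_mod_cast card_le_card (nbIn_mono (hC j hj) v))
    (h.deg_le i (hI hi) v (hC i hi hv) j (hI hj) hji)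

theorem IsBlockade.disjoint {col : W → ℕ} {C : ℕ → Finset W} {I : Finset ℕ} {σ δ : ℝ}
    (h : G.IsBlockade col C I σ δ) {i j : ℕ} (hi : i ∈ I) (hj : j ∈ I) (hij : i ≠ j) :
    Disjoint (C i) (C j) := by
  rw [Finset.disjoint_left]
  intro v hv hvj
  exact hij ((h.col_eq i hi v hv).symm.trans (h.col_eq j hj v hvj))

/-- The constants of the sparse regime: there are at most `q ^ E` vertices, and sets of `m` vertices
are linked, where `m ≤ r ^ (k - 1)`. -/
structure IsSetting (G : SimpleGraph W) [Fintype W] (q : ℝ) (E k r m : ℕ) : Prop where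
  card_le : (Fintype.card W : ℝ) ≤ q ^ E
  links : G.LinksLarge m
  two_le : 2 ≤ m
  one_le : 1 ≤ r
  le_pow : m ≤ r ^ (k - 1)

theorem IsSetting.exists_isExpanding [Fintype W] {q τ δ : ℝ} {E k r m : ℕ}
    (hG : G.IsSetting q E k r m) {col : W → ℕ} {C : ℕ → Finset W} {I : Finset ℕ}
    (hB : G.IsBlockade col C I (q * τ) δ) (hτ : (r * m : ℝ) ≤ τ) (hq : (#I : ℝ) + 3 ≤ q) :
    ∃ C' : ℕ → Finset W, (∀ i ∈ I, C' i ⊆ C i) ∧ G.IsBlockade col C' I τ δ ∧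
      G.IsExpanding C' I r m := by
  have hr : (1 : ℝ) ≤ r := by exact_mod_cast hG.one_le
  have hm : (2 : ℝ) ≤ m := by exact_mod_cast hG.two_le
  have hI0 : (0 : ℝ) ≤ #I := Nat.cast_nonneg _
  have hrm : (m : ℝ) ≤ r * m := by nlinarith
  have hτ0 : 0 ≤ τ := by linarith
  have h1 : ((#I : ℝ) + 3) * τ ≤ q * τ := mul_le_mul_of_nonneg_right hq hτ0
  have h2 : (#I : ℝ) * m ≤ #I * τ := mul_le_mul_of_nonneg_left (hrm.trans hτ) hI0
  obtain ⟨C', hC', hexp⟩ := SimpleGraph.exists_isExpanding (G := G) (C := C) (I := I) (M := #I) (r := r)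
    (fun i hi j hj hij => hB.disjoint hi hj hij) hG.links (one_le_two.trans hG.two_le) le_rfl
    (fun i hi => by
      have h3 := hB.le_card i hi
      have h4 : ((2 * r + #I + 1) * m : ℝ) ≤ #(C i) := by nlinarith
      exact_mod_cast h4)
  refine ⟨C', fun i hi => (hC' i hi).1, hB.subset subset_rfl (fun i hi => (hC' i hi).1)
    fun i hi => ?_, hexp⟩
  have h3 := hB.le_card i hi
  have h4 : (#(C i) : ℝ) ≤ #(C' i) + #I * m := by exact_mod_cast (hC' i hi).2
  nlinarith

/-- The path vertices stay in colours reserved for the levels, which keeps different systems of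
paths apart. The three factors `q` pay for the selections. -/
theorem IsSetting.exists_hasAccess [Fintype W] {q τ σ δ : ℝ} {E k r m : ℕ}
    (hG : G.IsSetting q E k r m) {col : W → ℕ} {C D : ℕ → Finset W} {I J : Finset ℕ}
    (hD : G.IsBlockade col D J σ δ) (hexp : G.IsExpanding D J r m) {c : ℕ → ℕ}
    (hc : ∀ t < k, c t ∈ J) (hne : ∀ s t, s < t → t < k → c s ≠ c t) {z : W} (hz : z ∈ D (c 0))
    (hB : G.IsBlockade col C I (q ^ 3 * τ) δ) (hIJ : I ⊆ J) (hCD : ∀ i ∈ I, C i ⊆ D i)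
    (hcI : ∀ t < k, c t ∉ I) (hq : 64 * (#I : ℝ) ^ 2 * (E + 1) ≤ q)
    (hqk : 2 * ((k : ℝ) + 1) * (k + 2) ≤ q) (hδ1 : 1 ≤ δ) (hδ : δ ≤ τ) (hm : (m : ℝ) ≤ τ) :
    ∃ I' ⊆ I, #I ≤ (k + 1) * k * (E + 1) * #I' ∧ ∃ (C' : ℕ → Finset W) (ℓ : ℕ),
      0 < ℓ ∧ ℓ ≤ k ∧ (∀ i ∈ I', C' i ⊆ C i) ∧ G.IsBlockade col C' I' τ δ ∧
        G.HasAccess col C' I' {v | v ∈ D (col v) ∧ ∃ t < k, col v = c t} z ℓ := by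
  obtain ⟨T, hT, S, hS, hSD, hST⟩ := hexp.exists_isLevels hD.col_eq (by linarith [hG.two_le])
    hG.one_le hG.le_pow hc hne hz
  have hk0 : (0 : ℝ) ≤ k := Nat.cast_nonneg _
  have hTk : (T : ℝ) + 1 ≤ k := by exact_mod_cast hT
  have hT0 : (0 : ℝ) ≤ T := Nat.cast_nonneg _
  have hq2 : 2 ≤ q := by nlinarith
  have hq3 : 2 ≤ q ^ 3 := by
    have : (1 : ℝ) ≤ q ^ 2 := one_le_pow₀ (by linarith)
    nlinarith
  obtain ⟨I', hI', hIc, C', ℓ, hℓ0, hℓ, hC', hacc⟩ := hS.exists_hasAccess (C := C) (I := I)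
    (K := {v | v ∈ D (col v) ∧ ∃ t < k, col v = c t}) (M := #I) (E := E) (q := q) (δ := δ)
    (σ := q ^ 3 * τ) hG.links hG.two_le hST hB.col_eq (fun t ht => hcI t (by omega))
    (fun t ht y hy => by
      have h1 := hS.col_eq t ht y hy
      refine ⟨?_, t, by omega, h1⟩
      rw [h1]
      exact hSD t ht hy) le_rfl hG.card_le hq (by nlinarith) hδ1
    (fun t ht y hy i hi => by
      have h1 := hcI t (by omega)
      refine le_trans (by exact_mod_cast card_le_card (nbIn_mono (hCD i hi) y))
        (hD.deg_le (c t) (hc t (by omega)) y (hSD t ht hy) i (hIJ hi) ?_)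
      rintro rfl
      exact h1 hi)
    (mul_le_mul_of_nonneg_left hδ (by linarith))
    (by
      have : 0 ≤ τ := by linarith
      nlinarith) hB.le_card
  refine ⟨I', hI', hIc.trans (Nat.mul_le_mul_right _ (Nat.mul_le_mul_right _
    (Nat.mul_le_mul (by omega) (by omega)))), C', ℓ, hℓ0, by omega, fun i hi => (hC' i hi).1,
    hB.subset hI' (fun i hi => (hC' i hi).1) fun i hi => ?_, hacc⟩
  have h1 := (hB.le_card i (hI' hi)).trans (hC' i hi).2
  exact le_of_mul_le_mul_left h1 (by linarith)

/-- The sequence `p 0, …, p ℓ` is a path from `u ∈ C h` to `v ∈ C j`, which is induced except that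
its ends may be adjacent, and whose interior vertices lie in `K`, have different colours and no
neighbours in the other sets of the family. -/
structure IsLinkPath (G : SimpleGraph W) (col : W → ℕ) (C : ℕ → Finset W) (I : Finset ℕ)
    (K : Set W) (h j : ℕ) (u v : W) (ℓ : ℕ) (p : ℕ → W) : Prop where
  left : p 0 = u
  right : p ℓ = v
  adj_iff : ∀ s t, s < t → t ≤ ℓ → (0 < s ∨ t < ℓ) → (G.Adj (p s) (p t) ↔ s + 1 = t)
  mem : ∀ t, 0 < t → t < ℓ → p t ∈ K
  ne : ∀ s t, 0 < s → s < t → t < ℓ → col (p s) ≠ col (p t)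
  not_adj : ∀ t, 0 < t → t < ℓ → ∀ i ∈ I, i ≠ h → i ≠ j → ∀ w ∈ C i, ¬ G.Adj (p t) w

/-- Two access paths to the same vertex give rise to a link. -/
theorem IsAccessPath.exists_isLinkPath {col : W → ℕ} {C : ℕ → Finset W} {I : Finset ℕ} {K K' : Set W}
    {h h' a b : ℕ} {u u' z : W} {p p' : ℕ → W} (hp : G.IsAccessPath col C I K h u z a p)
    (hp' : G.IsAccessPath col C I K' h' u' z b p') (ha : 0 < a)
    (hKK : ∀ v ∈ K, ∀ v' ∈ K', col v = col v' → col v = col z) (hu : ¬ G.Adj u u') :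
    ∃ ℓ ≤ a + b, 2 ≤ ℓ ∧ ∃ x, G.IsLinkPath col C I (K ∪ K') h h' u u' ℓ x := by
  -- The walk follows `p` to `z` and returns along `p'`. Its vertices have different colours in the
  -- interior, since `K` and `K'` share only the colour of `z`, which is used once.
  let y : ℕ → W := fun t => if t ≤ a then p t else p' (a + b - t)
  have hy1 : ∀ t ≤ a, y t = p t := fun t ht => if_pos ht
  have hy2 : ∀ t, a ≤ t → y t = p' (a + b - t) := by
    intro t ht
    rcases ht.eq_or_lt with rfl | ht
    · rw [hy1 _ le_rfl, Nat.add_sub_cancel_left, hp.right, hp'.right]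
    · exact if_neg (by omega)
  obtain ⟨ℓ, hℓ, g, hg0, hgℓ, hgm, hga⟩ := exists_induced_subpath (G := G) (a + b) y fun t ht => by
    rcases Nat.lt_or_ge t a with h1 | h1
    · rw [hy1 t h1.le, hy1 (t + 1) h1, hp.adj_iff t (t + 1) (by omega) h1]
    · rw [hy2 t h1, hy2 (t + 1) (by omega), G.adj_comm,
        hp'.adj_iff _ _ (by omega) (by omega)]
      omega
  have h0 : y 0 = u := by rw [hy1 0 (Nat.zero_le _), hp.left]
  have hL : y (a + b) = u' := by rw [hy2 _ (by omega), Nat.sub_self, hp'.left]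
  have hint : ∀ t, 0 < t → t < ℓ → 0 < g t ∧ g t < a + b := fun t h1 h2 => by
    have h3 := hgm 0 t h1 h2.le
    have h4 := hgm t ℓ h2 le_rfl
    omega
  have hℓ2 : 2 ≤ ℓ := by
    by_contra hcon
    rcases Nat.eq_zero_or_pos ℓ with h1 | h1
    · rw [h1, hg0] at hgℓ
      omega
    · obtain rfl : ℓ = 1 := by omega
      have h2 := (hga 0 1 one_pos le_rfl).2 rfl
      rw [hg0, hgℓ, h0, hL] at h2
      exact hu h2
  refine ⟨ℓ, hℓ, hℓ2, fun t => y (g t), by simp only [hg0, h0], by simp only [hgℓ, hL],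
    fun s t hst ht _ => hga s t hst ht, ?_, ?_, ?_⟩
  · intro t h1 h2
    obtain ⟨h3, h4⟩ := hint t h1 h2
    rcases Nat.lt_or_ge a (g t) with h5 | h5
    · simp only [hy2 _ h5.le]
      exact Or.inr (hp'.mem _ (by omega) (by omega))
    · simp only [hy1 _ h5]
      exact Or.inl (hp.mem _ h3 h5)
  · intro s t h1 hst h2
    have h3 := hgm s t hst h2.le
    obtain ⟨h4, -⟩ := hint s h1 (by omega)
    obtain ⟨-, h5⟩ := hint t (by omega) h2
    rcases Nat.lt_or_ge a (g t) with h6 | h6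
    · rcases Nat.lt_or_ge a (g s) with h7 | h7
      · simp only [hy2 _ h6.le, hy2 _ h7.le]
        exact (hp'.ne _ _ (by omega) (by omega) (by omega)).symm
      · simp only [hy2 _ h6.le, hy1 _ h7]
        intro h8
        have h9 := hKK _ (hp.mem _ h4 h7) _ (hp'.mem (a + b - g t) (by omega) (by omega)) h8
        rw [h8, ← hp'.right] at h9
        exact hp'.ne _ _ (by omega) (by omega) le_rfl h9
    · simp only [hy1 _ h6, hy1 (g s) (by omega)]
      exact hp.ne _ _ h4 h3 h6
  · intro t h1 h2 i hi hih hih' w hw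
    obtain ⟨h3, h4⟩ := hint t h1 h2
    rcases Nat.lt_or_ge a (g t) with h5 | h5
    · simp only [hy2 _ h5.le]
      exact hp'.not_adj _ (by omega) (by omega) i hi hih' w hw
    · simp only [hy1 _ h5]
      exact hp.not_adj _ h3 h5 i hi hih w hw

/-- A link to a vertex is prolonged by an access path to this vertex. -/
theorem IsLinkPath.exists_of_isAccessPath {col : W → ℕ} {C D : ℕ → Finset W} {I J : Finset ℕ}
    {K K' : Set W} {h j a b : ℕ} {u v z : W} {p p' : ℕ → W}
    (hp : G.IsLinkPath col D J K h (col z) u z a p)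
    (hp' : G.IsAccessPath col C I K' j v z b p') (ha : 2 ≤ a) (hb : 0 < b) (hIJ : I ⊆ J)
    (hCD : ∀ i ∈ I, C i ⊆ D i) (hh : h ∈ I) (hj : j ∈ I)
    (hhj : h ≠ j) (hu : u ∈ C h) (hv : v ∈ C j) (hK : ∀ w ∈ K, col w ∉ J)
    (hK' : ∀ w ∈ K', col w ∈ J ∧ col w ∉ I ∧ w ∈ D (col w)) :
    ∃ x, G.IsLinkPath col C I (K ∪ K') h j u v (a + b) x := by
  have hz : z ∈ K' := by
    rw [← hp'.right]
    exact hp'.mem b hb le_rfl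
  have hzI := (hK' z hz).2.1
  -- No shortening is needed. The interior of the link sees no set of `D` but those of its own ends,
  -- hence not the access path before `z`; and the access path does not see `C h`. So the length is
  -- exactly `a + b`.
  let y : ℕ → W := fun t => if t ≤ a then p t else p' (a + b - t)
  have hy1 : ∀ t ≤ a, y t = p t := fun t ht => if_pos ht
  have hy2 : ∀ t, a ≤ t → y t = p' (a + b - t) := by
    intro t ht
    rcases ht.eq_or_lt with rfl | ht
    · rw [hy1 _ le_rfl, Nat.add_sub_cancel_left, hp.right, hp'.right]
    · exact if_neg (by omega)
  have huadj : ∀ t, 0 < t → t ≤ b → ¬ G.Adj u (p' t) := fun t h1 h2 h3 =>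
    hp'.not_adj t h1 h2 h hh hhj u hu h3.symm
  refine ⟨y, by rw [hy1 0 (Nat.zero_le _), hp.left],
    by rw [hy2 _ (by omega), Nat.sub_self, hp'.left], ?_, ?_, ?_, ?_⟩
  · intro s t hst ht hexc
    rcases Nat.lt_or_ge a t with h1 | h1
    · rw [hy2 t h1.le]
      rcases Nat.lt_or_ge s a with h2 | h2
      · rw [hy1 s h2.le]
        refine iff_of_false ?_ (by omega)
        rcases Nat.eq_zero_or_pos s with rfl | h3
        · rw [hp.left]
          exact huadj _ (by omega) (by omega)
        · rcases Nat.eq_zero_or_pos (a + b - t) with h4 | h4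
          · rw [h4, hp'.left]
            exact hp.not_adj s h3 h2 j (hIJ hj) hhj.symm
              (by rintro rfl; exact hzI hj) v (hCD j hj hv)
          · obtain ⟨h5, h6, h7⟩ := hK' _ (hp'.mem _ h4 (by omega))
            refine hp.not_adj s h3 h2 _ h5 (by rintro rfl; exact h6 hh) ?_ _ h7
            have h8 := hp'.ne (a + b - t) b h4 (by omega) le_rfl
            rwa [hp'.right] at h8
      · rw [hy2 s h2, G.adj_comm, hp'.adj_iff _ _ (by omega) (by omega)]
        omega
    · rw [hy1 s (by omega), hy1 t h1]
      rcases Nat.lt_or_ge t a with h2 | h2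
      · exact hp.adj_iff s t hst h1 (Or.inr h2)
      · rcases Nat.eq_zero_or_pos s with rfl | h3
        · obtain rfl : t = a := by omega
          refine iff_of_false ?_ (by omega)
          rw [hp.left, hp.right, ← hp'.right]
          exact huadj b hb le_rfl
        · exact hp.adj_iff s t hst h1 (Or.inl h3)
  · intro t h1 h2
    rcases Nat.lt_or_ge t a with h3 | h3
    · rw [hy1 t h3.le]
      exact Or.inl (hp.mem t h1 h3)
    · rw [hy2 t h3]
      exact Or.inr (hp'.mem _ (by omega) (by omega))
  · intro s t h1 hst h2
    rcases Nat.lt_or_ge t a with h3 | h3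
    · rw [hy1 t h3.le, hy1 s (by omega)]
      exact hp.ne s t h1 hst h3
    · rw [hy2 t h3]
      rcases Nat.lt_or_ge s a with h4 | h4
      · rw [hy1 s h4.le]
        intro h5
        refine hK _ (hp.mem s h1 h4) ?_
        rw [h5]
        exact (hK' _ (hp'.mem _ (by omega) (by omega))).1
      · rw [hy2 s h4]
        exact (hp'.ne _ _ (by omega) (by omega) (by omega)).symm
  · intro t h1 h2 i hi hih hij w hw
    rcases Nat.lt_or_ge t a with h3 | h3
    · rw [hy1 t h3.le]
      exact hp.not_adj t h1 h3 i (hIJ hi) hih (by rintro rfl; exact hzI hi) w (hCD i hi hw)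
    · rw [hy2 t h3]
      exact hp'.not_adj _ (by omega) (by omega) i hi hij w hw

end SimpleGraph

/-! ### Links of a common length. -/

namespace SimpleGraph

open Finset

open scoped Classical

universe u

theorem exists_enumeration (I : Finset ℕ) :
    ∃ e : ℕ → ℕ, (∀ t < #I, e t ∈ I) ∧ ∀ s t, s < #I → t < #I → e s = e t → s = t := by
  refine ⟨fun t => if h : t < #I then I.orderEmbOfFin rfl ⟨t, h⟩ else 0, fun t ht => ?_,
    fun s t hs ht hst => ?_⟩
  · simp only [dif_pos ht]
    exact orderEmbOfFin_mem _ _ _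
  · simp only [dif_pos hs, dif_pos ht] at hst
    exact congrArg Fin.val ((I.orderEmbOfFin rfl).injective hst)

variable {W : Type u} {G : SimpleGraph W}

theorem IsLinkPath.subset {col : W → ℕ} {C C' : ℕ → Finset W} {I I' : Finset ℕ} {K K' : Set W}
    {h j ℓ : ℕ} {u v : W} {p : ℕ → W} (hp : G.IsLinkPath col C I K h j u v ℓ p) (hI : I' ⊆ I)
    (hC : ∀ i ∈ I', C' i ⊆ C i) (hK : K ⊆ K') : G.IsLinkPath col C' I' K' h j u v ℓ p where
  left := hp.left
  right := hp.right
  adj_iff := hp.adj_iff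
  mem t h0 ht := hK (hp.mem t h0 ht)
  ne := hp.ne
  not_adj t h0 ht i hi hih hij w hw := hp.not_adj t h0 ht i (hI hi) hih hij w (hC i hi hw)

/-- Any two vertices of different sets of the family are linked by a path of length `ℓ` with
interior in `K`. -/
def HasLinks (G : SimpleGraph W) (col : W → ℕ) (C : ℕ → Finset W) (I : Finset ℕ) (K : Set W)
    (ℓ : ℕ) : Prop :=
  ∀ h ∈ I, ∀ j ∈ I, h ≠ j → ∀ u ∈ C h, ∀ v ∈ C j, ∃ p, G.IsLinkPath col C I K h j u v ℓ p

theorem HasLinks.subset {col : W → ℕ} {C C' : ℕ → Finset W} {I I' : Finset ℕ} {K K' : Set W}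
    {ℓ : ℕ} (h : G.HasLinks col C I K ℓ) (hI : I' ⊆ I) (hC : ∀ i ∈ I', C' i ⊆ C i) (hK : K ⊆ K') :
    G.HasLinks col C' I' K' ℓ := fun i hi j hj hij u hu v hv => by
  obtain ⟨p, hp⟩ := h i (hI hi) j (hI hj) hij u (hC i hi hu) v (hC j hj hv)
  exact ⟨p, hp.subset hI hC hK⟩

/-- The vertices of the family whose colour does not lie in `I'`. -/
def residue (col : W → ℕ) (C : ℕ → Finset W) (I I' : Finset ℕ) : Set W :=
  {v | v ∈ C (col v) ∧ col v ∈ I ∧ col v ∉ I'}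

/-- Two access paths to `z` can be joined, but the length of the induced path obtained depends on
both ends. Hence one end is fixed: two systems of levels from `z`, with no other colour in common,
join each `u` to a single vertex `z'`, and the length now depends on `u` alone and is made constant
by pigeonhole. A third system, of levels from `z'` within the surviving sets, gives every `v` an
induced path to `z'` of fixed length, appended without shortcuts. Each system contributes at most
`k` edges. The twelve factors `q` are spent as `1 + 3 + 3 + 1 + 3 + 1`: expansion, two accesses,
expansion, access, pigeonhole. -/
theorem IsSetting.exists_hasLinks [Fintype W] {q τ δ : ℝ} {E k r m : ℕ}
    (hG : G.IsSetting q E k r m) {col : W → ℕ} {C : ℕ → Finset W} {I : Finset ℕ} {M : ℕ}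
    (hB : G.IsBlockade col C I (q ^ 12 * τ) δ) (hq : 64 * (#I : ℝ) ^ 2 * (E + 1) ≤ q)
    (hqk : 2 * ((k : ℝ) + 1) * (k + 2) ≤ q) (hδ1 : 1 ≤ δ) (hδ : δ ≤ τ) (hτ : (r * m : ℝ) ≤ τ)
    (hM : 2 ≤ M) (hI : 2 * k + (k + 1) * k * (E + 1) * ((k + 1) * k * (E + 1) *
      (k + (k + 1) * k * (E + 1) * ((3 * k + 1) * M))) ≤ #I) :
    ∃ I' ⊆ I, M ≤ #I' ∧ ∃ (C' : ℕ → Finset W) (ℓ : ℕ), 2 ≤ ℓ ∧ ℓ ≤ 3 * k ∧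
      (∀ i ∈ I', C' i ⊆ C i) ∧ G.IsBlockade col C' I' τ δ ∧
      G.HasLinks col C' I' (residue col C I I') ℓ := by
  have hk : 1 ≤ k := by
    by_contra hcon
    have h1 := hG.le_pow
    rw [show k - 1 = 0 by omega, pow_zero] at h1
    have := hG.two_le
    omega
  set A := (k + 1) * k * (E + 1) with hA
  have hA0 : 0 < A := Nat.mul_pos (Nat.mul_pos (Nat.succ_pos k) hk) (Nat.succ_pos E)
  have hk0 : (1 : ℝ) ≤ k := by exact_mod_cast hk
  have hE0 : (0 : ℝ) ≤ E := Nat.cast_nonneg _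
  have hI1 : (1 : ℝ) ≤ #I := by
    have : 1 ≤ #I := le_trans (by omega) ((Nat.le_add_right (2 * k) _).trans hI)
    exact_mod_cast this
  have hqI : (#I : ℝ) + 3 ≤ q := by nlinarith
  have hq1 : 1 ≤ q := by linarith
  have hq0 : 0 < q := by linarith
  have hτ1 : 1 ≤ τ := hδ1.trans hδ
  have hτ0 : 0 < τ := by linarith
  have hr1 : (1 : ℝ) ≤ r := by exact_mod_cast hG.one_le
  have hm0 : (0 : ℝ) ≤ m := Nat.cast_nonneg _
  have hmτ : (m : ℝ) ≤ τ := by nlinarith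
  have hpow : ∀ n : ℕ, τ ≤ q ^ n * τ := fun n => le_mul_of_one_le_left hτ0.le (one_le_pow₀ hq1)
  have hcard : ∀ J ⊆ I, 64 * (#J : ℝ) ^ 2 * (E + 1) ≤ q ∧ (#J : ℝ) + 3 ≤ q := by
    intro J hJ
    have h1 : (#J : ℝ) ≤ #I := by exact_mod_cast card_le_card hJ
    have h2 : (0 : ℝ) ≤ #J := Nat.cast_nonneg _
    have h3 : (#J : ℝ) ^ 2 ≤ (#I : ℝ) ^ 2 := pow_le_pow_left₀ h2 h1 2
    exact ⟨by nlinarith, by linarith⟩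
  -- two systems of levels
  obtain ⟨C₁, hC₁, hB₁, hE₁⟩ := hG.exists_isExpanding (τ := q ^ 11 * τ) (I := I)
    (by rwa [← mul_assoc, ← pow_succ']) (hτ.trans (hpow 11)) hqI
  obtain ⟨e, he, hinj⟩ := exists_enumeration I
  have h2k : 2 * k ≤ #I := (Nat.le_add_right _ _).trans hI
  set I₁ := I \ (range (2 * k)).image e with hI₁
  have heI₁ : ∀ t < 2 * k, e t ∉ I₁ := fun t ht h =>
    (mem_sdiff.1 h).2 (mem_image_of_mem e (mem_range.2 ht))
  have hI₁I : I₁ ⊆ I := sdiff_subset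
  have hcard₁ : A * (A * (k + A * ((3 * k + 1) * M))) ≤ #I₁ := by
    have h1 := le_card_sdiff ((range (2 * k)).image e) I
    rw [← hI₁] at h1
    have h2 := card_image_le (s := range (2 * k)) (f := e)
    rw [card_range] at h2
    omega
  obtain ⟨z, hz⟩ : (C₁ (e 0)).Nonempty := by
    rw [← card_pos]
    have h1 := hB₁.le_card (e 0) (he 0 (by omega))
    have h2 := hpow 11
    exact_mod_cast lt_of_lt_of_le hτ0 (h2.trans h1)
  have hcolz : col z = e 0 := hB₁.col_eq _ (he 0 (by omega)) z hz
  obtain ⟨I₂, hI₂, hcard₂, C₂, ℓ₁, hℓ₁0, hℓ₁, hC₂, hB₂, hacc₁⟩ := hG.exists_hasAccess (C := C₁)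
    (I := I₁) (τ := q ^ 8 * τ) (c := e) hB₁ hE₁ (fun t ht => he t (by omega))
    (fun s t hst ht h => by have := hinj s t (by omega) (by omega) h; omega) hz
    ((by rwa [← mul_assoc, ← pow_add] : G.IsBlockade col C₁ I (q ^ 3 * (q ^ 8 * τ)) δ).subset hI₁I
      (fun _ _ => subset_rfl) fun i hi => by
        rw [← mul_assoc, ← pow_add]
        exact hB₁.le_card i (hI₁I hi)) hI₁I (fun _ _ => subset_rfl)
    (fun t ht => heI₁ t (by omega)) (hcard I₁ hI₁I).1 hqk hδ1 (hδ.trans (hpow 8))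
    (hmτ.trans (hpow 8))
  -- The second system starts at the same `z`, of colour `e 0`, and otherwise uses the fresh colours
  -- `e k, …, e (2 k - 2)`.
  let c : ℕ → ℕ := fun t => if t = 0 then e 0 else e (k - 1 + t)
  have hc : ∀ t < k, ∃ s < 2 * k, c t = e s ∧ (t = 0 → s = 0) ∧ (0 < t → s = k - 1 + t) := by
    intro t ht
    rcases Nat.eq_zero_or_pos t with rfl | h0
    · exact ⟨0, by omega, rfl, fun _ => rfl, fun h => absurd h (lt_irrefl _)⟩
    · exact ⟨k - 1 + t, by omega, if_neg h0.ne', fun h => by omega, fun _ => rfl⟩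
  obtain ⟨I₃, hI₃, hcard₃, C₃, ℓ₂, hℓ₂0, hℓ₂, hC₃, hB₃, hacc₂⟩ := hG.exists_hasAccess (C := C₂)
    (I := I₂) (τ := q ^ 5 * τ) (c := c) hB₁ hE₁
    (fun t ht => by
      obtain ⟨s, hs, h, -⟩ := hc t ht
      rw [h]
      exact he s (by omega))
    (fun s t hst ht h => by
      obtain ⟨s', hs', h1, h2, h3⟩ := hc s (by omega)
      obtain ⟨t', ht', h4, h5, h6⟩ := hc t ht
      rw [h1, h4] at h
      have h7 := hinj _ _ (by omega) (by omega) h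
      have h8 := h6 (by omega)
      rcases Nat.eq_zero_or_pos s with h9 | h9
      · have := h2 h9
        omega
      · have := h3 h9
        omega) hz
    (by rwa [← mul_assoc, ← pow_add]) (hI₂.trans hI₁I) hC₂
    (fun t ht h => by
      obtain ⟨s, hs, h1, -⟩ := hc t ht
      rw [h1] at h
      exact heI₁ s hs (hI₂ h)) (hcard I₂ (hI₂.trans hI₁I)).1 hqk hδ1 (hδ.trans (hpow 5))
    (hmτ.trans (hpow 5))
  have hI₃I : I₃ ⊆ I := hI₃.trans (hI₂.trans hI₁I)
  have hC₃C₁ : ∀ i ∈ I₃, C₃ i ⊆ C₁ i := fun i hi => (hC₃ i hi).trans (hC₂ i (hI₃ hi))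
  have hcard₃' : k + A * ((3 * k + 1) * M) ≤ #I₃ := by
    have h1 := hcard₁.trans hcard₂
    have h2 := (Nat.le_of_mul_le_mul_left h1 hA0).trans hcard₃
    exact Nat.le_of_mul_le_mul_left h2 hA0
  -- a third system of levels
  obtain ⟨C₄, hC₄, hB₄, hE₄⟩ := hG.exists_isExpanding (τ := q ^ 4 * τ) (I := I₃) (C := C₃)
    (by rwa [← mul_assoc, ← pow_succ']) (hτ.trans (hpow 4)) (hcard I₃ hI₃I).2
  obtain ⟨e', he', hinj'⟩ := exists_enumeration I₃
  have hkI₃ : k ≤ #I₃ := (Nat.le_add_right _ _).trans hcard₃'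
  set I₄ := I₃ \ (range k).image e' with hI₄
  have heI₄ : ∀ t < k, e' t ∉ I₄ := fun t ht h =>
    (mem_sdiff.1 h).2 (mem_image_of_mem e' (mem_range.2 ht))
  have hI₄I : I₄ ⊆ I₃ := sdiff_subset
  have hcard₄ : A * ((3 * k + 1) * M) ≤ #I₄ := by
    have h1 := le_card_sdiff ((range k).image e') I₃
    rw [← hI₄] at h1
    have h2 := card_image_le (s := range k) (f := e')
    rw [card_range] at h2
    omega
  obtain ⟨z', hz'⟩ : (C₄ (e' 0)).Nonempty := by
    rw [← card_pos]
    have h1 := hB₄.le_card (e' 0) (he' 0 (by omega))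
    have h2 := hpow 4
    exact_mod_cast lt_of_lt_of_le hτ0 (h2.trans h1)
  have he'0 : e' 0 ∈ I₃ := he' 0 (by omega)
  have hcolz' : col z' = e' 0 := hB₄.col_eq _ he'0 z' hz'
  obtain ⟨I₅, hI₅, hcard₅, C₅, ℓ₃, hℓ₃0, hℓ₃, hC₅, hB₅, hacc₃⟩ := hG.exists_hasAccess (C := C₄)
    (I := I₄) (τ := q * τ) (c := e') hB₄ hE₄ (fun t ht => he' t (by omega))
    (fun s t hst ht h => by have := hinj' s t (by omega) (by omega) h; omega) hz'
    ((by rwa [← mul_assoc, ← pow_succ] : G.IsBlockade col C₄ I₃ (q ^ 3 * (q * τ)) δ).subset hI₄I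
      (fun _ _ => subset_rfl) fun i hi => by
        rw [← mul_assoc, ← pow_succ]
        exact hB₄.le_card i (hI₄I hi)) hI₄I (fun _ _ => subset_rfl)
    (fun t ht => heI₄ t ht) (hcard I₄ (hI₄I.trans hI₃I)).1 hqk hδ1
    (hδ.trans (by simpa using hpow 1)) (hmτ.trans (by simpa using hpow 1))
  have hI₅I₃ : I₅ ⊆ I₃ := hI₅.trans hI₄I
  have hC₅C₃ : ∀ i ∈ I₅, C₅ i ⊆ C₃ i := fun i hi =>
    (hC₅ i hi).trans (hC₄ i (hI₅I₃ hi))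
  have hcard₅' : (3 * k + 1) * M ≤ #I₅ := Nat.le_of_mul_le_mul_left (hcard₄.trans hcard₅) hA0
  -- joining the first two systems
  set K₁ : Set W := {v | v ∈ C₁ (col v) ∧ ∃ t < k, col v = e t} with hK₁
  set K₂ : Set W := {v | v ∈ C₁ (col v) ∧ ∃ t < k, col v = c t} with hK₂
  set K₃ : Set W := {v | v ∈ C₄ (col v) ∧ ∃ t < k, col v = e' t} with hK₃
  obtain ⟨p', hp'⟩ := hacc₂ (e' 0) he'0 z' (hC₄ _ he'0 hz')
  obtain ⟨ℓ₄, hℓ₄, I₆, hI₆, hcard₆, C₆, hC₆⟩ := exists_uniform_of_exists (C := C₅) (I := I₅)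
    (k := 3 * k + 1) (Nat.succ_pos _)
    (P := fun i u ℓ => 2 ≤ ℓ ∧ ℓ ≤ 2 * k ∧
      ∃ p, G.IsLinkPath col C₃ I₃ (K₁ ∪ K₂) i (col z') u z' ℓ p)
    (fun i hi u hu => by
      obtain ⟨p, hp⟩ := (hacc₁.subset hI₃ hC₃) i (hI₅I₃ hi) u (hC₅C₃ i hi hu)
      -- A second set `C₅ i'` shows that `u` and `z'` are nonadjacent: `z'` ends an access path from
      -- `C₅ i'`, so it sees nothing in `C₅ i`.
      obtain ⟨i', hi', hne⟩ := exists_mem_ne (s := I₅) (by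
        have : 1 * 2 ≤ (3 * k + 1) * M := Nat.mul_le_mul (by omega) hM
        omega) i
      obtain ⟨v, hv⟩ : (C₅ i').Nonempty := by
        rw [← card_pos]
        have h1 := hB₅.le_card i' hi'
        exact_mod_cast lt_of_lt_of_le (mul_pos hq0 hτ0) h1
      obtain ⟨p₃, hp₃⟩ := hacc₃ i' hi' v hv
      have hnot : ¬ G.Adj u z' := by
        intro hadj
        have h1 := hp₃.not_adj ℓ₃ hℓ₃0 le_rfl i hi hne.symm u hu
        rw [hp₃.right] at h1
        exact h1 hadj.symm
      obtain ⟨ℓ, hℓ, hℓ2, x, hx⟩ := hp.exists_isLinkPath hp' hℓ₁0 (fun v hv v' hv' hvv => by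
        obtain ⟨-, t, ht, h1⟩ := hv
        obtain ⟨-, s, hs, h2⟩ := hv'
        obtain ⟨s', hs', h3, h4, h5⟩ := hc s hs
        rw [h1, h2, h3] at hvv
        have h6 := hinj _ _ (by omega) (by omega) hvv
        rcases Nat.eq_zero_or_pos s with h7 | h7
        · rw [h1, h6, h4 h7, hcolz]
        · have := h5 h7
          omega) hnot
      rw [hcolz']
      exact ⟨ℓ, by omega, hℓ2, by omega, x, hx⟩)
  have hcard₆' : M ≤ #I₆ := Nat.le_of_mul_le_mul_left (hcard₅'.trans hcard₆) (Nat.succ_pos _)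
  have hI₆I₃ : I₆ ⊆ I₃ := hI₆.trans hI₅I₃
  have hcolI₃ : ∀ w ∈ K₁ ∪ K₂, col w ∉ I₃ ∧ w ∈ C₁ (col w) ∧ col w ∈ I := by
    rintro w (⟨h1, t, ht, h2⟩ | ⟨h1, t, ht, h2⟩)
    · rw [h2] at h1 ⊢
      exact ⟨fun h => heI₁ t (by omega) (hI₂ (hI₃ h)), h1, he t (by omega)⟩
    · obtain ⟨s, hs, h3, -⟩ := hc t ht
      rw [h2, h3] at h1 ⊢
      exact ⟨fun h => heI₁ s (by omega) (hI₂ (hI₃ h)), h1, he s (by omega)⟩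
  have hcolK₃ : ∀ w ∈ K₃, col w ∈ I₃ ∧ col w ∉ I₆ ∧ w ∈ C₃ (col w) := by
    rintro w ⟨h1, t, ht, h2⟩
    rw [h2] at h1 ⊢
    have h3 := he' t (by omega)
    exact ⟨h3, fun h => heI₄ t ht (hI₅ (hI₆ h)), hC₄ _ h3 h1⟩
  have hlen : 2 ≤ ℓ₄ ∧ ℓ₄ ≤ 2 * k := by
    obtain ⟨i, hi⟩ : I₆.Nonempty := card_pos.1 (by omega)
    obtain ⟨u, hu⟩ : (C₆ i).Nonempty := by
      rw [← card_pos]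
      by_contra hcon
      have h1 := (hC₆ i hi).2.1
      rw [Nat.eq_zero_of_not_pos hcon, mul_zero] at h1
      have h2 := hB₅.le_card i (hI₆ hi)
      rw [Nat.le_zero.1 h1, Nat.cast_zero] at h2
      exact absurd (mul_pos hq0 hτ0) (not_lt.2 h2)
    obtain ⟨h1, h2, -⟩ := (hC₆ i hi).2.2 u hu
    exact ⟨h1, h2⟩
  refine ⟨I₆, hI₆I₃.trans hI₃I, hcard₆', C₆, ℓ₄ + ℓ₃, by omega, by omega, fun i hi =>
    (hC₆ i hi).1.trans ((hC₅C₃ i (hI₆ hi)).trans ((hC₃C₁ i (hI₆I₃ hi)).trans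
      (hC₁ i (hI₃I (hI₆I₃ hi))))), hB₅.subset hI₆ (fun i hi => (hC₆ i hi).1) fun i hi => ?_, ?_⟩
  · have h1 := hB₅.le_card i (hI₆ hi)
    have h2 : (#(C₅ i) : ℝ) ≤ (3 * k + 1) * #(C₆ i) := by exact_mod_cast (hC₆ i hi).2.1
    have h3 : (3 * (k : ℝ) + 1) * #(C₆ i) ≤ q * #(C₆ i) :=
      mul_le_mul_of_nonneg_right (by nlinarith) (Nat.cast_nonneg _)
    exact le_of_mul_le_mul_left (h1.trans (h2.trans h3)) hq0
  · intro i hi j hj hij u hu v hv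
    obtain ⟨-, -, p, hp⟩ := (hC₆ i hi).2.2 u hu
    obtain ⟨p₃, hp₃⟩ := (hacc₃.subset hI₆ fun i hi => (hC₆ i hi).1) j hj v hv
    obtain ⟨x, hx⟩ := hp.exists_of_isAccessPath hp₃ hlen.1 hℓ₃0 hI₆I₃
      (fun i hi => (hC₆ i hi).1.trans (hC₅C₃ i (hI₆ hi))) hi hj hij hu hv
      (fun w hw => (hcolI₃ w hw).1) (fun w hw => hcolK₃ w hw)
    refine ⟨x, hx.subset subset_rfl (fun _ _ => subset_rfl) ?_⟩
    rintro w (hw | hw)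
    · obtain ⟨h1, h2, h3⟩ := hcolI₃ w hw
      exact ⟨hC₁ _ h3 h2, h3, fun h => h1 (hI₆I₃ h)⟩
    · obtain ⟨h1, h2, h3⟩ := hcolK₃ w hw
      exact ⟨hC₁ _ (hI₃I h1) (hC₃C₁ _ h1 h3), hI₃I h1, h2⟩

end SimpleGraph

/-! ### Links of prescribed length, and embedding into blockades. -/

namespace SimpleGraph

open Finset

open scoped Classical

universe u

section Lengthen

variable {W : Type u} {G : SimpleGraph W}

/-- Links can be made longer by one edge. -/
theorem IsSetting.exists_hasLinks_succ [Fintype W] {q τ δ : ℝ} {E k r m : ℕ}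
    (hG : G.IsSetting q E k r m) {col : W → ℕ} {C : ℕ → Finset W} {I : Finset ℕ} {K : Set W}
    {M ℓ : ℕ} (hB : G.IsBlockade col C I (q ^ 3 * τ) δ) (hL : G.HasLinks col C I K ℓ) (hℓ : 2 ≤ ℓ)
    (hK : ∀ w ∈ K, col w ∉ I) (hq : 64 * (#I : ℝ) ^ 2 * (E + 1) ≤ q) (hδ1 : 1 ≤ δ) (hδ : δ ≤ τ)
    (hm : (m : ℝ) ≤ τ) (hI : 1 + (E + 1) * M ≤ #I) :
    ∃ I' ⊆ I, M ≤ #I' ∧ ∃ (C' : ℕ → Finset W), (∀ i ∈ I', C' i ⊆ C i) ∧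
      G.IsBlockade col C' I' τ δ ∧ ∃ c ∈ I, c ∉ I' ∧ G.HasLinks col C' I' (K ∪ C c) (ℓ + 1) := by
  have hI0 : 0 < #I := by omega
  obtain ⟨c, hc⟩ := card_pos.1 hI0
  have hI1 : (1 : ℝ) ≤ #I := by exact_mod_cast hI0
  have hE0 : (0 : ℝ) ≤ E := Nat.cast_nonneg _
  have hq2 : 2 ≤ q := by nlinarith
  have hτ0 : 0 < τ := by linarith
  have hq21 : (1 : ℝ) ≤ q ^ 2 := one_le_pow₀ (by linarith)
  have hq3 : 2 * q ^ 2 * τ ≤ q ^ 3 * τ := by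
    rw [pow_succ' q 2]
    exact mul_le_mul_of_nonneg_right (mul_le_mul_of_nonneg_right hq2 (by linarith)) hτ0.le
  have hq2τ : τ ≤ q ^ 2 * τ := le_mul_of_one_le_left hτ0.le hq21
  have hmem : ∀ i ∈ I.erase c, i ∈ I ∧ i ≠ c := fun i hi => ⟨mem_of_mem_erase hi, ne_of_mem_erase hi⟩
  have hmc : m ≤ #(C c) := by
    have h1 := hB.le_card c hc
    have h2 : (m : ℝ) ≤ #(C c) := by linarith
    exact_mod_cast h2
  -- The set `C c` is sacrificed: `u` goes to one of its ports `y ∈ C c`, and a link continues from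
  -- `y`. Ports do not see the other sets, so no chord arises; in particular the edge that a link
  -- may have between its ends is absent for `y` and `v`.
  obtain ⟨I', hI', hIc, C', Y, hY, hC'⟩ := exists_isPorts_of_adj (G := G)
    (C := fun i => G.nbOf (C i) (C c)) (I := I.erase c) (L := C c) (M := #I) (E := E) (q := q)
    (δ := δ) (σ := q ^ 2 * τ) (card_le_card (erase_subset _ _)) (by linarith) hδ1
    (le_trans (by exact_mod_cast card_le_univ _) hG.card_le)
    (fun i _ w hw => (mem_nbOf.1 hw).2)
    (fun y hy i hi => le_trans (by exact_mod_cast card_le_card (nbIn_mono (nbOf_subset _ _) y))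
      (hB.deg_le c hc y hy i (hmem i hi).1 (hmem i hi).2)) hq
    (mul_le_mul_of_nonneg_left hδ (by linarith))
    (fun i hi => by
      have h1 := hG.links.card_lt (hB.disjoint hc (hmem i hi).1 (hmem i hi).2.symm) hmc
      have h2 : (#(C i) : ℝ) ≤ #(G.nbOf (C i) (C c)) + m := by exact_mod_cast h1.le
      have h3 := hB.le_card i (hmem i hi).1
      linarith)
  have hI'I : I' ⊆ I := hI'.trans (erase_subset _ _)
  have hC'C : ∀ i ∈ I', C' i ⊆ C i := fun i hi => (hC' i hi).1.trans (nbOf_subset _ _)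
  have hcI' : c ∉ I' := fun h => (hmem c (hI' h)).2 rfl
  refine ⟨I', hI'I, ?_, C', hC'C, hB.subset hI'I hC'C fun i hi => ?_, c, hc, hcI', ?_⟩
  · have h1 := card_erase_of_mem hc
    have h2 : (E + 1) * M ≤ (E + 1) * #I' := by omega
    exact Nat.le_of_mul_le_mul_left h2 (Nat.succ_pos E)
  · have h1 := hG.links.card_lt (hB.disjoint hc (hI'I hi) (hmem i (hI' hi)).2.symm) hmc
    have h2 : (#(C i) : ℝ) ≤ #(G.nbOf (C i) (C c)) + m := by exact_mod_cast h1.le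
    have h3 := hB.le_card i (hI'I hi)
    have h4 := (hC' i hi).2
    have h5 : q ^ 2 * τ ≤ q ^ 2 * #(C' i) := by linarith
    exact le_of_mul_le_mul_left h5 (by linarith)
  · intro i hi j hj hij u hu v hv
    obtain ⟨hYL, hYadj, hYnot⟩ := hY i hi
    obtain ⟨y, hy, hyu⟩ := hYadj u hu
    have hyc := hYL hy
    have hcoly : col y = c := hB.col_eq c hc y hyc
    have hcj : c ≠ j := by rintro rfl; exact hcI' hj
    have hci : c ≠ i := by rintro rfl; exact hcI' hi
    obtain ⟨p, hp⟩ := hL c hc j (hI'I hj) hcj y hyc v (hC'C j hj hv)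
    refine ⟨fun t => if t = 0 then u else p (t - 1), rfl, by simp [hp.right], ?_, ?_, ?_, ?_⟩
    · intro s t hst ht hexc
      obtain ⟨t, rfl⟩ := Nat.exists_eq_add_of_le' (show 1 ≤ t by omega)
      simp only [if_neg (Nat.succ_ne_zero t), Nat.add_sub_cancel]
      rcases Nat.eq_zero_or_pos s with rfl | h0
      · rw [if_pos rfl]
        rcases Nat.eq_zero_or_pos t with rfl | h1
        · rw [hp.left]
          exact iff_of_true hyu.symm rfl
        · exact iff_of_false (fun h => hp.not_adj t h1 (by omega) i (hI'I hi) hci.symm hij u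
            (hC'C i hi hu) h.symm) (by omega)
      · obtain ⟨s, rfl⟩ := Nat.exists_eq_add_of_le' h0
        simp only [if_neg (Nat.succ_ne_zero s), Nat.add_sub_cancel]
        by_cases h2 : 0 < s ∨ t < ℓ
        · rw [hp.adj_iff s t (by omega) (by omega) h2]
          omega
        · obtain ⟨rfl, rfl⟩ : s = 0 ∧ t = ℓ := by omega
          rw [hp.left, hp.right]
          exact iff_of_false (fun h => hYnot j hj hij.symm v hv y hy h) (by omega)
    · intro t h0 ht
      obtain ⟨t, rfl⟩ := Nat.exists_eq_add_of_le' h0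
      simp only [if_neg (Nat.succ_ne_zero t), Nat.add_sub_cancel]
      rcases Nat.eq_zero_or_pos t with rfl | h1
      · rw [hp.left]
        exact Or.inr hyc
      · exact Or.inl (hp.mem t h1 (by omega))
    · intro s t h0 hst ht
      obtain ⟨t, rfl⟩ := Nat.exists_eq_add_of_le' (show 1 ≤ t by omega)
      obtain ⟨s, rfl⟩ := Nat.exists_eq_add_of_le' h0
      simp only [if_neg (Nat.succ_ne_zero t), if_neg (Nat.succ_ne_zero s), Nat.add_sub_cancel]
      rcases Nat.eq_zero_or_pos s with rfl | h1
      · rw [hp.left, hcoly]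
        intro h
        exact hK _ (hp.mem t (by omega) (by omega)) (h ▸ hc)
      · exact hp.ne s t h1 (by omega) (by omega)
    · intro t h0 ht i' hi' hi'i hi'j w hw
      obtain ⟨t, rfl⟩ := Nat.exists_eq_add_of_le' h0
      simp only [if_neg (Nat.succ_ne_zero t), Nat.add_sub_cancel]
      rcases Nat.eq_zero_or_pos t with rfl | h1
      · rw [hp.left]
        exact hYnot i' hi' hi'i w hw y hy
      · exact hp.not_adj t h1 (by omega) i' (hI'I hi') (by rintro rfl; exact hcI' hi') hi'j w
          (hC'C i' hi' hw)

end Lengthen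

/-- Large blockades contain large blockades whose vertices have links of length between `a` and `ℓ`
through the rest. -/
def LinkClaim (k a ℓ : ℕ) : Prop :=
  ∃ lam : ℕ, ∀ E M : ℕ, ∃ (N : ℕ) (q₀ : ℝ), ∀ (W : Type u) [Fintype W] (G : SimpleGraph W)
    (col : W → ℕ) (C : ℕ → Finset W) (I : Finset ℕ) (q τ δ : ℝ) (r m : ℕ), q₀ ≤ q →
    G.IsSetting q E k r m → 1 ≤ δ → δ ≤ τ → (r * m : ℝ) ≤ τ →
    G.IsBlockade col C I (q ^ lam * τ) δ → N ≤ #I →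
    ∃ I' ⊆ I, M ≤ #I' ∧ ∃ (C' : ℕ → Finset W) (ℓ' : ℕ), 2 ≤ ℓ' ∧ a ≤ ℓ' ∧ ℓ' ≤ ℓ ∧
      (∀ i ∈ I', C' i ⊆ C i) ∧ G.IsBlockade col C' I' τ δ ∧
      G.HasLinks col C' I' (residue col C I I') ℓ'

theorem residue_mono {W : Type u} {col : W → ℕ} {C C' : ℕ → Finset W} {I I₀ I' I'' : Finset ℕ}
    (hI : I₀ ⊆ I) (hC : ∀ i ∈ I₀, C' i ⊆ C i) (hI' : I'' ⊆ I') :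
    residue col C' I₀ I' ⊆ residue col C I I'' := fun _ hv =>
  ⟨hC _ hv.2.1 hv.1, hI hv.2.1, fun h => hv.2.2 (hI' h)⟩

theorem linkClaim_zero {k ℓ : ℕ} (hℓ : 3 * k ≤ ℓ) : LinkClaim.{u} k 0 ℓ := by
  refine ⟨12, fun E M => ?_⟩
  set N := 2 * k + (k + 1) * k * (E + 1) * ((k + 1) * k * (E + 1) *
      (k + (k + 1) * k * (E + 1) * ((3 * k + 1) * (M + 2)))) with hN
  refine ⟨N, max (64 * (N : ℝ) ^ 2 * (E + 1)) (2 * ((k : ℝ) + 1) * (k + 2)), ?_⟩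
  intro W _ G col C I q τ δ r m hq hG hδ1 hδ hτ hB hI
  obtain ⟨I₀, hI₀, hcard⟩ := exists_subset_card_eq hI
  obtain ⟨I', hI', hM, C', ℓ', h1, h2, h3, h4, h5⟩ := hG.exists_hasLinks (M := M + 2)
    (hB.subset hI₀ (fun _ _ => subset_rfl) fun i hi => hB.le_card i (hI₀ hi))
    (by rw [hcard]; exact (le_max_left _ _).trans hq) ((le_max_right _ _).trans hq) hδ1 hδ hτ
    (by omega) (by rw [hcard])
  exact ⟨I', hI'.trans hI₀, by omega, C', ℓ', h1, Nat.zero_le _, h2.trans hℓ, h3, h4,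
    h5.subset subset_rfl (fun _ _ => subset_rfl)
      (residue_mono hI₀ (fun _ _ => subset_rfl) subset_rfl)⟩

/-- A common length above `a` needs nothing; a length equal to `a` is raised once. Passing to
exactly `N'` sets makes the bound on `q` independent of the number of sets. -/
theorem LinkClaim.succ {k a ℓ : ℕ} (h : LinkClaim.{u} k a ℓ) (ha : a < ℓ) :
    LinkClaim.{u} k (a + 1) ℓ := by
  obtain ⟨lam, h⟩ := h
  refine ⟨lam + 3, fun E M => ?_⟩
  set N' := 1 + (E + 1) * M with hN'
  obtain ⟨N, q₀, h⟩ := h E N'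
  refine ⟨N, max q₀ (64 * (N' : ℝ) ^ 2 * (E + 1)), ?_⟩
  intro W _ G col C I q τ δ r m hq hG hδ1 hδ hτ hB hI
  have hE0 : (0 : ℝ) ≤ E := Nat.cast_nonneg _
  have hN1 : (1 : ℝ) ≤ N' := by exact_mod_cast Nat.le_add_right 1 _
  have hqN := (le_max_right _ _).trans hq
  have hq1 : 1 ≤ q := by nlinarith
  have hτ0 : 0 < τ := by linarith
  have hq3 : τ ≤ q ^ 3 * τ := le_mul_of_one_le_left hτ0.le (one_le_pow₀ hq1)
  have hr1 : (1 : ℝ) ≤ r := by exact_mod_cast hG.one_le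
  have hm0 : (0 : ℝ) ≤ m := Nat.cast_nonneg _
  have hmτ : (m : ℝ) ≤ τ := by nlinarith
  rw [pow_add, mul_assoc] at hB
  obtain ⟨I', hI', hM, C', ℓ', h1, h2, h3, h4, h5, h6⟩ := h W G col C I q (q ^ 3 * τ) δ r m
    ((le_max_left _ _).trans hq) hG hδ1 (hδ.trans hq3) (hτ.trans hq3) hB hI
  obtain ⟨I₀, hI₀, hcard⟩ := exists_subset_card_eq hM
  have hB₀ := h5.subset hI₀ (fun _ _ => subset_rfl) fun i hi => h5.le_card i (hI₀ hi)
  have hL₀ : G.HasLinks col C' I₀ (residue col C I I') ℓ' :=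
    h6.subset hI₀ (fun _ _ => subset_rfl) subset_rfl
  rcases h2.eq_or_lt with rfl | h2
  · obtain ⟨I'', hI'', hM'', C'', h7, h8, c, hc, hc', h9⟩ := hG.exists_hasLinks_succ (M := M) hB₀
      hL₀ h1 (fun w hw hwI => hw.2.2 (hI₀ hwI)) (by rw [hcard]; exact hqN) hδ1 hδ hmτ
      (by rw [hcard])
    refine ⟨I'', hI''.trans (hI₀.trans hI'), hM'', C'', a + 1, by omega, le_rfl, ha,
      fun i hi => (h7 i hi).trans (h4 i (hI₀ (hI'' hi))), h8,
      h9.subset subset_rfl (fun _ _ => subset_rfl) ?_⟩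
    rintro w (hw | hw)
    · exact residue_mono subset_rfl (fun _ _ => subset_rfl) (hI''.trans hI₀) hw
    · have h10 := h5.col_eq c (hI₀ hc) w hw
      refine ⟨?_, ?_, ?_⟩ <;> rw [h10]
      · exact h4 c (hI₀ hc) hw
      · exact hI' (hI₀ hc)
      · exact hc'
  · have h7 : M ≤ N' := by rw [hN']; nlinarith
    exact ⟨I₀, hI₀.trans hI', by omega, C', ℓ', h1, h2, h3, fun i hi => h4 i (hI₀ hi),
      hB₀.subset subset_rfl (fun _ _ => subset_rfl) fun i hi => hq3.trans (hB₀.le_card i hi),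
      hL₀.subset subset_rfl (fun _ _ => subset_rfl)
        (residue_mono subset_rfl (fun _ _ => subset_rfl) hI₀)⟩

theorem linkClaim_self {k ℓ : ℕ} (hℓ : 3 * k ≤ ℓ) : LinkClaim.{u} k ℓ ℓ := by
  have h : ∀ a ≤ ℓ, LinkClaim.{u} k a ℓ := by
    intro a
    induction a with
    | zero => exact fun _ => linkClaim_zero hℓ
    | succ a ih => exact fun ha => (ih (by omega)).succ ha
  exact h ℓ le_rfl

variable {V : Type*} {H : SimpleGraph V}

/-- Large blockades contain induced copies of the subgraph of `H` induced on `S`, with vertices of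
different colours. -/
def BlockadeClaim (k : ℕ) (H : SimpleGraph V) (S : Finset V) : Prop :=
  ∃ lam : ℕ, ∀ E : ℕ, ∃ (N : ℕ) (q₀ : ℝ), ∀ (W : Type u) [Fintype W] (G : SimpleGraph W)
    (col : W → ℕ) (C : ℕ → Finset W) (I : Finset ℕ) (q τ δ : ℝ) (r m : ℕ), q₀ ≤ q →
    G.IsSetting q E k r m → 1 ≤ δ → δ ≤ τ → (r * m : ℝ) ≤ τ →
    G.IsBlockade col C I (q ^ lam * τ) δ → N ≤ #I →
    ∃ φ : V → W, IsCopyOn G H S φ ∧ (∀ v ∈ S, col (φ v) ∈ I ∧ φ v ∈ C (col (φ v))) ∧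
      ∀ u ∈ S, ∀ v ∈ S, col (φ u) = col (φ v) → u = v

theorem BlockadeClaim.two (k : ℕ) {a b : V} (hab : a ≠ b) (h : ¬ H.Adj a b) :
    BlockadeClaim.{u} k H {a, b} := by
  refine ⟨1, fun E => ⟨2, 2, ?_⟩⟩
  intro W _ G col C I q τ δ r m hq hG hδ1 hδ hτ hB hI
  obtain ⟨i, hi, j, hj, hij⟩ := one_lt_card.1 hI
  rw [pow_one] at hB
  have hlt : δ < q * τ := by nlinarith
  obtain ⟨v, hv⟩ : (C i).Nonempty := by
    rw [← card_pos]
    exact_mod_cast lt_of_lt_of_le (by linarith : 0 < q * τ) (hB.le_card i hi)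
  obtain ⟨w, hw, hwv⟩ : ∃ w ∈ C j, w ∉ G.nbIn (C j) v := by
    refine exists_mem_notMem_of_card_lt_card ?_
    have h1 := hB.deg_le i hi v hv j hj hij.symm
    have h2 := hB.le_card j hj
    exact_mod_cast (show (#(G.nbIn (C j) v) : ℝ) < #(C j) by linarith)
  have hvw : ¬ G.Adj v w := fun h => hwv (mem_nbIn.2 ⟨hw, h⟩)
  have hcv := hB.col_eq i hi v hv
  have hcw := hB.col_eq j hj w hw
  have hne : v ≠ w := by
    rintro rfl
    exact hij (hcv.symm.trans hcw)
  refine ⟨fun x => if x = a then v else w, ⟨?_, ?_⟩, ?_, ?_⟩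
  · simp [hab, hab.symm, hne, hne.symm]
  · have hba : ¬ H.Adj b a := fun h' => h h'.symm
    have hwv' : ¬ G.Adj w v := fun h' => hvw h'.symm
    simp [hab.symm, h, hba, hvw, hwv']
  · simp [hab.symm, hcv, hcw, hi, hj, hv, hw]
  · simp [hab, hab.symm, hcv, hcw, hij, hij.symm]

/-- The links come before the copy. They run through colours outside a surviving family and have
length exactly `ℓ`; the copy of the part on `S` is then found inside that family, and the link
between its two ends is seen by no other vertex of the copy. Whether the ends of the link are
adjacent is settled by the copy itself. -/
theorem BlockadeClaim.handle {k : ℕ} {S : Finset V} {ℓ : ℕ} {p : ℕ → V}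
    (hS : BlockadeClaim.{u} k H S) (hp : H.IsAttachedPath S ℓ p) (hℓ : 3 * k ≤ ℓ) :
    BlockadeClaim.{u} k H (S ∪ (Ioo 0 ℓ).image p) := by
  obtain ⟨lam, hS⟩ := hS
  obtain ⟨lam', hL⟩ := linkClaim_self.{u} hℓ
  refine ⟨lam' + lam, fun E => ?_⟩
  obtain ⟨N, q₀, hS⟩ := hS E
  obtain ⟨N', q₀', hL⟩ := hL E N
  refine ⟨N', max 1 (max q₀ q₀'), ?_⟩
  intro W _ G col C I q τ δ r m hq hG hδ1 hδ hτ hB hI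
  have hq1 : 1 ≤ q := (le_max_left _ _).trans hq
  have hq2 := (le_max_right _ _).trans hq
  have hτ0 : 0 < τ := by linarith
  have hqτ : τ ≤ q ^ lam * τ := le_mul_of_one_le_left hτ0.le (one_le_pow₀ hq1)
  rw [pow_add, mul_assoc] at hB
  obtain ⟨I', hI', hM, C', ℓ', hℓ2, h1, h2, hC', hB', hlink⟩ := hL W G col C I q (q ^ lam * τ) δ r m
    ((le_max_right _ _).trans hq2) hG hδ1 (hδ.trans hqτ) (hτ.trans hqτ) hB hI
  obtain rfl := le_antisymm h1 h2
  obtain ⟨φ, hφ, hφC, hφinj⟩ := hS W G col C' I' q τ δ r m ((le_max_left _ _).trans hq2) hG hδ1 hδ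
    hτ hB' hM
  have hne0 : p 0 ≠ p ℓ := fun h => by
    have := hp.inj 0 (by omega) ℓ le_rfl h
    omega
  obtain ⟨hc0, hm0⟩ := hφC _ hp.left_mem
  obtain ⟨hcl, hml⟩ := hφC _ hp.right_mem
  obtain ⟨z, hz⟩ := hlink _ hc0 _ hcl
    (fun h => hne0 (hφinj _ hp.left_mem _ hp.right_mem h)) _ hm0 _ hml
  let ψ : V → W := fun v => if h : ∃ i, 0 < i ∧ i < ℓ ∧ p i = v then z h.choose else φ v
  have hψS : ∀ v ∈ S, ψ v = φ v := fun v hv => dif_neg fun ⟨i, h0, hi, h⟩ =>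
    hp.notMem i h0 hi (h ▸ hv)
  have hψp : ∀ i, 0 < i → i < ℓ → ψ (p i) = z i := by
    intro i h0 hi
    have hex : ∃ j, 0 < j ∧ j < ℓ ∧ p j = p i := ⟨i, h0, hi, rfl⟩
    have h3 : hex.choose = i :=
      hp.inj _ hex.choose_spec.2.1.le _ hi.le hex.choose_spec.2.2
    change (if h : ∃ j, 0 < j ∧ j < ℓ ∧ p j = p i then z h.choose else φ (p i)) = z i
    rw [dif_pos hex, h3]
  have hzcol : ∀ i, 0 < i → i < ℓ → ∀ v ∈ S, col (z i) ≠ col (φ v) := fun i h0 hi v hv h =>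
    (hz.mem i h0 hi).2.2 (h ▸ (hφC v hv).1)
  refine ⟨ψ, hφ.handle hp hψS hψp (fun i h0 hi v hv h => hzcol i h0 hi v hv (congrArg col h)) ?_ ?_,
    ?_, ?_⟩
  · intro i h0 hi v hv
    by_cases hv0 : v = p 0
    · subst hv0
      rw [G.adj_comm, ← hz.left, hz.adj_iff 0 i h0 hi.le (Or.inr hi)]
      constructor
      · exact fun h => Or.inl ⟨by omega, rfl⟩
      · rintro (⟨h, -⟩ | ⟨-, h⟩)
        · omega
        · exact absurd h hne0
    by_cases hvl : v = p ℓ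
    · subst hvl
      rw [← hz.right, hz.adj_iff i ℓ hi le_rfl (Or.inl h0)]
      constructor
      · exact fun h => Or.inr ⟨h, rfl⟩
      · rintro (⟨-, h⟩ | ⟨h, -⟩)
        · exact absurd h.symm hne0
        · exact h
    · refine iff_of_false (hz.not_adj i h0 hi _ (hφC v hv).1
        (fun h => hv0 (hφinj v hv _ hp.left_mem h))
        (fun h => hvl (hφinj v hv _ hp.right_mem h)) _ (hφC v hv).2) ?_
      rintro (⟨-, h⟩ | ⟨-, h⟩)
      · exact hv0 h
      · exact hvl h
  · intro i j h0 hij hj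
    exact ⟨fun h => hz.ne i j h0 hij hj (congrArg col h),
      hz.adj_iff i j hij hj.le (Or.inl h0)⟩
  · intro v hv
    rcases mem_union.1 hv with hv | hv
    · rw [hψS v hv]
      obtain ⟨h3, h4⟩ := hφC v hv
      exact ⟨hI' h3, hC' _ h3 h4⟩
    · obtain ⟨i, hi, rfl⟩ := mem_image.1 hv
      rw [mem_Ioo] at hi
      rw [hψp i hi.1 hi.2]
      obtain ⟨h3, h4, -⟩ := hz.mem i hi.1 hi.2
      exact ⟨h4, h3⟩
  · intro u hu v hv huv
    rcases mem_union.1 hu with hu | hu <;> rcases mem_union.1 hv with hv | hv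
    · rw [hψS u hu, hψS v hv] at huv
      exact hφinj u hu v hv huv
    · obtain ⟨i, hi, rfl⟩ := mem_image.1 hv
      rw [mem_Ioo] at hi
      rw [hψS u hu, hψp i hi.1 hi.2] at huv
      exact absurd huv.symm (hzcol i hi.1 hi.2 u hu)
    · obtain ⟨i, hi, rfl⟩ := mem_image.1 hu
      rw [mem_Ioo] at hi
      rw [hψS v hv, hψp i hi.1 hi.2] at huv
      exact absurd huv (hzcol i hi.1 hi.2 v hv)
    · obtain ⟨i, hi, rfl⟩ := mem_image.1 hu
      obtain ⟨j, hj, rfl⟩ := mem_image.1 hv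
      rw [mem_Ioo] at hi hj
      rw [hψp i hi.1 hi.2, hψp j hj.1 hj.2] at huv
      rcases lt_trichotomy i j with h | rfl | h
      · exact absurd huv (hz.ne i j hi.1 h hj.2)
      · rfl
      · exact absurd huv.symm (hz.ne j i hj.1 h hi.2)

theorem SetBuildable.blockadeClaim {β k : ℕ} (hk : 3 * k ≤ β) {S : Finset V}
    (h : H.SetBuildable β S) : BlockadeClaim.{u} k H S := by
  induction h with
  | two a b hab h => convert BlockadeClaim.two k hab h
  | handle S ℓ p hS hℓ hp ih => convert ih.handle hp (hk.trans hℓ)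

end SimpleGraph

/-! ### From failing density to blockades. -/

namespace SimpleGraph

open Finset

open scoped Classical

universe u

/-- Discarding an element of largest value does not raise the average. -/
theorem exists_subset_card_eq_sum_le {ι : Type*} {s : ℕ} (hs : 0 < s) {c : ℝ} (f : ι → ℝ)
    (A : Finset ι) (hA : s ≤ #A) (h : ∑ a ∈ A, f a ≤ c * #A) :
    ∃ A' ⊆ A, #A' = s ∧ ∑ a ∈ A', f a ≤ c * s := by
  obtain ⟨d, hd⟩ := Nat.exists_eq_add_of_le hA
  induction d generalizing A with
  | zero => exact ⟨A, subset_rfl, hd, by rwa [hd] at h⟩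
  | succ d ih =>
    obtain ⟨a, ha, hmax⟩ := exists_max_image A f (card_pos.1 (by omega))
    have hcard := card_erase_of_mem ha
    have h1 : ∑ b ∈ A, f b ≤ #A * f a := by
      rw [← nsmul_eq_mul]
      exact sum_le_card_nsmul _ _ _ hmax
    have h2 := add_sum_erase A f ha
    have hA0 : (0 : ℝ) < #A := by exact_mod_cast (show 0 < #A by omega)
    have h3 : (#(A.erase a) : ℝ) = #A - 1 := by
      rw [hcard, Nat.cast_sub (by omega), Nat.cast_one]
    have hA1 : (1 : ℝ) ≤ #A := by exact_mod_cast (show 1 ≤ #A by omega)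
    obtain ⟨A', hA', h4⟩ := ih (A.erase a) (by omega) (by
      rw [h3]
      by_cases hc : c ≤ f a
      · linarith
      · push Not at hc
        have h5 : ∑ b ∈ A.erase a, f b ≤ #(A.erase a) * c := by
          rw [← nsmul_eq_mul]
          exact sum_le_card_nsmul _ _ _ fun b hb => (hmax b (mem_of_mem_erase hb)).trans hc.le
        rw [h3] at h5
        linarith) (by omega)
    exact ⟨A', hA'.trans (erase_subset _ _), h4⟩

variable {W : Type u} {G : SimpleGraph W}

/-- In a graph that is not dense there is a small set with few neighbours in the vertices of a
large set. -/
theorem exists_sparse_pair_of_not_isDense {U : Finset W} {x η : ℝ} {t : ℕ} (hx0 : 0 < x)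
    (hxη : 4 * x ^ t ≤ η) (hdeg : ∀ v ∈ U, (#(G.nbIn U v) : ℝ) ≤ η * #U)
    (h1 : 1 ≤ x ^ t * #U) (h : ¬ G.IsDense U x t η) :
    ∃ A ⊆ U, ∃ U' ⊆ U, Disjoint A U' ∧ x ^ t * #U ≤ #A ∧ (#A : ℝ) ≤ 2 * (x ^ t * #U) ∧
      η / 4 * #U ≤ #U' ∧ ∀ v ∈ U', (#(G.nbIn A v) : ℝ) ≤ 4 * x * #A := by
  have hex : ∃ A ⊆ U, ∃ B ⊆ U, x ^ t * #U ≤ #A ∧ η * #U ≤ #B ∧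
      ((∑ b ∈ B, #(G.nbIn A b) : ℕ) : ℝ) < x * #A * #B := by
    by_contra! hcon
    exact h ⟨hdeg, fun A hA B hB => hcon A hA B hB, h1⟩
  obtain ⟨A, hA, B, hB, hAc, hBc, hAB⟩ := hex
  have hU0 : (0 : ℝ) ≤ #U := Nat.cast_nonneg _
  -- `A` is cut down to the least admissible size while its average stays low, so that its size is
  -- known up to a factor two.
  set s := ⌈x ^ t * #U⌉₊ with hs
  have hs1 : 1 ≤ s := Nat.one_le_ceil_iff.2 (by linarith)
  have hsle : x ^ t * #U ≤ s := Nat.le_ceil _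
  have hslt : (s : ℝ) < x ^ t * #U + 1 := Nat.ceil_lt_add_one (by linarith)
  rw [sum_card_nbIn_comm] at hAB
  push_cast at hAB
  obtain ⟨A', hA', hA's, hsum⟩ := exists_subset_card_eq_sum_le (s := s) hs1 (c := x * #B)
    (fun a => (#(G.nbIn B a) : ℝ)) A (Nat.ceil_le.2 hAc) (by linarith)
  rw [← hA's] at hsum hsle hslt
  have hA'0 : (0 : ℝ) < #A' := by linarith
  have hB0 : (0 : ℝ) ≤ #B := Nat.cast_nonneg _
  have hsum' : ∑ b ∈ B, (#(G.nbIn A' b) : ℝ) ≤ x * #A' * #B := by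
    have h2 : ∑ b ∈ B, (#(G.nbIn A' b) : ℝ) = ∑ a ∈ A', (#(G.nbIn B a) : ℝ) := by
      exact_mod_cast sum_card_nbIn_comm A' B
    rw [h2]
    linarith
  set Bad := B.filter fun b => 4 * x * #A' ≤ (#(G.nbIn A' b) : ℝ) with hBad
  have hbad : 4 * x * #A' * #Bad ≤ x * #A' * #B := by
    refine le_trans ?_ hsum'
    exact mul_card_filter_le_le_sum B (fun b => (#(G.nbIn A' b) : ℝ))
      (fun _ _ => Nat.cast_nonneg _) _
  have hbad' : 4 * (#Bad : ℝ) ≤ #B := by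
    have h2 : 0 < x * #A' := mul_pos hx0 hA'0
    refine le_of_mul_le_mul_left ?_ h2
    linarith
  refine ⟨A', hA'.trans hA, (B \ Bad) \ A', (sdiff_subset.trans sdiff_subset).trans hB,
    disjoint_sdiff, hsle, by linarith, ?_, fun v hv => ?_⟩
  · have h2 : #B ≤ #((B \ Bad) \ A') + #Bad + #A' := by
      have h3 := le_card_sdiff Bad B
      have h4 := le_card_sdiff A' (B \ Bad)
      omega
    have h3 : (#B : ℝ) ≤ #((B \ Bad) \ A') + #Bad + #A' := by exact_mod_cast h2
    have h4 : 4 * x ^ t * #U ≤ η * #U := mul_le_mul_of_nonneg_right hxη hU0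
    linarith
  · obtain ⟨hv1, -⟩ := mem_sdiff.1 hv
    obtain ⟨hv2, hv3⟩ := mem_sdiff.1 hv1
    by_contra! hcon
    exact hv3 (mem_filter.2 ⟨hv2, hcon.le⟩)

variable {V : Type*} [Fintype V] {H : SimpleGraph V}

/-- Sparse graphs without an induced copy of `H` contain blockades with sparse pairs. -/
theorem DenseClaim.exists_blockade (hH : DenseClaim.{u} H univ) :
    ∃ (t : ℕ) (x₁ : ℝ), 0 < x₁ ∧ ∀ N : ℕ, ∃ ε κ : ℝ, 0 < ε ∧ 0 < κ ∧
      ∀ (W : Type u) [Fintype W] (G : SimpleGraph W) (x : ℝ), 0 < x → x ≤ x₁ →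
      (∀ v, (#(G.nbIn univ v) : ℝ) ≤ ε * Fintype.card W) → 1 ≤ κ * (x ^ t * Fintype.card W) →
      ¬ H.IsIndContained G → ∃ C : ℕ → Finset W, (∀ i j, i < j → j < N → Disjoint (C i) (C j)) ∧
      (∀ i < N, κ * (x ^ t * Fintype.card W) ≤ #(C i)) ∧
      ∀ i < N, ∀ j < N, j ≠ i → ∀ v ∈ C i,
        (#(G.nbIn (C j) v) : ℝ) ≤ 16 * N * (x ^ (t + 1) * Fintype.card W) := by
  obtain ⟨a, t, η, x₀, hη0, hx₀0, hH⟩ := hH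
  set η' := min η 1 with hη'
  have hη'0 : 0 < η' := lt_min hη0 one_pos
  have hη'1 : η' ≤ 1 := min_le_right _ _
  -- The exponent `t + 1` instead of `t` guarantees `4 x ^ (t + 1) ≤ η'`, needed to split off a
  -- sparse pair.
  refine ⟨t + 1, min x₀ (η' / 4), lt_min hx₀0 (by linarith), fun N => ?_⟩
  set θ := η' / 4 with hθ
  have hθ0 : 0 < θ := by linarith
  have hθ1 : θ ≤ 1 := by linarith
  refine ⟨η' * θ ^ N, θ ^ N / 2, mul_pos hη'0 (pow_pos hθ0 _), by positivity, ?_⟩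
  intro W _ G x hx0 hx hdeg h1 hfree
  have hx1 : x ≤ θ := hx.trans (min_le_right _ _)
  have hxle1 : x ≤ 1 := hx1.trans hθ1
  set n : ℝ := (Fintype.card W : ℝ) with hn
  have hn0 : 0 ≤ n := Nat.cast_nonneg _
  have hxt0 : 0 < x ^ (t + 1) := pow_pos hx0 _
  have hxt : 4 * x ^ (t + 1) ≤ η' := by
    rw [pow_succ]
    have h2 : x ^ t ≤ 1 := pow_le_one₀ hx0.le hxle1
    nlinarith
  -- Each failure of density splits a set `A i` off the current `U` and keeps at least a proportion
  -- `θ` of `U`, whose vertices have few neighbours in `A i`. All later sets lie there.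
  have key : ∀ k ≤ N, ∃ (A : ℕ → Finset W) (U : Finset W), θ ^ k * n ≤ #U ∧
      (∀ i < k, Disjoint (A i) U ∧ θ ^ i * (x ^ (t + 1) * n) ≤ #(A i) ∧
        (#(A i) : ℝ) ≤ 2 * (x ^ (t + 1) * n) ∧ ∀ v ∈ U, (#(G.nbIn (A i) v) : ℝ) ≤ 4 * x * #(A i)) ∧
      ∀ i j, i < j → j < k → Disjoint (A i) (A j) ∧
        ∀ v ∈ A j, (#(G.nbIn (A i) v) : ℝ) ≤ 4 * x * #(A i) := by
    intro k
    induction k with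
    | zero =>
      intro _
      refine ⟨fun _ => ∅, univ, ?_, fun i hi => absurd hi (Nat.not_lt_zero _),
        fun i j _ hj => absurd hj (Nat.not_lt_zero _)⟩
      rw [pow_zero, one_mul, card_univ]
    | succ k ih =>
      intro hk
      obtain ⟨A, U, hU, hAU, hAA⟩ := ih (by omega)
      have hθk : θ ^ N ≤ θ ^ k := pow_le_pow_of_le_one hθ0.le hθ1 (by omega)
      have hUN : θ ^ N * n ≤ #U := (mul_le_mul_of_nonneg_right hθk hn0).trans hU
      have hUn : (#U : ℝ) ≤ n := by
        rw [hn]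
        exact_mod_cast card_le_univ U
      have hone : 1 ≤ x ^ (t + 1) * #U := by
        have h2 := mul_le_mul_of_nonneg_left hUN hxt0.le
        have h3 : 0 ≤ x ^ (t + 1) * (θ ^ N * n) := by positivity
        nlinarith
      have hnd : ¬ G.IsDense U x (t + 1) η' := by
        intro hd
        have h2 := hH W G U x hx0 (hx.trans (min_le_left _ _))
          (hd.mono hx0 hxle1 (Nat.le_succ t) (min_le_left _ _))
        have h3 : 0 < x ^ a * (#U : ℝ) ^ Fintype.card V :=
          mul_pos (pow_pos hx0 _) (pow_pos (hd.card_pos hx0) _)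
        have h4 : 0 < #(copies G H univ U) := by exact_mod_cast h3.trans_le h2
        obtain ⟨φ, hφ⟩ := Finset.card_pos.1 h4
        exact hfree (IsCopyOn.isIndContained (mem_filter.1 hφ).2)
      obtain ⟨B, hB, U', hU', hBU, hB1, hB2, hU'c, hU'B⟩ := exists_sparse_pair_of_not_isDense hx0
        hxt (fun v _ => by
          have h2 : (#(G.nbIn U v) : ℝ) ≤ #(G.nbIn univ v) := by
            exact_mod_cast card_le_card (nbIn_mono (subset_univ _) v)
          have h3 := mul_le_mul_of_nonneg_left hUN hη'0.le
          linarith [hdeg v]) hone hnd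
      have hA : ∀ i < k, Function.update A k B i = A i := fun i hi =>
        Function.update_of_ne hi.ne _ _
      refine ⟨Function.update A k B, U', ?_, fun i hi => ?_, fun i j hij hj => ?_⟩
      · rw [pow_succ]
        rw [← hθ] at hU'c
        have h2 := mul_le_mul_of_nonneg_left hU hθ0.le
        linarith
      · rcases (Nat.lt_succ_iff.1 hi).eq_or_lt with rfl | hi
        · rw [Function.update_self]
          refine ⟨hBU, ?_, ?_, hU'B⟩
          · have h2 := mul_le_mul_of_nonneg_left hU hxt0.le
            linarith
          · have h2 := mul_le_mul_of_nonneg_left hUn hxt0.le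
            linarith
        · rw [hA i hi]
          obtain ⟨h2, h3, h4, h5⟩ := hAU i hi
          exact ⟨h2.mono_right hU', h3, h4, fun v hv => h5 v (hU' hv)⟩
      · rcases (Nat.lt_succ_iff.1 hj).eq_or_lt with rfl | hj
        · rw [Function.update_self, hA i hij]
          obtain ⟨h2, -, -, h5⟩ := hAU i hij
          exact ⟨h2.mono_right hB, fun v hv => h5 v (hB hv)⟩
        · rw [hA i (hij.trans hj), hA j hj]
          exact hAA i j hij hj
  obtain ⟨A, U, -, hA, hAA⟩ := key N le_rfl
  rcases Nat.eq_zero_or_pos N with rfl | hN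
  · exact ⟨A, fun i j _ hj => absurd hj (Nat.not_lt_zero _), fun i hi => absurd hi (Nat.not_lt_zero _),
      fun i hi => absurd hi (Nat.not_lt_zero _)⟩
  have hN1 : (1 : ℝ) ≤ N := by exact_mod_cast hN
  -- the vertices of `A i` with many neighbours in `A j`
  let Bad : ℕ → ℕ → Finset W := fun i j =>
    (A i).filter fun v => 8 * N * x * #(A j) ≤ (#(G.nbIn (A j) v) : ℝ)
  -- From earlier to later sets the degree bound holds only on average. For each later `j`, at most
  -- a proportion `1 / (2 N)` of `A i` breaks it, so deleting all of these leaves at least half.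
  have hBad : ∀ i j, i < j → j < N → 2 * (N : ℝ) * #(Bad i j) ≤ #(A i) := by
    intro i j hij hj
    have h2 := mul_card_filter_le_le_sum (A i) (fun v => (#(G.nbIn (A j) v) : ℝ))
      (fun _ _ => Nat.cast_nonneg _) (8 * N * x * #(A j))
    have h3 : ∑ v ∈ A i, (#(G.nbIn (A j) v) : ℝ) = ∑ w ∈ A j, (#(G.nbIn (A i) w) : ℝ) := by
      exact_mod_cast sum_card_nbIn_comm (A j) (A i)
    have h4 : ∑ w ∈ A j, (#(G.nbIn (A i) w) : ℝ) ≤ #(A j) * (4 * x * #(A i)) := by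
      rw [← nsmul_eq_mul]
      exact sum_le_card_nsmul _ _ _ (hAA i j hij hj).2
    have h5 : 0 < (#(A j) : ℝ) := by
      refine lt_of_lt_of_le ?_ (hA j hj).2.1
      have h6 : 0 < x ^ (t + 1) * n := by
        by_contra! h7
        have : θ ^ N / 2 * (x ^ (t + 1) * n) ≤ 0 := mul_nonpos_of_nonneg_of_nonpos (by positivity) h7
        linarith
      exact mul_pos (pow_pos hθ0 _) h6
    have h6 : 0 < 4 * x * #(A j) := by positivity
    refine le_of_mul_le_mul_left ?_ h6
    change 8 * N * x * #(A j) * #(Bad i j) ≤ _ at h2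
    linarith
  let C : ℕ → Finset W := fun i => A i \ (Ioo i N).biUnion (Bad i)
  have hCA : ∀ i, C i ⊆ A i := fun i => sdiff_subset
  refine ⟨C, fun i j hij hj => ((hAA i j hij hj).1).mono (hCA i) (hCA j), fun i hi => ?_, ?_⟩
  · have h2 : #(A i) ≤ #(C i) + ∑ j ∈ Ioo i N, #(Bad i j) := by
      have h3 := le_card_sdiff ((Ioo i N).biUnion (Bad i)) (A i)
      have h4 : #((Ioo i N).biUnion (Bad i)) ≤ ∑ j ∈ Ioo i N, #(Bad i j) := card_biUnion_le
      change _ ≤ #(C i) at h3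
      omega
    have h3 : 2 * (N : ℝ) * ∑ j ∈ Ioo i N, (#(Bad i j) : ℝ) ≤ N * #(A i) := by
      rw [mul_sum]
      calc ∑ j ∈ Ioo i N, 2 * (N : ℝ) * #(Bad i j) ≤ ∑ j ∈ Ioo i N, (#(A i) : ℝ) :=
            sum_le_sum fun j hj => hBad i j (mem_Ioo.1 hj).1 (mem_Ioo.1 hj).2
        _ = (#(Ioo i N) : ℝ) * #(A i) := by rw [sum_const, nsmul_eq_mul]
        _ ≤ N * #(A i) := by
          refine mul_le_mul_of_nonneg_right ?_ (Nat.cast_nonneg _)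
          rw [Nat.card_Ioo]
          exact_mod_cast (by omega : N - i - 1 ≤ N)
    have h4 : 2 * ∑ j ∈ Ioo i N, (#(Bad i j) : ℝ) ≤ #(A i) := by
      refine le_of_mul_le_mul_left ?_ (show (0 : ℝ) < N by linarith)
      linarith
    have h5 : (#(A i) : ℝ) ≤ #(C i) + ∑ j ∈ Ioo i N, (#(Bad i j) : ℝ) := by exact_mod_cast h2
    have h6 := (hA i hi).2.1
    have h7 : θ ^ N * (x ^ (t + 1) * n) ≤ θ ^ i * (x ^ (t + 1) * n) :=
      mul_le_mul_of_nonneg_right (pow_le_pow_of_le_one hθ0.le hθ1 hi.le)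
        (mul_nonneg hxt0.le hn0)
    linarith
  · intro i hi j hj hji v hv
    have h2 : (#(G.nbIn (C j) v) : ℝ) ≤ #(G.nbIn (A j) v) := by
      exact_mod_cast card_le_card (nbIn_mono (hCA j) v)
    have h3 : (#(G.nbIn (A j) v) : ℝ) ≤ 8 * N * x * #(A j) := by
      rcases lt_or_gt_of_ne hji with h4 | h4
      · refine ((hAA j i h4 hi).2 v (hCA i hv)).trans ?_
        have h5 : 0 ≤ x * #(A j) := mul_nonneg hx0.le (Nat.cast_nonneg _)
        nlinarith
      · by_contra! hcon
        exact (mem_sdiff.1 hv).2 (mem_biUnion.2 ⟨j, mem_Ioo.2 ⟨h4, hj⟩,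
          mem_filter.2 ⟨hCA i hv, hcon.le⟩⟩)
    have h4 := mul_le_mul_of_nonneg_left (hA j hj).2.2.1
      (show 0 ≤ 8 * N * x by positivity)
    calc (#(G.nbIn (C j) v) : ℝ) ≤ 8 * N * x * #(A j) := h2.trans h3
      _ ≤ 8 * N * x * (2 * (x ^ (t + 1) * n)) := h4
      _ = _ := by ring

end SimpleGraph

/-! ### Choice of the exponents, and conclusion. -/

namespace SimpleGraph

open Finset

open scoped Classical

universe u

/-- In base `q`, `E` is the exponent of `n`, while `μ` and `ρ` are those of the bounds for `m` and
`r`; `L` is the loss in passing to the blockade. With `μ ≤ E (1 - c) + 2` and `ρ = E - L - μ`, the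
condition `μ ≤ (k - 1) ρ` follows from `E (k c - 1) ≥ 2 k + (k - 1) L`, which holds for large `E`
because `k c > 1`. -/
theorem exists_exponents {k : ℕ} {c : ℝ} (hkc : 1 < k * c) (hc : c ≤ 1) (L : ℕ) :
    ∃ E μ ρ : ℕ, (E : ℝ) * (1 - c) + 1 ≤ μ ∧ E = L + μ + ρ ∧ μ ≤ (k - 1) * ρ := by
  have hk1 : (1 : ℝ) < k := by
    have : (0 : ℝ) ≤ k := Nat.cast_nonneg _
    nlinarith
  have hk2 : 2 ≤ k := by exact_mod_cast hk1
  set E := ⌈(2 * k + k * L : ℝ) / (k * c - 1)⌉₊ with hE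
  set μ := ⌈(E : ℝ) * (1 - c)⌉₊ + 1 with hμ
  have hE1 : (2 * k + k * L : ℝ) ≤ E * (k * c - 1) := by
    rw [← div_le_iff₀ (by linarith)]
    exact Nat.le_ceil _
  have hE0 : (0 : ℝ) ≤ E := Nat.cast_nonneg _
  have hμ1 : (E : ℝ) * (1 - c) + 1 ≤ μ := by
    rw [hμ]
    push_cast
    linarith [Nat.le_ceil ((E : ℝ) * (1 - c))]
  have hμ2 : (μ : ℝ) ≤ E * (1 - c) + 2 := by
    rw [hμ]
    push_cast
    linarith [Nat.ceil_lt_add_one (mul_nonneg hE0 (show (0 : ℝ) ≤ 1 - c by linarith))]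
  have hμ0 : (0 : ℝ) ≤ μ := Nat.cast_nonneg _
  have hL0 : (0 : ℝ) ≤ L := Nat.cast_nonneg _
  have hmain : (μ : ℝ) ≤ (k - 1) * (E - L - μ) := by nlinarith
  have hle : (L : ℝ) + μ ≤ E := by
    by_contra! hcon
    have : ((k : ℝ) - 1) * (E - L - μ) < 0 := mul_neg_of_pos_of_neg (by linarith) (by linarith)
    linarith
  have hle' : L + μ ≤ E := by exact_mod_cast hle
  refine ⟨E, μ, E - (L + μ), hμ1, by omega, ?_⟩
  have h1 : ((μ : ℕ) : ℝ) ≤ ((k - 1 : ℕ) : ℝ) * ((E - (L + μ) : ℕ) : ℝ) := by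
    rw [Nat.cast_sub (by omega), Nat.cast_sub hle']
    push_cast
    linarith
  exact_mod_cast h1

variable {V : Type*} [Fintype V] {H : SimpleGraph V}

theorem IsCoherent.linksLarge {W : Type*} {G : SimpleGraph W} {γ : ℝ} {m : ℕ}
    (h : G.IsCoherent γ γ) (hm : γ ≤ m) : G.LinksLarge m := by
  intro A B hAB hA hB
  by_contra! hcon
  refine h ⟨A, B, ⟨Finset.disjoint_coe.2 hAB, fun a ha b hb => hcon a ha b hb⟩, ?_, ?_⟩
  · rw [Set.ncard_coe_finset]
    exact hm.trans (by exact_mod_cast hA)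
  · rw [Set.ncard_coe_finset]
    exact hm.trans (by exact_mod_cast hB)

theorem card_nbIn_univ {W : Type*} [Fintype W] (G : SimpleGraph W) (v : W) :
    #(G.nbIn univ v) = (G.neighborSet v).ncard := by
  rw [← Set.ncard_coe_finset]
  congr 1
  ext w
  simp [mem_nbIn]

/-- Here `m` is the coherence threshold rounded up to an integer at least two, and `r = ⌈q ^ ρ⌉`.
The spare unit in `μ` and the extra factor `q` in the last bound absorb the rounding. -/
theorem IsCoherent.exists_isSetting {W : Type u} [Fintype W] {G : SimpleGraph W} {ε c q : ℝ}
    {E k μ ρ : ℕ}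
    (h : G.IsCoherent (ε * (Fintype.card W : ℝ) ^ (1 - c)) (ε * (Fintype.card W : ℝ) ^ (1 - c)))
    (hε0 : 0 < ε) (hε : ε ≤ 1 / 2) (hc : c ≤ 1) (hq : 2 ≤ q) (hqE : (Fintype.card W : ℝ) = q ^ E)
    (hμ : (E : ℝ) * (1 - c) + 1 ≤ μ) (hμρ : μ ≤ (k - 1) * ρ) :
    ∃ r m : ℕ, G.IsSetting q E k r m ∧ (r * m : ℝ) ≤ q ^ (μ + ρ + 1) := by
  have hq0 : 0 < q := by linarith
  have hq1 : 1 ≤ q := by linarith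
  have hμ1 : 1 ≤ μ := by
    have h1 : (0 : ℝ) ≤ E * (1 - c) := mul_nonneg (Nat.cast_nonneg _) (by linarith)
    have h2 : (1 : ℝ) ≤ μ := by linarith
    exact_mod_cast h2
  have hceil : ∀ y : ℝ, 1 ≤ y → (⌈y⌉₊ : ℝ) ≤ q * y := by
    intro y hy
    have h3 := Nat.ceil_lt_add_one (show 0 ≤ y by linarith)
    nlinarith
  have hn : q * (Fintype.card W : ℝ) ^ (1 - c) ≤ q ^ μ := by
    rw [hqE, ← Real.rpow_natCast q E, ← Real.rpow_mul hq0.le, ← Real.rpow_natCast q μ]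
    calc q * q ^ ((E : ℝ) * (1 - c)) = q ^ ((E : ℝ) * (1 - c) + 1) := by
          rw [Real.rpow_add_one hq0.ne', mul_comm]
      _ ≤ _ := Real.rpow_le_rpow_of_exponent_le hq1 hμ
  have hμq : q ≤ q ^ μ := le_self_pow₀ hq1 (by omega)
  have hm : ((max 2 ⌈ε * (Fintype.card W : ℝ) ^ (1 - c)⌉₊ : ℕ) : ℝ) ≤ q ^ μ := by
    have h3 : 0 ≤ (Fintype.card W : ℝ) ^ (1 - c) := Real.rpow_nonneg (Nat.cast_nonneg _) _
    have h4 := Nat.ceil_lt_add_one (mul_nonneg hε0.le h3)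
    have h5 : ε * (Fintype.card W : ℝ) ^ (1 - c) ≤ 1 / 2 * (Fintype.card W : ℝ) ^ (1 - c) :=
      mul_le_mul_of_nonneg_right hε h3
    have h6 : 2 * (Fintype.card W : ℝ) ^ (1 - c) ≤ q * (Fintype.card W : ℝ) ^ (1 - c) :=
      mul_le_mul_of_nonneg_right hq h3
    rw [Nat.cast_max]
    refine max_le (by push_cast; linarith) (h4.le.trans ?_)
    linarith
  have hρ : (1 : ℝ) ≤ q ^ ρ := one_le_pow₀ hq1
  refine ⟨⌈q ^ ρ⌉₊, max 2 ⌈ε * (Fintype.card W : ℝ) ^ (1 - c)⌉₊, ⟨hqE.le, h.linksLarge ?_,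
    le_max_left _ _, Nat.one_le_ceil_iff.2 (by linarith), ?_⟩, ?_⟩
  · exact (Nat.le_ceil _).trans (by exact_mod_cast le_max_right _ _)
  · have h1 : (q ^ ρ) ^ (k - 1) ≤ (⌈q ^ ρ⌉₊ : ℝ) ^ (k - 1) :=
      pow_le_pow_left₀ (by linarith) (Nat.le_ceil _) _
    have h2 := hm.trans (le_trans (by
      rw [← pow_mul]
      exact pow_le_pow_right₀ hq1 (by rwa [mul_comm])) h1)
    exact_mod_cast h2
  · calc _ ≤ (q * q ^ ρ) * q ^ μ :=
          mul_le_mul (hceil _ hρ) hm (Nat.cast_nonneg _) (by positivity)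
      _ = _ := by ring

/-- For `n = q ^ E` and `x = q ^ (-D)`, the blockade has sets of at least `κ q ^ (D + μ + ρ)`
vertices and degrees at most `16 N q ^ (μ + ρ)`. Of the gap `q ^ D`, one factor `q` absorbs `16 N`
and one absorbs `κ`; the sets then exceed `τ = δ = q ^ (μ + ρ + 1)` by `q ^ lam`. This is why `D =
lam + 2`. -/
theorem SetBuildable.exists_forall_isIndContained {β k : ℕ} (hH : H.SetBuildable β univ)
    (hk : 3 * k ≤ β) (hβ : 7 ≤ β) {c : ℝ} (hkc : 1 < k * c) (hc : c ≤ 1) :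
    ∃ ε : ℝ, 0 < ε ∧ ∀ (W : Type u) [Fintype W] (G : SimpleGraph W), 1 < Nat.card W →
      G.IsSparse ε →
      G.IsCoherent (ε * (Nat.card W : ℝ) ^ (1 - c)) (ε * (Nat.card W : ℝ) ^ (1 - c)) →
      H.IsIndContained G := by
  obtain ⟨t, x₁, hx₁, hdense⟩ := (hH.leafBuildable hβ).denseClaim.{u}.exists_blockade
  obtain ⟨lam, hsparse⟩ := hH.blockadeClaim.{u} hk
  set D := lam + 2 with hD
  obtain ⟨E, μ, ρ, hμ, hE, hμρ⟩ := exists_exponents hkc hc (D * t + D)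
  obtain ⟨N, q₀, hsparse⟩ := hsparse E
  obtain ⟨ε₁, κ, hε₁, hκ, hdense⟩ := hdense N
  have hc0 : 0 ≤ c := by
    by_contra! h
    have : (0 : ℝ) ≤ k := Nat.cast_nonneg _
    nlinarith
  -- `Q` collects all lower bounds wanted for `q`. Since `n > ε⁻¹ ≥ Q ^ E`, they hold.
  set Q := max 3 (max q₀ (max (16 * N : ℝ) (max x₁⁻¹ κ⁻¹))) with hQ
  have hQ0 : 0 < Q := lt_of_lt_of_le (by norm_num) (le_max_left _ _)
  have hE0 : E ≠ 0 := by omega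
  refine ⟨min (1 / 2) (min ε₁ (Q ^ E)⁻¹), by positivity, ?_⟩
  set ε := min (1 / 2) (min ε₁ (Q ^ E)⁻¹) with hε
  have hε0 : 0 < ε := by positivity
  have hε2 : ε ≤ 1 / 2 := min_le_left _ _
  intro W _ G hW hs hcoh
  have hn := inv_lt_card_of_isSparse_of_isCoherent hε0 hε2 hc0 hW hs hcoh
  rw [Nat.card_eq_fintype_card] at hn hcoh
  set n : ℝ := (Fintype.card W : ℝ) with hn_def
  have hn0 : 0 ≤ n := Nat.cast_nonneg _
  set q := n ^ ((E : ℝ)⁻¹) with hq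
  have hqE : q ^ E = n := Real.rpow_inv_natCast_pow hn0 hE0
  have hq0 : 0 ≤ q := Real.rpow_nonneg hn0 _
  have hQq : Q ≤ q := by
    have h1 : Q ^ E ≤ q ^ E := by
      rw [hqE]
      refine le_trans ?_ hn.le
      rw [le_inv_comm₀ (pow_pos hQ0 _) hε0]
      exact (min_le_right _ _).trans (min_le_right _ _)
    exact le_of_pow_le_pow_left₀ hE0 hq0 h1
  have hq3 : 3 ≤ q := (le_max_left _ _).trans hQq
  have hQ1 := (le_max_right _ _).trans hQq
  have hqq₀ : q₀ ≤ q := (le_max_left _ _).trans hQ1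
  have hQ2 := (le_max_right _ _).trans hQ1
  have hqN : 16 * (N : ℝ) ≤ q := (le_max_left _ _).trans hQ2
  have hQ3 := (le_max_right _ _).trans hQ2
  have hqx : x₁⁻¹ ≤ q := (le_max_left _ _).trans hQ3
  have hqκ : 1 ≤ κ * q := by
    have h1 : κ⁻¹ ≤ q := (le_max_right _ _).trans hQ3
    rwa [inv_le_iff_one_le_mul₀' hκ] at h1
  have hqpos : 0 < q := by linarith
  have hq1 : 1 ≤ q := by linarith
  set x := (q ^ D)⁻¹ with hx
  have hx0 : 0 < x := inv_pos.2 (pow_pos hqpos _)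
  have hxx₁ : x ≤ x₁ := by
    rw [hx, inv_le_comm₀ (pow_pos hqpos _) hx₁]
    exact hqx.trans (le_self_pow₀ hq1 (by omega))
  have hxt : x ^ t * n = q ^ (D + μ + ρ) := by
    rw [← hqE, hE, hx, inv_pow, ← pow_mul, show D * t + D + μ + ρ = D * t + (D + μ + ρ) by ring,
      pow_add, inv_mul_cancel_left₀ (pow_pos hqpos _).ne']
  have hxt' : x ^ (t + 1) * n = q ^ (μ + ρ) := by
    rw [pow_succ, mul_right_comm, hxt, hx, add_assoc, pow_add, mul_comm,
      inv_mul_cancel_left₀ (pow_pos hqpos _).ne']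
  by_contra hfree
  have hσ : q ^ lam * q ^ (μ + ρ + 1) ≤ κ * (x ^ t * n) := by
    rw [hxt, ← pow_add, show D + μ + ρ = lam + (μ + ρ + 1) + 1 by omega, pow_succ']
    have h1 : 0 ≤ q ^ (lam + (μ + ρ + 1)) := by positivity
    nlinarith
  obtain ⟨C, hdisj, hcard, hdeg⟩ := hdense W G x hx0 hxx₁ (fun v => by
      rw [card_nbIn_univ]
      have h1 := hs v
      rw [Nat.card_eq_fintype_card] at h1
      exact h1.le.trans (mul_le_mul_of_nonneg_right
        ((min_le_right _ _).trans (min_le_left _ _)) hn0))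
    (le_trans (by rw [← pow_add]; exact one_le_pow₀ hq1) hσ) hfree
  -- The colour `0` outside the blockade is a dummy.
  let col : W → ℕ := fun v => if h : ∃ i < N, v ∈ C i then h.choose else 0
  have hcol : ∀ i < N, ∀ v ∈ C i, col v = i := by
    intro i hi v hv
    have hex : ∃ i < N, v ∈ C i := ⟨i, hi, hv⟩
    change (if h : ∃ i < N, v ∈ C i then h.choose else 0) = i
    rw [dif_pos hex]
    obtain ⟨h1, h2⟩ := hex.choose_spec
    rcases lt_trichotomy hex.choose i with h3 | h3 | h3
    · exact absurd hv (Finset.disjoint_left.1 (hdisj _ _ h3 hi) h2)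
    · exact h3
    · exact absurd h2 (Finset.disjoint_left.1 (hdisj _ _ h3 h1) hv)
  have hB : G.IsBlockade col C (range N) (q ^ lam * q ^ (μ + ρ + 1)) (q ^ (μ + ρ + 1)) := by
    refine ⟨fun i hi => hcol i (mem_range.1 hi), fun i hi => hσ.trans (hcard i (mem_range.1 hi)),
      fun i hi v hv j hj hji => (hdeg i (mem_range.1 hi) j (mem_range.1 hj) hji v hv).trans ?_⟩
    rw [hxt', pow_succ']
    exact mul_le_mul_of_nonneg_right hqN (by positivity)
  obtain ⟨r, m, hset, hrm⟩ := hcoh.exists_isSetting hε0 hε2 hc (by linarith) hqE.symm hμ hμρ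
  obtain ⟨φ, hφ, -⟩ := hsparse W G col C (range N) q (q ^ (μ + ρ + 1)) (q ^ (μ + ρ + 1)) r m hqq₀
    hset (one_le_pow₀ hq1) le_rfl hrm hB (by rw [card_range])
  exact hfree hφ.isIndContained

end SimpleGraph

namespace SimpleGraph

theorem IsBuildable.setBuildable_univ {V : Type*} [Fintype V] {β : ℕ} {H : SimpleGraph V}
    (h : H.IsBuildable β) : H.SetBuildable β Finset.univ := by
  obtain ⟨S, hS, hSb⟩ := h.exists_setBuildable (Embedding.refl : H ↪g H)
  have : S = Finset.univ := by
    ext v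
    rw [← Finset.mem_coe, hS]
    simp
  rwa [this] at hSb

end SimpleGraph

theorem theorem3p3 {V : Type*} (β : ℕ) (hβ : 2 ≤ β)
    (hfloor : 0 < ⌊((β : ℝ) - 3) / 3⌋)
    (H : SimpleGraph V) (hH : H.IsBuildable β)
    (c : ℝ) (hc : 1 / (⌊((β : ℝ) - 3) / 3⌋ : ℝ) < c) :
    ∃ ε : ℝ, 0 < ε ∧
      ∀ (W : Type*) [Finite W] (G : SimpleGraph W),
        1 < Nat.card W →
        G.IsSparse ε →
        G.IsCoherent (ε * (Nat.card W : ℝ) ^ (1 - c)) (ε * (Nat.card W : ℝ) ^ (1 - c)) →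
        H.IsIndContained G := by
  rcases le_or_gt 1 c with hc1 | hc1
  · exact ⟨1 / 2, by norm_num, fun W _ G hW hs hG =>
      absurd hG (SimpleGraph.not_isCoherent_of_one_le hc1 hW hs)⟩
  have := hH.finite
  have := Fintype.ofFinite V
  have hfl := Int.floor_le (((β : ℝ) - 3) / 3)
  generalize ⌊((β : ℝ) - 3) / 3⌋ = K at hfloor hc hfl
  obtain ⟨k, rfl⟩ := Int.eq_ofNat_of_zero_le hfloor.le
  have hk : (0 : ℝ) < k := by exact_mod_cast hfloor
  rw [Int.cast_natCast] at hc hfl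
  rw [div_lt_iff₀ hk] at hc
  -- `1 < k c` with `c < 1` forces `k ≥ 2`, hence `β ≥ 9`, which covers the length seven needed in
  -- the dense regime.
  have hk1 : (1 : ℝ) < k := by nlinarith
  have hkβ : 3 * k + 3 ≤ β := by
    have h1 : 3 * (k : ℝ) + 3 ≤ β := by linarith
    exact_mod_cast h1
  have hk2 : 2 ≤ k := by exact_mod_cast hk1
  obtain ⟨ε, hε, h⟩ := hH.setBuildable_univ.exists_forall_isIndContained (k := k) (by omega)
    (by omega) (by linarith) hc1.le
  exact ⟨ε, hε, fun W _ G hW hs hG => by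
    have := Fintype.ofFinite W
    exact h W G hW hs hG⟩
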